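/- **Setting.** Let $(N^3,g_N,Z)$ be a compact Sasakian three-manifold: $Z$ is a unit length Killing field of the smooth metric $g_N$, and $\Phi(X):=\nabla_XZ$ satisfies $(\nabla_X\Phi)(Y)=g_N(Z,Y)X-g_N(X,Y)Z$. Let $\eta=g_N(Z,\cdot)$. The associated *Sasaki-type complex surface* is $M=N\times\mathbb R$ with $W=\partial/\partial t$ and the complex structure $J$ given by $J=\Phi$ on $\ker\eta$, $JZ=W$, $JW=-Z$. A tensor field on $M$ is *invariant* if its Lie derivatives along $Z$ and $W$ vanish. For an invariant Hermitian metric $g$ on $(M,J)$ put $\psi=g(Z,Z)=g(W,W)$, $\mu^Z=\psi^{-1}g(Z,\cdot)$, $\mu^W=\psi^{-1}g(W,\cdot)$, and $$g^T=g-\psi(\mu^Z\otimes\mu^Z+\mu^W\otimes\mu^W),\qquad \omega^T(X,Y)=g^T(X,JY),\qquad F^Z=d\mu^Z .$$ Put also $\omega(X,Y)=g(X,JY)$, $H=d^c\omega=-d\omega(J\cdot,J\cdot,J\cdot)$ and $H^2(X,Y)=\sum_{i,j}H(X,e_i,e_j)H(Y,e_i,e_j)$ for an orthonormal frame $(e_i)$.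 The pair $(g,f)$, with $f\in C^\infty(M)$, is a *pluriclosed steady soliton* if $g$ is Hermitian, $dd^c\omega=0$, and $$\mathrm{Rc}-\tfrac14H^2=\nabla^2f,\qquad \tfrac12 d^*H=i_{\frac12\nabla f}H .$$ **Proposition.** Let $g$ be an invariant metric on $(M,J)$ and let $(g,f)$ be a pluriclosed steady soliton. Then $$L_{J\nabla f}\,g^T=0,\qquad L_{J\nabla f}\,\omega^T=0,\qquad L_{J\nabla f}\,F^Z=0 .$$ -/

import Mathlib

open scoped Manifold ContDiff

noncomputable section

/-! ### Tensor calculus through vector fields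

A covariant tensor field of rank `k` is used as an operator that sends `k` vector fields to a
function.  All operators below are local, so identities between tensors are tested at every point
`x` on all vector fields that are smooth at `x`. -/

namespace VFCalc

variable {E : Type*} [NormedAddCommGroup E] [NormedSpace ℝ E]
  {H : Type*} [TopologicalSpace H] (I : ModelWithCorners ℝ E H)
  {M : Type*} [TopologicalSpace M] [ChartedSpace H M]

/-- Vector fields (without any regularity). -/
abbrev VF (I : ModelWithCorners ℝ E H) (M : Type*) [TopologicalSpace M] [ChartedSpace H M] :=
  (x : M) → TangentSpace I x

variable (M) in
/-- Covariant tensor fields of rank 1, as operators on vector fields. -/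
abbrev Tensor₁ := VF I M → M → ℝ

variable (M) in
/-- Covariant tensor fields of rank 2, as operators on vector fields. -/
abbrev Tensor₂ := VF I M → VF I M → M → ℝ

variable (M) in
/-- Covariant tensor fields of rank 3, as operators on vector fields. -/
abbrev Tensor₃ := VF I M → VF I M → VF I M → M → ℝ

variable (M) in
/-- Covariant tensor fields of rank 4, as operators on vector fields. -/
abbrev Tensor₄ := VF I M → VF I M → VF I M → VF I M → M → ℝ

variable {I}

/-- The vector field `X` is smooth at `x`. -/
def SmoothAt [IsManifold I ∞ M] (X : VF I M) (x : M) : Prop :=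
  ContMDiffAt I (I.prod 𝓘(ℝ, E)) ∞
    (fun y => (⟨y, X y⟩ : Bundle.TotalSpace E (TangentSpace I : M → Type _))) x

/-- The directional derivative `X u` of a function `u`. -/
def dir (X : VF I M) (u : M → ℝ) (x : M) : ℝ := mvfderiv I u x (X x)

/-- The Lie bracket `[X, Y]`. -/
def brk (X Y : VF I M) : VF I M := VectorField.mlieBracket I X Y

/-- The rank 2 tensor `T` vanishes identically. -/
def Vanishes₂ [IsManifold I ∞ M] (T : Tensor₂ I M) : Prop :=
  ∀ (x : M) (X Y : VF I M), SmoothAt X x → SmoothAt Y x → T X Y x = 0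

/-- The rank 4 tensor `T` vanishes identically. -/
def Vanishes₄ [IsManifold I ∞ M] (T : Tensor₄ I M) : Prop :=
  ∀ (x : M) (X Y Z W : VF I M), SmoothAt X x → SmoothAt Y x → SmoothAt Z x → SmoothAt W x →
    T X Y Z W x = 0

/-- Lie derivative of a rank 2 covariant tensor:
`(L_V T)(X, Y) = V (T(X, Y)) - T([V, X], Y) - T(X, [V, Y])`. -/
def lieDeriv₂ (V : VF I M) (T : Tensor₂ I M) : Tensor₂ I M := fun X Y x =>
  dir V (T X Y) x - T (brk V X) Y x - T X (brk V Y) x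

/-- Exterior derivative of a 1-form. -/
def extd₁ (α : Tensor₁ I M) : Tensor₂ I M := fun X Y x =>
  dir X (α Y) x - dir Y (α X) x - α (brk X Y) x

/-- Exterior derivative of a 2-form. -/
def extd₂ (β : Tensor₂ I M) : Tensor₃ I M := fun X Y Z x =>
  dir X (β Y Z) x + dir Y (β Z X) x + dir Z (β X Y) x
    - β (brk X Y) Z x + β (brk X Z) Y x - β (brk Y Z) X x

/-- Exterior derivative of a 3-form. -/
def extd₃ (γ : Tensor₃ I M) : Tensor₄ I M := fun X Y Z W x =>
  dir X (γ Y Z W) x - dir Y (γ X Z W) x + dir Z (γ X Y W) x - dir W (γ X Y Z) x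
    - γ (brk X Y) Z W x + γ (brk X Z) Y W x - γ (brk X W) Y Z x
    - γ (brk Y Z) X W x + γ (brk Y W) X Z x - γ (brk Z W) X Y x

variable [IsManifold I ∞ M]

variable (I M) in
/-- Smooth Riemannian metrics on `M`. -/
abbrev Metric :=
  Bundle.ContMDiffRiemannianMetric I ∞ E (TangentSpace I : M → Type _)

/-- The metric as a rank 2 tensor. -/
def Metric.tensor (g : Metric I M) : Tensor₂ I M := fun X Y x => g.inner x (X x) (Y x)

/-- The gradient of `u`: the vector with `g(∇u, w) = du(w)` for all `w`. -/
def grad (g : Metric I M) (u : M → ℝ) : VF I M := fun x =>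
  Classical.epsilon fun v : TangentSpace I x =>
    ∀ w : TangentSpace I x, g.inner x v w = mvfderiv I u x w

/-- Right-hand side of the Koszul formula for `g(∇_X Y, Z)`. -/
def koszul (g : Metric I M) (X Y Z : VF I M) (x : M) : ℝ :=
  (1 / 2) * (dir X (g.tensor Y Z) x + dir Y (g.tensor X Z) x - dir Z (g.tensor X Y) x
    + g.tensor (brk X Y) Z x - g.tensor (brk X Z) Y x - g.tensor (brk Y Z) X x)

/-- The Levi-Civita connection: `nabla g Y x v` is `∇_v Y` at `x`, the vector determined by the
Koszul formula. -/
def nabla (g : Metric I M) (Y : VF I M) (x : M) (v : TangentSpace I x) : TangentSpace I x :=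
  Classical.epsilon fun u : TangentSpace I x =>
    ∀ X Z : VF I M, SmoothAt X x → SmoothAt Z x → X x = v →
      g.inner x u (Z x) = koszul g X Y Z x

/-- The vector field `∇_X Y`. -/
def cov (g : Metric I M) (X Y : VF I M) : VF I M := fun x => nabla g Y x (X x)

/-- The curvature `R(X, Y) Z = ∇_X ∇_Y Z - ∇_Y ∇_X Z - ∇_{[X, Y]} Z`. -/
def curv (g : Metric I M) (X Y Z : VF I M) : VF I M := fun x =>
  cov g X (cov g Y Z) x - cov g Y (cov g X Z) x - cov g (brk X Y) Z x

/-- The Hessian `∇²u(X, Y) = X (Y u) - (∇_X Y) u`. -/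
def hess (g : Metric I M) (u : M → ℝ) : Tensor₂ I M := fun X Y x =>
  dir X (dir Y u) x - dir (cov g X Y) u x

/-- Covariant derivative of a rank 3 tensor. -/
def covTensor₃ (g : Metric I M) (V : VF I M) (T : Tensor₃ I M) : Tensor₃ I M := fun X Y Z x =>
  dir V (T X Y Z) x - T (cov g V X) Y Z x - T X (cov g V Y) Z x - T X Y (cov g V Z) x

/-- `e` consists of vector fields which are smooth at `x`, and their values at `x` are an
orthonormal basis of the tangent space. -/
def IsOrthonormalAt (g : Metric I M) (x : M) {n : ℕ} (e : Fin n → VF I M) : Prop :=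
  n = Module.finrank ℝ E ∧ (∀ i, SmoothAt (e i) x) ∧
    ∀ i j, g.inner x (e i x) (e j x) = if i = j then 1 else 0

/-- Ricci curvature at `x`, traced in a frame `e` which is orthonormal at `x`. -/
def ricci (g : Metric I M) {n : ℕ} (e : Fin n → VF I M) : Tensor₂ I M := fun X Y x =>
  ∑ i, g.inner x (curv g (e i) X Y x) (e i x)

/-- `T²(X, Y) = ∑ T(X, eᵢ, eⱼ) T(Y, eᵢ, eⱼ)` for a 3-form `T`. -/
def sq₃ (T : Tensor₃ I M) {n : ℕ} (e : Fin n → VF I M) : Tensor₂ I M := fun X Y x =>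
  ∑ i, ∑ j, T X (e i) (e j) x * T Y (e i) (e j) x

/-- The codifferential of a 3-form, `d*T(X, Y) = -∑ (∇_{eᵢ} T)(eᵢ, X, Y)`. -/
def codiff₃ (g : Metric I M) (T : Tensor₃ I M) {n : ℕ} (e : Fin n → VF I M) : Tensor₂ I M :=
  fun X Y x => -∑ i, covTensor₃ g (e i) T (e i) X Y x

/-! ### Hermitian metrics and pluriclosed steady solitons -/

/-- `J X` for a field of endomorphisms `J`. -/
def app (J : (x : M) → TangentSpace I x → TangentSpace I x) (X : VF I M) : VF I M :=
  fun x => J x (X x)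

/-- The metric `g` is compatible with the (almost) complex structure `J`. -/
def IsHermitian (J : (x : M) → TangentSpace I x → TangentSpace I x) (g : Metric I M) : Prop :=
  ∀ (x : M) (v w : TangentSpace I x), g.inner x (J x v) (J x w) = g.inner x v w

/-- The Kähler form `ω(X, Y) = g(X, J Y)`. -/
def kahlerForm (J : (x : M) → TangentSpace I x → TangentSpace I x) (g : Metric I M) :
    Tensor₂ I M := fun X Y => g.tensor X (app J Y)

/-- The torsion 3-form `H = dᶜω`, where for the `(1,1)`-form `ω` one has
`dᶜω = i(∂̄ - ∂)ω = -dω(J·, J·, J·)`. -/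
def torsionForm (J : (x : M) → TangentSpace I x → TangentSpace I x) (g : Metric I M) :
    Tensor₃ I M := fun X Y Z x =>
  -extd₂ (kahlerForm J g) (app J X) (app J Y) (app J Z) x

/-- `g` is a pluriclosed Hermitian metric: `ddᶜω = 2i∂∂̄ω = 0`. -/
def IsPluriclosed (J : (x : M) → TangentSpace I x → TangentSpace I x) (g : Metric I M) : Prop :=
  IsHermitian J g ∧ Vanishes₄ (extd₃ (torsionForm J g))

/-- `(g, f)` is a pluriclosed steady soliton: `g` is pluriclosed, `f` is smooth, and
`Rc - ¼ H² = ∇²f`, `½ d*H = i_{½∇f} H`.  Traces may be taken in any frame which is orthonormal at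
the point in question. -/
structure IsSteadySoliton (J : (x : M) → TangentSpace I x → TangentSpace I x)
    (g : Metric I M) (f : M → ℝ) : Prop where
  pluriclosed : IsPluriclosed J g
  smooth : ContMDiff I 𝓘(ℝ, ℝ) ∞ f
  ricci_eq : ∀ (x : M) (n : ℕ) (e : Fin n → VF I M), IsOrthonormalAt g x e →
    ∀ X Y : VF I M, SmoothAt X x → SmoothAt Y x →
      ricci g e X Y x - (1 / 4) * sq₃ (torsionForm J g) e X Y x = hess g f X Y x
  torsion_eq : ∀ (x : M) (n : ℕ) (e : Fin n → VF I M), IsOrthonormalAt g x e →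
    ∀ X Y : VF I M, SmoothAt X x → SmoothAt Y x →
      (1 / 2) * codiff₃ g (torsionForm J g) e X Y x
        = torsionForm J g (fun y => (1 / 2 : ℝ) • grad g f y) X Y x

/-! ### Sasakian manifolds -/

variable (I M) in
/-- A Sasakian structure: a metric `g` and a unit length Killing field `Z` such that
`Φ(X) = ∇_X Z` satisfies `(∇_X Φ)(Y) = g(Z, Y) X - g(X, Y) Z`. -/
structure SasakianStructure where
  metric : Metric I M
  reeb : VF I M
  reeb_smooth : ∀ x, SmoothAt reeb x
  unit_length : ∀ x, metric.inner x (reeb x) (reeb x) = 1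
  killing : Vanishes₂ (lieDeriv₂ reeb metric.tensor)
  sasaki : ∀ (x : M) (X Y : VF I M), SmoothAt X x → SmoothAt Y x →
    cov metric X (cov metric Y reeb) x - cov metric (cov metric X Y) reeb x
      = metric.inner x (reeb x) (Y x) • X x - metric.inner x (X x) (Y x) • reeb x

end VFCalc

/-! ### Sasaki-type complex surfaces -/

namespace SasakiType

open VFCalc

variable {N : Type*} [TopologicalSpace N] [ChartedSpace (EuclideanSpace ℝ (Fin 3)) N]
  [IsManifold (𝓡 3) ∞ N]

/-- The model with corners of the cylinder `N × ℝ` over a 3-manifold `N`. -/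
abbrev cylModel : ModelWithCorners ℝ (EuclideanSpace ℝ (Fin 3) × ℝ)
    (ModelProd (EuclideanSpace ℝ (Fin 3)) ℝ) := (𝓡 3).prod 𝓘(ℝ, ℝ)

/-- The complex structure of the cylinder: `J = Φ` on the contact distribution `ker η`, `J Z = W`
and `J W = -Z`, where `W = ∂/∂t`.  As `Φ Z = 0`, for a tangent vector `(v, s)` this reads
`J(v, s) = (Φ v - s Z, η(v))`. -/
def J (S : SasakianStructure (𝓡 3) N) (p : N × ℝ) (V : TangentSpace cylModel p) :
    TangentSpace cylModel p :=
  let v : TangentSpace (𝓡 3) p.1 := V.1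
  let s : ℝ := V.2
  ((nabla S.metric S.reeb p.1 v - s • S.reeb p.1, S.metric.inner p.1 (S.reeb p.1) v) :
    EuclideanSpace ℝ (Fin 3) × ℝ)

/-- The lift of the Reeb field to the cylinder. -/
def Z (S : SasakianStructure (𝓡 3) N) : VF cylModel (N × ℝ) :=
  fun p => ((S.reeb p.1, 0) : EuclideanSpace ℝ (Fin 3) × ℝ)

variable (N) in
/-- The vector field `W = ∂/∂t` on the cylinder. -/
def W : VF cylModel (N × ℝ) :=
  fun _ => ((0, 1) : EuclideanSpace ℝ (Fin 3) × ℝ)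

/-- A rank 2 tensor on the cylinder is invariant if its Lie derivatives along `Z` and `W`
vanish. -/
def IsInvariant (S : SasakianStructure (𝓡 3) N) (T : Tensor₂ cylModel (N × ℝ)) : Prop :=
  Vanishes₂ (lieDeriv₂ (Z S) T) ∧ Vanishes₂ (lieDeriv₂ (W N) T)

/-- The fibre length function `ψ = g(Z, Z)`. -/
def psi (S : SasakianStructure (𝓡 3) N) (g : Metric cylModel (N × ℝ)) : N × ℝ → ℝ :=
  g.tensor (Z S) (Z S)

/-- The component `μ^Z = ψ⁻¹ g(Z, ·)` of the connection form. -/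
def muZ (S : SasakianStructure (𝓡 3) N) (g : Metric cylModel (N × ℝ)) :
    Tensor₁ cylModel (N × ℝ) := fun X p => (psi S g p)⁻¹ * g.tensor (Z S) X p

/-- The component `μ^W = ψ⁻¹ g(W, ·)` of the connection form. -/
def muW (S : SasakianStructure (𝓡 3) N) (g : Metric cylModel (N × ℝ)) :
    Tensor₁ cylModel (N × ℝ) := fun X p => (psi S g p)⁻¹ * g.tensor (W N) X p

/-- The transverse metric `g^T = g - ψ (μ^Z ⊗ μ^Z + μ^W ⊗ μ^W)`. -/
def gT (S : SasakianStructure (𝓡 3) N) (g : Metric cylModel (N × ℝ)) :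
    Tensor₂ cylModel (N × ℝ) := fun X Y p =>
  g.tensor X Y p - psi S g p * (muZ S g X p * muZ S g Y p + muW S g X p * muW S g Y p)

/-- The transverse Kähler form `ω^T(X, Y) = g^T(X, J Y)`. -/
def omegaT (S : SasakianStructure (𝓡 3) N) (g : Metric cylModel (N × ℝ)) :
    Tensor₂ cylModel (N × ℝ) := fun X Y => gT S g X (app (J S) Y)

/-- The curvature component `F^Z = dμ^Z`. -/
def FZ (S : SasakianStructure (𝓡 3) N) (g : Metric cylModel (N × ℝ)) :
    Tensor₂ cylModel (N × ℝ) := extd₁ (muZ S g)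

end SasakiType

end

/-! The fields Z and W = JZ are commuting Killing fields, so M is locally a holomorphic torus
fibration over a surface. In a frame e0 = Z, e1 = JZ, e2, e3 = J e2 with e2 a unit horizontal field,
the Killing equations force all brackets into a form governed by two families of functions: θ, the
curvature of the connection forms, and σ, which will be a connection form. Write A for the area form
of e2, e3 and ψ for the fibre length.

The first point is that ψ is locally constant. The torsion H has components θψ and the derivatives
of ψ. Evaluating dH = 0 on the full frame, the θ terms drop by the Jacobi identity, and there
remains a linear second order equation for ψ without zeroth order term (`IsFibreFrame.harmonic`). As
ψ does not depend on t, it is a function on the compact N, and the strong maximum principle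
(`eventually_eq_of_eventually_le`, proved by the Hopf barrier) makes it constant on components
(`eventually_psi_eq`). After multiplying Z by a constant one may take ψ = 1 near any given point.

If ψ = 1 then H = θ ∧ A, and the Bismut connection ∇ + ½H annihilates e0, e1 and rotates e2, e3 with
connection form σ. Its curvature is dσ ⊗ A (`bismut_algebra`, `ricci_bismut`). Subtracting the two
soliton equations gives a single one: the Bismut Ricci tensor equals the Bismut Hessian of f.
Reading off components (`soliton_table`): e0 f and e1 f are constant; the trace-free part of the
horizontal Hessian vanishes; and, with the Jacobi identity, dθ0 = -θ0 df in horizontal directions.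

The conclusion follows. Put V = J∇f. The vanishing trace-free part says that V acts on the
horizontal coframe by an infinitesimal rotation (`exists_rotation`), so it preserves the horizontal
metric, which is g^T, and the horizontal area form, which is -ω^T. Moreover V θ0 = 0, because θ0 is
constant along the fibres and the horizontal part of J∇f is orthogonal to ∇f (`dir_app_grad_theta`).
Since F^Z is a constant multiple of θ0 A, it is preserved as well. -/

noncomputable section

set_option linter.unusedSectionVars false

/-! ### Derivatives, smooth vector fields and Lie brackets. -/

namespace VFCalc

open VectorField Bundle Topology

variable {E : Type*} [NormedAddCommGroup E] [NormedSpace ℝ E]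
  {H : Type*} [TopologicalSpace H] {I : ModelWithCorners ℝ E H}
  {M : Type*} [TopologicalSpace M] [ChartedSpace H M]

/-- The vector field `X` is differentiable at `x`. -/
abbrev DiffAt [IsManifold I ∞ M] (X : VF I M) (x : M) : Prop :=
  MDifferentiableAt I (I.prod 𝓘(ℝ, E))
    (fun y => (⟨y, X y⟩ : Bundle.TotalSpace E (TangentSpace I : M → Type _))) x

variable (I) in
/-- The function `u` is smooth at `x`. -/
abbrev FnSmoothAt (u : M → ℝ) (x : M) : Prop := ContMDiffAt I 𝓘(ℝ, ℝ) ∞ u x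

variable (I) in
/-- The function `u` is differentiable at `x`. -/
abbrev FnDiffAt (u : M → ℝ) (x : M) : Prop := MDifferentiableAt I 𝓘(ℝ, ℝ) u x

theorem FnSmoothAt.diffAt {u : M → ℝ} {x : M} (h : FnSmoothAt I u x) : FnDiffAt I u x :=
  ContMDiffAt.mdifferentiableAt h (by simp)

section dir

variable {X Y : VF I M} {u v : M → ℝ} {x : M}

theorem dir_apply (X : VF I M) (u : M → ℝ) (x : M) : dir X u x = mvfderiv I u x (X x) := rfl

theorem dir_congr_left {X' : VF I M} (h : X x = X' x) : dir X u x = dir X' u x := by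
  simp [dir, h]

theorem dir_congr {v : M → ℝ} (h : u =ᶠ[𝓝 x] v) : dir X u x = dir X v x := by
  simp only [dir, mvfderiv]
  rw [h.mfderiv_eq]
  rw [h.self_of_nhds]

theorem dir_congr_on {U : Set M} (hU : IsOpen U) (hx : x ∈ U) (h : ∀ y ∈ U, u y = v y) :
    dir X u x = dir X v x :=
  dir_congr (Filter.eventuallyEq_of_mem (hU.mem_nhds hx) h)

@[simp] theorem dir_const (c : ℝ) : dir X (fun _ => c) x = 0 := by
  simp [dir, mvfderiv_const]

theorem dir_add (hu : FnDiffAt I u x) (hv : FnDiffAt I v x) :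
    dir X (fun y => u y + v y) x = dir X u x + dir X v x := by
  simp [dir, mvfderiv_fun_add hu hv]

theorem dir_sub (hu : FnDiffAt I u x) (hv : FnDiffAt I v x) :
    dir X (fun y => u y - v y) x = dir X u x - dir X v x := by
  simp [dir, mvfderiv_fun_sub hu hv]

theorem dir_neg : dir X (fun y => -u y) x = -dir X u x := by
  simp [dir, mvfderiv_fun_neg]

theorem dir_mul (hu : FnDiffAt I u x) (hv : FnDiffAt I v x) :
    dir X (fun y => u y * v y) x = dir X u x * v x + u x * dir X v x := by
  simp [dir, mvfderiv_fun_mul hu hv]; ring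

theorem dir_const_mul (c : ℝ) (hv : FnDiffAt I v x) :
    dir X (fun y => c * v y) x = c * dir X v x := by
  rw [dir_mul mdifferentiableAt_const hv]; simp

end dir

variable [IsManifold I ∞ M]

theorem SmoothAt.diffAt {X : VF I M} {x : M} (h : SmoothAt X x) : DiffAt X x :=
  ContMDiffAt.mdifferentiableAt h (by simp)

theorem SmoothAt.eventually_diffAt {X : VF I M} {x : M} (h : SmoothAt X x) :
    ∀ᶠ y in 𝓝 x, DiffAt X y := by
  have h1 : ContMDiffAt I (I.prod 𝓘(ℝ, E)) 1
      (fun y => (⟨y, X y⟩ : Bundle.TotalSpace E (TangentSpace I : M → Type _))) x :=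
    ContMDiffAt.of_le h (by simp)
  have : IsManifold (I.prod 𝓘(ℝ, E)) 1
    (Bundle.TotalSpace E (TangentSpace I : M → Type _)) := inferInstance
  filter_upwards [(contMDiffAt_iff_contMDiffAt_nhds (by simp)).1 h1] with y hy
  exact hy.mdifferentiableAt one_ne_zero

/-- The passage from vectors to fields: an identity known for fields smooth at a point becomes an
identity between tangent vectors. The whole neighbourhood is needed when the extension is
differentiated more than once. -/
theorem exists_smooth_extension {x : M} (v : TangentSpace I x) :
    ∃ (X : VF I M) (U : Set M), IsOpen U ∧ x ∈ U ∧ (∀ y ∈ U, SmoothAt X y) ∧ X x = v := by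
  obtain ⟨s, hs, h⟩ := FiberBundle.exists_contMDiffOn_extend (k := ∞) I E
    (V := (TangentSpace I : M → Type _)) v
  obtain ⟨U, hUs, hU, hx⟩ := mem_nhds_iff.1 hs
  refine ⟨FiberBundle.extend E v, U, hU, hx, fun y hy => ?_, by simp⟩
  exact (h.mono hUs).contMDiffAt (hU.mem_nhds hy)

theorem exists_smoothAt_extension {x : M} (v : TangentSpace I x) :
    ∃ X : VF I M, SmoothAt X x ∧ X x = v := by
  obtain ⟨X, U, -, hx, h, hv⟩ := exists_smooth_extension v
  exact ⟨X, h x hx, hv⟩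

section smooth

variable {X Y : VF I M} {u v : M → ℝ} {x : M}

theorem SmoothAt.add (hX : SmoothAt X x) (hY : SmoothAt Y x) :
    SmoothAt (fun y => X y + Y y) x := ContMDiffAt.add_section hX hY

theorem SmoothAt.sub (hX : SmoothAt X x) (hY : SmoothAt Y x) :
    SmoothAt (fun y => X y - Y y) x := ContMDiffAt.sub_section hX hY

theorem SmoothAt.smul (hu : FnSmoothAt I u x) (hX : SmoothAt X x) :
    SmoothAt (fun y => u y • X y) x := ContMDiffAt.smul_section hu hX

theorem SmoothAt.const_smul (c : ℝ) (hX : SmoothAt X x) :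
    SmoothAt (fun y => c • X y) x := ContMDiffAt.const_smul_section hX

theorem SmoothAt.sum {ι : Type*} {s : Finset ι} {F : ι → VF I M}
    (h : ∀ i ∈ s, SmoothAt (F i) x) : SmoothAt (fun y => ∑ i ∈ s, F i y) x :=
  ContMDiffAt.sum_section h

theorem SmoothAt.congr (hX : SmoothAt X x) (h : Y =ᶠ[𝓝 x] X) : SmoothAt Y x :=
  ContMDiffAt.congr_of_eventuallyEq hX (h.mono fun y hy => by simp [hy])

theorem SmoothAt.congr_on {U : Set M} (hU : IsOpen U) (hx : x ∈ U) (hX : SmoothAt X x)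
    (h : ∀ y ∈ U, Y y = X y) : SmoothAt Y x :=
  hX.congr (Filter.eventuallyEq_of_mem (hU.mem_nhds hx) h)

theorem DiffAt.smul (hu : FnDiffAt I u x) (hX : DiffAt X x) :
    DiffAt (fun y => u y • X y) x := MDifferentiableAt.smul_section hu hX

theorem DiffAt.sum {ι : Type*} {s : Finset ι} {F : ι → VF I M}
    (h : ∀ i ∈ s, DiffAt (F i) x) : DiffAt (fun y => ∑ i ∈ s, F i y) x :=
  MDifferentiableAt.sum_section h

theorem DiffAt.congr (hX : DiffAt X x) (h : Y =ᶠ[𝓝 x] X) : DiffAt Y x :=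
  MDifferentiableAt.congr_of_eventuallyEq hX (h.mono fun y hy => by simp [hy])

end smooth

section metric

variable (g : Metric I M) {X Y : VF I M} {x : M}

theorem Metric.smoothAt_tensor (hX : SmoothAt X x) (hY : SmoothAt Y x) :
    FnSmoothAt I (g.tensor X Y) x := by
  have h : ContMDiffAt I (I.prod 𝓘(ℝ)) ∞
      (fun m => TotalSpace.mk' ℝ (E := Bundle.Trivial M ℝ) m (g.inner m (X m) (Y m))) x :=
    ContMDiffAt.clm_bundle_apply₂ (F₁ := E) (F₂ := E) g.contMDiff.contMDiffAt hX hY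
  simp only [contMDiffAt_totalSpace] at h
  exact h.2

theorem Metric.diffAt_tensor (hX : DiffAt X x) (hY : DiffAt Y x) :
    FnDiffAt I (g.tensor X Y) x := by
  have h : MDifferentiableAt I (I.prod 𝓘(ℝ))
      (fun m => TotalSpace.mk' ℝ (E := Bundle.Trivial M ℝ) m (g.inner m (X m) (Y m))) x :=
    MDifferentiableAt.clm_bundle_apply₂ (F₁ := E) (F₂ := E)
      (g.contMDiff.contMDiffAt.mdifferentiableAt (by simp)) hX hY
  simp only [mdifferentiableAt_totalSpace] at h
  exact h.2

theorem Metric.symm_apply (v w : TangentSpace I x) : g.inner x v w = g.inner x w v :=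
  g.symm x v w

theorem Metric.tensor_comm (X Y : VF I M) : g.tensor X Y = g.tensor Y X :=
  funext fun y => g.symm y _ _

variable {g} in
theorem Metric.eq_zero_of_inner_self {v : TangentSpace I x} (h : g.inner x v v = 0) : v = 0 := by
  by_contra hv
  exact (g.pos x v hv).ne' h

variable {g} in
theorem Metric.ext_inner {v w : TangentSpace I x}
    (h : ∀ z : TangentSpace I x, g.inner x v z = g.inner x w z) : v = w := by
  have : g.inner x (v - w) (v - w) = 0 := by simp [h]
  exact sub_eq_zero.1 (Metric.eq_zero_of_inner_self this)

end metric

section bracket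

variable [CompleteSpace E] {X Y V : VF I M} {u v : M → ℝ} {x : M}

theorem brk_swap (X Y : VF I M) (x : M) : brk X Y x = -brk Y X x :=
  mlieBracket_swap_apply

theorem brk_self (X : VF I M) (x : M) : brk X X x = 0 :=
  have key : ∀ v : E, v = -v → v = 0 := fun v hv => by
    have h2 : (2 : ℝ) • v = 0 := by rw [two_smul]; nth_rewrite 2 [hv]; simp
    simpa using h2
  key _ (brk_swap X X x)

theorem brk_congr {X' Y' : VF I M} (hX : X =ᶠ[𝓝 x] X') (hY : Y =ᶠ[𝓝 x] Y') :
    brk X Y x = brk X' Y' x :=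
  Filter.EventuallyEq.mlieBracket_vectorField_eq hX hY

theorem brk_add_right (hX : DiffAt X x) (hY : DiffAt Y x) :
    brk V (fun y => X y + Y y) x = brk V X x + brk V Y x :=
  mlieBracket_add_right (V := V) hX hY

theorem brk_add_left (hX : DiffAt X x) (hY : DiffAt Y x) :
    brk (fun y => X y + Y y) V x = brk X V x + brk Y V x :=
  mlieBracket_add_left (W := V) hX hY

theorem brk_smul_right (hu : FnDiffAt I u x) (hX : DiffAt X x) :
    brk V (fun y => u y • X y) x = dir V u x • X x + u x • brk V X x :=
  mlieBracket_smul_right (V := V) hu hX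

theorem brk_smul_left (hu : FnDiffAt I u x) (hX : DiffAt X x) :
    brk (fun y => u y • X y) V x = -(dir V u x • X x) + u x • brk X V x := by
  rw [brk_swap, brk_smul_right hu hX, brk_swap V X]
  simp [add_comm]

theorem brk_sum_right {ι : Type*} {s : Finset ι} {F : ι → VF I M}
    (h : ∀ i ∈ s, DiffAt (F i) x) :
    brk V (fun y => ∑ i ∈ s, F i y) x = ∑ i ∈ s, brk V (F i) x := by
  classical
  induction s using Finset.induction_on with
  | empty =>
    simp only [Finset.sum_empty]
    exact congrFun (mlieBracket_zero_right (I := I) (W := V)) x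
  | insert i s hi ih =>
    simp only [Finset.sum_insert hi]
    rw [brk_add_right (h i (by simp)) (DiffAt.sum fun j hj => h j (by simp [hj])),
      ih fun j hj => h j (by simp [hj])]

theorem SmoothAt.brk (hX : SmoothAt X x) (hY : SmoothAt Y x) : SmoothAt (brk X Y) x := by
  have : IsManifold I ((⊤ : ℕ∞) + 1 : ℕ∞ω) M := inferInstanceAs (IsManifold I ∞ M)
  have : IsManifold I (minSmoothness ℝ 2) M := by
    rw [minSmoothness_of_isRCLikeNormedField]; infer_instance
  exact ContMDiffAt.mlieBracket_vectorField (m := ⊤) (n := ⊤) hX hY (by simp)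

theorem brk_jacobi (hX : SmoothAt X x) (hY : SmoothAt Y x) (hV : SmoothAt V x) :
    VFCalc.brk X (VFCalc.brk Y V) x =
      VFCalc.brk (VFCalc.brk X Y) V x + VFCalc.brk Y (VFCalc.brk X V) x := by
  have : IsManifold I (minSmoothness ℝ 3) M := by
    rw [minSmoothness_of_isRCLikeNormedField]
    exact IsManifold.of_le (n := ∞) ENat.LEInfty.out
  have h2 : (minSmoothness ℝ 2 : ℕ∞ω) ≤ ∞ := by
    rw [minSmoothness_of_isRCLikeNormedField]; exact ENat.LEInfty.out
  exact leibniz_identity_mlieBracket_apply (ContMDiffAt.of_le hX h2) (ContMDiffAt.of_le hY h2)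
    (ContMDiffAt.of_le hV h2)

end bracket

end VFCalc

/-! ### The bracket as commutator of derivations, and tensoriality. -/

namespace VFCalc

open VectorField Bundle Topology

variable {E : Type*} [NormedAddCommGroup E] [NormedSpace ℝ E] 
  {H : Type*} [TopologicalSpace H] {I : ModelWithCorners ℝ E H}
  {M : Type*} [TopologicalSpace M] [ChartedSpace H M] [IsManifold I ∞ M]

theorem SmoothAt.dir {X : VF I M} {u : M → ℝ} {x : M} (hX : SmoothAt X x)
    (hu : FnSmoothAt I u x) : FnSmoothAt I (dir X u) x := by
  have h1 := ContMDiffAt.mfderiv_const hu (m := ∞) (by simp)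
  have h2 := ContMDiffAt.clm_apply_of_inCoordinates (F₁ := E) (F₂ := ℝ)
    (E₁ := (TangentSpace I : M → Type _)) (E₂ := (TangentSpace 𝓘(ℝ, ℝ) : ℝ → Type _))
    (b₁ := id) (b₂ := u) (v := X) h1 hX hu
  exact (contMDiff_snd_tangentBundle_modelSpace ℝ 𝓘(ℝ, ℝ)).contMDiffAt.comp x h2

section
variable [CompleteSpace E]

/-- The Lie bracket acts on functions as the commutator. -/
theorem dir_brk {X Y : VF I M} {u : M → ℝ} {x : M} (hX : SmoothAt X x) (hY : SmoothAt Y x)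
    (hu : FnSmoothAt I u x) :
    dir (brk X Y) u x = dir X (dir Y u) x - dir Y (dir X u) x := by
  by_cases hE : Subsingleton E
  · have h : ∀ (V : VF I M) (w : M → ℝ), VFCalc.dir V w x = 0 := fun V w => by
      have : V x = 0 := @Subsingleton.elim E hE _ _
      simp [VFCalc.dir, this]
    simp [h]
  rw [not_subsingleton_iff_nontrivial] at hE
  -- The Jacobi identity for X, Y and uV, with V nonzero at x, is expanded by the Leibniz rule. The
  -- terms with brackets of V cancel, the last of them by the Jacobi identity for X, Y, V, and the
  -- coefficient of V that remains is the claim.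
  obtain ⟨v, hv⟩ := exists_ne (0 : E)
  obtain ⟨V, U, hU, hxU, hV, hVx⟩ := exists_smooth_extension (I := I) (x := x) v
  have hVd := (hV x hxU).diffAt
  have huV : SmoothAt (fun y => u y • V y) x := (hV x hxU).smul hu
  have hev : ∀ᶠ y in 𝓝 x, FnDiffAt I u y := by
    have h1 : ContMDiffAt I 𝓘(ℝ, ℝ) 1 u x := ContMDiffAt.of_le hu (by simp)
    filter_upwards [(contMDiffAt_iff_contMDiffAt_nhds (by simp)).1 h1] with y hy
    exact hy.mdifferentiableAt one_ne_zero
  have e1 : ∀ X' : VF I M, brk X' (fun y => u y • V y) =ᶠ[𝓝 x]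
      fun y => VFCalc.dir X' u y • V y + u y • brk X' V y := fun X' => by
    filter_upwards [hev, hU.mem_nhds hxU] with y hy hyU
    exact brk_smul_right hy (hV y hyU).diffAt
  have e2 : ∀ X' Y' : VF I M, SmoothAt X' x → SmoothAt Y' x →
      brk X' (brk Y' (fun y => u y • V y)) x =
        VFCalc.dir X' (VFCalc.dir Y' u) x • V x + VFCalc.dir Y' u x • brk X' V x
          + (VFCalc.dir X' u x • brk Y' V x + u x • brk X' (brk Y' V) x) := by
    intro X' Y' hX' hY'
    have hb : SmoothAt (brk Y' V) x := SmoothAt.brk hY' (hV x hxU)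
    rw [brk_congr (Filter.EventuallyEq.refl _ X') (e1 Y'),
      brk_add_right (DiffAt.smul (SmoothAt.dir hY' hu).diffAt hVd)
        (DiffAt.smul hu.diffAt hb.diffAt),
      brk_smul_right (SmoothAt.dir hY' hu).diffAt hVd, brk_smul_right hu.diffAt hb.diffAt]
  have key := brk_jacobi hX hY huV
  rw [e2 X Y hX hY, (e1 (brk X Y)).self_of_nhds, e2 Y X hY hX, brk_jacobi hX hY (hV x hxU)] at key
  have key2 : (VFCalc.dir (brk X Y) u x - (VFCalc.dir X (VFCalc.dir Y u) x -
      VFCalc.dir Y (VFCalc.dir X u) x)) • V x = 0 := by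
    rw [sub_smul, sub_smul]
    rw [← sub_eq_zero] at key
    rw [← neg_eq_zero, ← key]
    module
  rcases smul_eq_zero.1 key2 with h | h
  · linarith
  · exact absurd (hVx.symm.trans h) hv

end

section tensorial

variable [FiniteDimensional ℝ E]

/-- A tensorial operator sees only the value at x, so X may be replaced by the combination of the
fields e with constant coefficients. -/
theorem TensorialAt.apply_sum {Φ : VF I M → ℝ} {x : M}
    (hΦ : TensorialAt I E Φ x) {ι : Type*} [Fintype ι] {e : ι → VF I M} {X : VF I M}
    (he : ∀ i, DiffAt (e i) x) (hX : DiffAt X x) (c : ι → ℝ) (h : X x = ∑ i, c i • e i x) :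
    Φ X = ∑ i, c i * Φ (e i) := by
  have h1 : ∀ i, DiffAt (fun y => (fun _ => c i : M → ℝ) y • e i y) x := fun i =>
    DiffAt.smul mdifferentiableAt_const (he i)
  rw [hΦ.pointwise hX (σ' := fun y => ∑ i, (fun _ => c i : M → ℝ) y • e i y)
    (DiffAt.sum fun i _ => h1 i) (by simpa using h)]
  rw [hΦ.sum (fun i y => (fun _ => c i : M → ℝ) y • e i y) fun i _ => h1 i]
  refine Finset.sum_congr rfl fun i _ => ?_
  exact hΦ.smul (f := fun _ => c i) mdifferentiableAt_const (he i)

end tensorial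

/-! ### The Levi-Civita connection from the Koszul formula. -/

section koszul

variable [FiniteDimensional ℝ E] (g : Metric I M)

theorem Metric.tensor_smul_left (u : M → ℝ) (X Y : VF I M) :
    g.tensor (u • X) Y = fun y => u y * g.tensor X Y y := by
  funext y; simp [Metric.tensor]

theorem Metric.tensor_smul_right (u : M → ℝ) (X Y : VF I M) :
    g.tensor X (u • Y) = fun y => u y * g.tensor X Y y := by
  funext y; simp [Metric.tensor]

theorem Metric.tensor_add_left (X X' Y : VF I M) :
    g.tensor (X + X') Y = fun y => g.tensor X Y y + g.tensor X' Y y := by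
  funext y; simp [Metric.tensor]

theorem Metric.tensor_add_right (X Y Y' : VF I M) :
    g.tensor X (Y + Y') = fun y => g.tensor X Y y + g.tensor X Y' y := by
  funext y; simp [Metric.tensor]

theorem dir_smul_left (u : M → ℝ) (X : VF I M) (w : M → ℝ) (x : M) :
    dir (u • X) w x = u x * dir X w x := by
  simp [dir]

theorem dir_add_left (X Y : VF I M) (w : M → ℝ) (x : M) :
    dir (X + Y) w x = dir X w x + dir Y w x := by
  simp [dir]

theorem tensorialAt_koszul_right {X Y : VF I M} {x : M} (hX : DiffAt X x) (hY : DiffAt Y x) :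
    TensorialAt I E (fun Z => koszul g X Y Z x) x where
  smul {u Z} hu hZ := by
    have b1 : ∀ V : VF I M, brk V (u • Z) x = dir V u x • Z x + u x • brk V Z x :=
      fun V => brk_smul_right (V := V) hu hZ
    simp only [koszul, Metric.tensor_smul_right, dir_smul_left,
      dir_mul hu (g.diffAt_tensor hX hZ), dir_mul hu (g.diffAt_tensor hY hZ)]
    simp only [Metric.tensor, b1, map_add, map_smul, add_apply,
      smul_apply, smul_eq_mul, g.symm_apply (Z x) (Y x),
      g.symm_apply (Z x) (X x)]
    ring
  add {Z Z'} hZ hZ' := by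
    have b1 : ∀ V : VF I M, brk V (Z + Z') x = brk V Z x + brk V Z' x :=
      fun V => brk_add_right (V := V) hZ hZ'
    simp only [koszul, Metric.tensor_add_right, dir_add_left,
      dir_add (g.diffAt_tensor hX hZ) (g.diffAt_tensor hX hZ'),
      dir_add (g.diffAt_tensor hY hZ) (g.diffAt_tensor hY hZ')]
    simp only [Metric.tensor, b1, map_add, add_apply]
    ring

theorem tensorialAt_koszul_left {Y Z : VF I M} {x : M} (hY : DiffAt Y x) (hZ : DiffAt Z x) :
    TensorialAt I E (fun X => koszul g X Y Z x) x where
  smul {u X} hu hX := by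
    have b1 : ∀ V : VF I M, brk (u • X) V x = -(dir V u x • X x) + u x • brk X V x :=
      fun V => brk_smul_left (V := V) hu hX
    simp only [koszul, Metric.tensor_smul_left, dir_smul_left,
      dir_mul hu (g.diffAt_tensor hX hY), dir_mul hu (g.diffAt_tensor hX hZ)]
    simp only [Metric.tensor, b1, map_add, map_neg, map_smul, add_apply,
      smul_apply, smul_eq_mul, Pi.smul_apply', neg_apply]
    ring
  add {X X'} hX hX' := by
    have b1 : ∀ V : VF I M, brk (X + X') V x = brk X V x + brk X' V x :=
      fun V => brk_add_left (V := V) hX hX'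
    simp only [koszul, Metric.tensor_add_left, dir_add_left,
      dir_add (g.diffAt_tensor hX hY) (g.diffAt_tensor hX' hY),
      dir_add (g.diffAt_tensor hX hZ) (g.diffAt_tensor hX' hZ)]
    simp only [Metric.tensor, b1, map_add, add_apply, Pi.add_apply]
    ring

/-- Positive definiteness makes the map to the dual space injective, and the dimensions agree. This
is what justifies the choices made in `grad` and `nabla`. -/
theorem Metric.exists_riesz {x : M} (ℓ : TangentSpace I x →ₗ[ℝ] ℝ) :
    ∃ v : TangentSpace I x, ∀ w, g.inner x v w = ℓ w := by
  have : FiniteDimensional ℝ (TangentSpace I x) := inferInstanceAs (FiniteDimensional ℝ E)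
  let φ : TangentSpace I x →ₗ[ℝ] (TangentSpace I x →ₗ[ℝ] ℝ) :=
    { toFun := fun v => (g.inner x v : TangentSpace I x →ₗ[ℝ] ℝ)
      map_add' := fun v w => by ext; simp
      map_smul' := fun c v => by ext; simp }
  have hinj : Function.Injective φ := by
    rw [← LinearMap.ker_eq_bot, LinearMap.ker_eq_bot']
    intro v hv
    exact Metric.eq_zero_of_inner_self (LinearMap.congr_fun hv v)
  have hdim : Module.finrank ℝ (TangentSpace I x) =
      Module.finrank ℝ (TangentSpace I x →ₗ[ℝ] ℝ) := (Subspace.dual_finrank_eq).symm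
  obtain ⟨v, hv⟩ := (LinearMap.injective_iff_surjective_of_finrank_eq_finrank hdim).1 hinj ℓ
  exact ⟨v, fun w => LinearMap.congr_fun hv w⟩

theorem grad_spec (u : M → ℝ) (x : M) (w : TangentSpace I x) :
    g.inner x (grad g u x) w = mvfderiv I u x w :=
  Classical.epsilon_spec (p := fun v : TangentSpace I x =>
    ∀ w : TangentSpace I x, g.inner x v w = mvfderiv I u x w)
    (g.exists_riesz (mvfderiv I u x : TangentSpace I x →ₗ[ℝ] ℝ)) w

/-- The Koszul expression is tensorial in Z, so for one extension of v it is a linear functional and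
has a Riesz vector. It is also tensorial in X, so the same vector serves every extension of v, and
the defining choice is not vacuous. -/
theorem nabla_spec {Y : VF I M} {x : M} (hY : DiffAt Y x) (v : TangentSpace I x)
    {X Z : VF I M} (hX : SmoothAt X x) (hZ : SmoothAt Z x) (hv : X x = v) :
    g.inner x (nabla g Y x v) (Z x) = koszul g X Y Z x := by
  refine Classical.epsilon_spec (p := fun u : TangentSpace I x =>
    ∀ X Z : VF I M, SmoothAt X x → SmoothAt Z x → X x = v →
      g.inner x u (Z x) = koszul g X Y Z x) ?_ X Z hX hZ hv
  obtain ⟨X₀, hX₀, hv₀⟩ := exists_smoothAt_extension v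
  have hT := tensorialAt_koszul_right g hX₀.diffAt hY
  obtain ⟨u, hu⟩ := g.exists_riesz (TensorialAt.mkHom _ x hT : TangentSpace I x →ₗ[ℝ] ℝ)
  refine ⟨u, fun X Z hX hZ hv => ?_⟩
  rw [hu, ← (tensorialAt_koszul_left g hY hZ.diffAt).pointwise hX₀.diffAt hX.diffAt
    (hv₀.trans hv.symm)]
  exact TensorialAt.mkHom_apply hT hZ.diffAt

theorem inner_cov {X Y Z : VF I M} {x : M} (hX : SmoothAt X x) (hY : DiffAt Y x)
    (hZ : SmoothAt Z x) : g.inner x (cov g X Y x) (Z x) = koszul g X Y Z x :=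
  nabla_spec g hY _ hX hZ rfl

variable {g}

/-- The uniqueness half. It reduces the linearity and Leibniz rules of the connection to identities
between Koszul expressions. -/
theorem nabla_eq_of_koszul {Y : VF I M} {x : M} (hY : DiffAt Y x) {X : VF I M}
    (hX : SmoothAt X x) {u : TangentSpace I x}
    (h : ∀ Z : VF I M, SmoothAt Z x → g.inner x u (Z x) = koszul g X Y Z x) :
    nabla g Y x (X x) = u := by
  refine Metric.ext_inner (g := g) fun z => ?_
  obtain ⟨Z, hZ, rfl⟩ := exists_smoothAt_extension z
  rw [h Z hZ, nabla_spec g hY _ hX hZ rfl]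

theorem nabla_add {Y : VF I M} {x : M} (hY : DiffAt Y x) (v w : TangentSpace I x) :
    nabla g Y x (v + w) = nabla g Y x v + nabla g Y x w := by
  obtain ⟨X, hX, rfl⟩ := exists_smoothAt_extension v
  obtain ⟨X', hX', rfl⟩ := exists_smoothAt_extension w
  refine nabla_eq_of_koszul hY (hX.add hX') fun Z hZ => ?_
  rw [map_add, add_apply, nabla_spec g hY _ hX hZ rfl,
    nabla_spec g hY _ hX' hZ rfl]
  exact ((tensorialAt_koszul_left g hY hZ.diffAt).add hX.diffAt hX'.diffAt).symm

theorem nabla_smul {Y : VF I M} {x : M} (hY : DiffAt Y x) (c : ℝ) (v : TangentSpace I x) :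
    nabla g Y x (c • v) = c • nabla g Y x v := by
  obtain ⟨X, hX, rfl⟩ := exists_smoothAt_extension v
  refine nabla_eq_of_koszul hY (hX.const_smul c) fun Z hZ => ?_
  rw [map_smul, smul_apply, nabla_spec g hY _ hX hZ rfl]
  exact ((tensorialAt_koszul_left g hY hZ.diffAt).smul (f := fun _ => c)
    mdifferentiableAt_const hX.diffAt).symm

theorem nabla_congr {Y Y' : VF I M} {x : M} (hY : DiffAt Y x) (h : Y =ᶠ[𝓝 x] Y')
    (v : TangentSpace I x) : nabla g Y x v = nabla g Y' x v := by
  obtain ⟨X, hX, rfl⟩ := exists_smoothAt_extension v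
  refine nabla_eq_of_koszul hY hX fun Z hZ => ?_
  rw [nabla_spec g (hY.congr h.symm) _ hX hZ rfl]
  have t1 : ∀ V : VF I M, g.tensor V Y' =ᶠ[𝓝 x] g.tensor V Y := fun V => by
    filter_upwards [h] with y hy
    simp [Metric.tensor, hy]
  have t2 : ∀ V : VF I M, g.tensor Y' V x = g.tensor Y V x := fun V => by
    simp [Metric.tensor, h.self_of_nhds]
  have t3 : g.tensor Y' Z =ᶠ[𝓝 x] g.tensor Y Z := by
    filter_upwards [h] with y hy
    simp [Metric.tensor, hy]
  have b1 : brk X Y' x = brk X Y x := brk_congr (Filter.EventuallyEq.refl _ _) h.symm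
  have b2 : brk Y' Z x = brk Y Z x := brk_congr h.symm (Filter.EventuallyEq.refl _ _)
  simp only [koszul, dir_congr (t1 X), dir_congr t3, dir_congr_left h.self_of_nhds.symm]
  simp only [Metric.tensor, b1, b2, h.self_of_nhds.symm]

theorem cov_add_right {X Y Y' : VF I M} {x : M} (hX : SmoothAt X x) (hY : DiffAt Y x)
    (hY' : DiffAt Y' x) : cov g X (fun y => Y y + Y' y) x = cov g X Y x + cov g X Y' x := by
  refine nabla_eq_of_koszul (mdifferentiableAt_add_section hY hY') hX fun Z hZ => ?_
  rw [map_add, add_apply, inner_cov g hX hY hZ, inner_cov g hX hY' hZ]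
  have b1 : brk X (fun y => Y y + Y' y) x = brk X Y x + brk X Y' x := brk_add_right hY hY'
  have b2 : brk (fun y => Y y + Y' y) Z x = brk Y Z x + brk Y' Z x := brk_add_left hY hY'
  have e : (fun y => Y y + Y' y) = Y + Y' := rfl
  simp only [koszul, Metric.tensor_add_left, Metric.tensor_add_right, dir_add_left,
    dir_add (g.diffAt_tensor hX.diffAt hY) (g.diffAt_tensor hX.diffAt hY'),
    dir_add (g.diffAt_tensor hY hZ.diffAt) (g.diffAt_tensor hY' hZ.diffAt)]
  simp only [← e, Metric.tensor, b1, b2, map_add, add_apply]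
  ring

theorem cov_smul_right {X Y : VF I M} {u : M → ℝ} {x : M} (hX : SmoothAt X x)
    (hu : FnDiffAt I u x) (hY : DiffAt Y x) :
    cov g X (fun y => u y • Y y) x = dir X u x • Y x + u x • cov g X Y x := by
  refine nabla_eq_of_koszul (DiffAt.smul hu hY) hX fun Z hZ => ?_
  rw [map_add, add_apply, map_smul, map_smul, smul_apply,
    smul_apply, inner_cov g hX hY hZ]
  have b1 : brk X (fun y => u y • Y y) x = dir X u x • Y x + u x • brk X Y x :=
    brk_smul_right hu hY
  have b2 : brk (fun y => u y • Y y) Z x = -(dir Z u x • Y x) + u x • brk Y Z x :=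
    brk_smul_left hu hY
  have e : (fun y => u y • Y y) = u • Y := rfl
  simp only [koszul, e, Metric.tensor_smul_left, Metric.tensor_smul_right, dir_smul_left,
    dir_mul hu (g.diffAt_tensor hX.diffAt hY), dir_mul hu (g.diffAt_tensor hY hZ.diffAt)]
  simp only [← e, Metric.tensor, b1, b2, map_add, map_neg, map_smul,
    add_apply, smul_apply, neg_apply,
    smul_eq_mul, g.symm_apply (Y x) (X x)]
  ring

theorem cov_sum_right {X : VF I M} {x : M} (hX : SmoothAt X x) {ι : Type*} (s : Finset ι)
    {F : ι → VF I M} (hF : ∀ i ∈ s, DiffAt (F i) x) :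
    cov g X (fun y => ∑ i ∈ s, F i y) x = ∑ i ∈ s, cov g X (F i) x := by
  classical
  induction s using Finset.induction_on with
  | empty =>
    simp only [Finset.sum_empty]
    have h0 : DiffAt (fun y => (0 : TangentSpace I y)) x :=
      (DiffAt.sum (s := (∅ : Finset ι)) (F := F) (by simp)).congr
        (Filter.Eventually.of_forall fun y => Finset.sum_empty.symm)
    have := cov_smul_right (g := g) hX (u := fun _ => 0) mdifferentiableAt_const h0
    simpa using this
  | insert i s hi ih =>
    simp only [Finset.sum_insert hi]
    rw [cov_add_right hX (hF i (by simp)) (DiffAt.sum fun j hj => hF j (by simp [hj])),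
      ih fun j hj => hF j (by simp [hj])]

/-- The Levi-Civita connection has no torsion. -/
theorem cov_sub_cov {X Y : VF I M} {x : M} (hX : SmoothAt X x) (hY : SmoothAt Y x) :
    cov g X Y x - cov g Y X x = brk X Y x := by
  refine Metric.ext_inner (g := g) fun z => ?_
  obtain ⟨Z, hZ, rfl⟩ := exists_smoothAt_extension z
  rw [map_sub, sub_apply, inner_cov g hX hY.diffAt hZ,
    inner_cov g hY hX.diffAt hZ]
  simp only [koszul, g.tensor_comm Y X]
  simp only [Metric.tensor, brk_swap Y X, map_neg, neg_apply]
  ring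

/-- The Levi-Civita connection is compatible with the metric. -/
theorem dir_tensor {X Y Z : VF I M} {x : M} (hX : SmoothAt X x) (hY : SmoothAt Y x)
    (hZ : SmoothAt Z x) :
    dir X (g.tensor Y Z) x = g.inner x (cov g X Y x) (Z x) + g.inner x (Y x) (cov g X Z x) := by
  rw [g.symm_apply (Y x), inner_cov g hX hY.diffAt hZ, inner_cov g hX hZ.diffAt hY]
  simp only [koszul, g.tensor_comm Z Y]
  simp only [Metric.tensor, brk_swap Z Y, map_neg, neg_apply]
  ring

end koszul

end VFCalc

/-! ### Local orthonormal frames and smoothness of covariant derivatives. -/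

namespace VFCalc

open VectorField Bundle Topology

variable {E : Type*} [NormedAddCommGroup E] [NormedSpace ℝ E] [FiniteDimensional ℝ E]
  {H : Type*} [TopologicalSpace H] {I : ModelWithCorners ℝ E H}
  {M : Type*} [TopologicalSpace M] [ChartedSpace H M] [IsManifold I ∞ M]

section fn

variable {u v : M → ℝ} {x : M}

theorem FnSmoothAt.add (hu : FnSmoothAt I u x) (hv : FnSmoothAt I v x) :
    FnSmoothAt I (fun y => u y + v y) x := ContMDiffAt.add hu hv

theorem FnSmoothAt.sub (hu : FnSmoothAt I u x) (hv : FnSmoothAt I v x) :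
    FnSmoothAt I (fun y => u y - v y) x := ContMDiffAt.sub hu hv

theorem FnSmoothAt.mul (hu : FnSmoothAt I u x) (hv : FnSmoothAt I v x) :
    FnSmoothAt I (fun y => u y * v y) x := ContMDiffAt.mul hu hv

theorem FnSmoothAt.neg (hu : FnSmoothAt I u x) : FnSmoothAt I (fun y => -u y) x :=
  ContMDiffAt.neg hu

theorem FnSmoothAt.const (c : ℝ) : FnSmoothAt I (fun _ => c) x := contMDiffAt_const

theorem FnSmoothAt.const_mul (c : ℝ) (hu : FnSmoothAt I u x) :
    FnSmoothAt I (fun y => c * u y) x := (FnSmoothAt.const c).mul hu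

theorem FnSmoothAt.comp_real {φ : ℝ → ℝ} (hφ : ContDiffAt ℝ ∞ φ (u x))
    (hu : FnSmoothAt I u x) : FnSmoothAt I (fun y => φ (u y)) x :=
  (ContDiffAt.contMDiffAt hφ).comp x hu

theorem FnSmoothAt.inv (hu : FnSmoothAt I u x) (h0 : u x ≠ 0) :
    FnSmoothAt I (fun y => (u y)⁻¹) x :=
  hu.comp_real (contDiffAt_inv ℝ h0)

theorem FnSmoothAt.sqrt (hu : FnSmoothAt I u x) (h0 : u x ≠ 0) :
    FnSmoothAt I (fun y => √(u y)) x :=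
  hu.comp_real (Real.contDiffAt_sqrt h0)

theorem FnSmoothAt.congr (hu : FnSmoothAt I u x) (h : v =ᶠ[𝓝 x] u) : FnSmoothAt I v x :=
  ContMDiffAt.congr_of_eventuallyEq hu h

theorem FnSmoothAt.congr_on {U : Set M} (hU : IsOpen U) (hx : x ∈ U) (hu : FnSmoothAt I u x)
    (h : ∀ y ∈ U, v y = u y) : FnSmoothAt I v x :=
  hu.congr (Filter.eventuallyEq_of_mem (hU.mem_nhds hx) h)

end fn

variable {g : Metric I M}

/-- A vector is determined by its inner products with an orthogonal basis. -/
theorem eq_sum_orthogonal {n : ℕ} (hn : n = Module.finrank ℝ E) {x : M}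
    {e : Fin n → TangentSpace I x} {d : Fin n → ℝ} (hd : ∀ i, d i ≠ 0)
    (he : ∀ i j, g.inner x (e i) (e j) = if i = j then d i else 0) (v : TangentSpace I x) :
    v = ∑ i, (g.inner x v (e i) / d i) • e i := by
  have : FiniteDimensional ℝ (TangentSpace I x) := inferInstanceAs (FiniteDimensional ℝ E)
  have key : ∀ c : Fin n → ℝ, ∀ j, g.inner x (∑ i, c i • e i) (e j) = c j * d j := fun c j => by
    simp [he]
  have hli : LinearIndependent ℝ e := by
    rw [Fintype.linearIndependent_iff]
    intro c hc j
    have := key c j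
    rw [hc] at this
    simpa [hd j] using this.symm
  have hspan : Submodule.span ℝ (Set.range e) = ⊤ :=
    hli.span_eq_top_of_card_eq_finrank' (by rw [Fintype.card_fin]; exact hn)
  rw [← sub_eq_zero]
  set r := v - ∑ i, (g.inner x v (e i) / d i) • e i with hr
  have hr0 : ∀ j, g.inner x r (e j) = 0 := fun j => by
    rw [hr, map_sub, sub_apply, key, div_mul_cancel₀ _ (hd j), sub_self]
  have hr1 : ∀ w ∈ Submodule.span ℝ (Set.range e), g.inner x r w = 0 := fun w hw => by
    induction hw using Submodule.span_induction with
    | mem w hw => obtain ⟨j, rfl⟩ := hw; exact hr0 j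
    | zero => simp
    | add a b _ _ ha hb => simp [ha, hb]
    | smul c a _ ha => simp [ha]
  exact Metric.eq_zero_of_inner_self (hr1 r (by simp [hspan]))

/-- Vector fields which are smooth and orthonormal on the open set `U`, and as many as the
dimension. -/
structure IsOrthonormalFrame (g : Metric I M) (U : Set M) {n : ℕ} (e : Fin n → VF I M) :
    Prop where
  isOpen : IsOpen U
  finrank : n = Module.finrank ℝ E
  smooth : ∀ i, ∀ y ∈ U, SmoothAt (e i) y
  inner : ∀ y ∈ U, ∀ i j, g.inner y (e i y) (e j y) = if i = j then 1 else 0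

theorem IsOrthonormalFrame.isOrthonormalAt {U : Set M} {n : ℕ} {e : Fin n → VF I M}
    (h : IsOrthonormalFrame g U e) {x : M} (hx : x ∈ U) : IsOrthonormalAt g x e :=
  ⟨h.finrank, fun i => h.smooth i x hx, h.inner x hx⟩

theorem IsOrthonormalFrame.eq_sum {U : Set M} {n : ℕ} {e : Fin n → VF I M}
    (h : IsOrthonormalFrame g U e) {x : M} (hx : x ∈ U) (v : TangentSpace I x) :
    v = ∑ i, g.inner x v (e i x) • e i x := by
  have := eq_sum_orthogonal (g := g) h.finrank (d := fun _ => 1) (by simp) (h.inner x hx) v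
  simpa using this

/-- Gram-Schmidt, one field at a time: a nonzero vector orthogonal to the previous ones at x exists
for dimension reasons; it is extended, projected, and normalized on the open set where the
projection does not vanish. -/
theorem exists_orthonormal_fields (g : Metric I M) (x : M) (k : ℕ)
    (hk : k ≤ Module.finrank ℝ E) :
    ∃ (U : Set M) (e : Fin k → VF I M), IsOpen U ∧ x ∈ U ∧ (∀ i, ∀ y ∈ U, SmoothAt (e i) y) ∧
      ∀ y ∈ U, ∀ i j, g.inner y (e i y) (e j y) = if i = j then 1 else 0 := by
  have : FiniteDimensional ℝ (TangentSpace I x) := inferInstanceAs (FiniteDimensional ℝ E)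
  induction k with
  | zero => exact ⟨Set.univ, Fin.elim0, isOpen_univ, trivial, fun i => i.elim0,
      fun _ _ i => i.elim0⟩
  | succ k ih =>
    obtain ⟨U, e, hU, hx, he, ho⟩ := ih (by omega)
    obtain ⟨v, hv0, hv⟩ : ∃ v : TangentSpace I x, v ≠ 0 ∧ ∀ i, g.inner x v (e i x) = 0 := by
      let φ : TangentSpace I x →ₗ[ℝ] (Fin k → ℝ) :=
        LinearMap.pi fun i => (g.inner x (e i x) : TangentSpace I x →ₗ[ℝ] ℝ)
      have hker : LinearMap.ker φ ≠ ⊥ := LinearMap.ker_ne_bot_of_finrank_lt (by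
        rw [Module.finrank_fin_fun]
        exact hk)
      obtain ⟨v, hv, hv0⟩ := Submodule.exists_mem_ne_zero_of_ne_bot hker
      exact ⟨v, hv0, fun i => (g.symm_apply _ _).trans (congrFun (LinearMap.mem_ker.1 hv) i)⟩
    obtain ⟨X, U', hU', hx', hX, hXv⟩ := exists_smooth_extension v
    let Y : VF I M := fun y => X y - ∑ i, g.tensor X (e i) y • e i y
    have hYs : ∀ y ∈ U ∩ U', SmoothAt Y y := fun y hy =>
      (hX y hy.2).sub (SmoothAt.sum fun i _ =>
        SmoothAt.smul (g.smoothAt_tensor (hX y hy.2) (he i y hy.1)) (he i y hy.1))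
    have hYo : ∀ y ∈ U, ∀ i, g.inner y (Y y) (e i y) = 0 := fun y hy i => by
      simp [Y, ho y hy, Metric.tensor]
    have hYx : Y x = v := by
      simp [Y, Metric.tensor, hXv, hv]
    let V : Set M := (U ∩ U') ∩ {y | g.tensor Y Y y ≠ 0}
    have hVo : IsOpen V := by
      refine ContinuousOn.isOpen_inter_preimage (t := {r : ℝ | r ≠ 0}) (f := g.tensor Y Y)
        (fun y hy => ?_) (hU.inter hU') isOpen_ne
      exact (ContMDiffAt.continuousAt (g.smoothAt_tensor (hYs y hy)
        (hYs y hy))).continuousWithinAt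
    have hpos : ∀ y ∈ V, 0 < g.tensor Y Y y := fun y hy =>
      g.pos y _ fun h => hy.2 (by simp [Metric.tensor, h])
    refine ⟨V, Fin.snoc e fun y => (√(g.tensor Y Y y))⁻¹ • Y y, hVo, ⟨⟨hx, hx'⟩, ?_⟩, ?_, ?_⟩
    · change g.inner x (Y x) (Y x) ≠ 0
      rw [hYx]
      exact (g.pos x v hv0).ne'
    · intro i y hy
      refine Fin.lastCases ?_ (fun j => ?_) i
      · simp only [Fin.snoc_last]
        have hs := g.smoothAt_tensor (hYs y hy.1) (hYs y hy.1)
        exact SmoothAt.smul ((hs.sqrt hy.2).inv (Real.sqrt_pos.2 (hpos y hy)).ne') (hYs y hy.1)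
      · simp only [Fin.snoc_castSucc]
        exact he j y hy.1.1
    · intro y hy i j
      have hs : √(g.tensor Y Y y) * √(g.tensor Y Y y) = g.tensor Y Y y :=
        Real.mul_self_sqrt (hpos y hy).le
      have hs0 := (Real.sqrt_pos.2 (hpos y hy)).ne'
      have hYY : g.inner y (Y y) (Y y) = √(g.tensor Y Y y) * √(g.tensor Y Y y) := hs.symm
      have hYo' : ∀ i, g.inner y (e i y) (Y y) = 0 := fun i =>
        (g.symm_apply _ _).trans (hYo y hy.1.1 i)
      refine Fin.lastCases ?_ (fun i => ?_) i <;> refine Fin.lastCases ?_ (fun j => ?_) j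
      · simp only [Fin.snoc_last, map_smul, smul_apply, smul_eq_mul, hYY, if_true]
        field_simp
      · simp [hYo y hy.1.1, (Fin.castSucc_lt_last j).ne']
      · simp [hYo', (Fin.castSucc_lt_last i).ne]
      · simp [ho y hy.1.1]

theorem exists_orthonormalFrame (g : Metric I M) (x : M) :
    ∃ (U : Set M) (e : Fin (Module.finrank ℝ E) → VF I M), x ∈ U ∧ IsOrthonormalFrame g U e := by
  obtain ⟨U, e, hU, hx, he, ho⟩ := exists_orthonormal_fields g x _ le_rfl
  exact ⟨U, e, hx, hU, rfl, he, ho⟩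

/-- Smoothness is read off from frame components. For ∇_X Y and for gradients these components are
explicit functions. -/
theorem IsOrthonormalFrame.smoothAt_of_inner {U : Set M} {n : ℕ} {e : Fin n → VF I M}
    (h : IsOrthonormalFrame g U e) {x : M} (hx : x ∈ U) {X : VF I M}
    (hX : ∀ i, FnSmoothAt I (g.tensor X (e i)) x) : SmoothAt X x :=
  SmoothAt.congr_on h.isOpen hx (SmoothAt.sum fun i _ => SmoothAt.smul (hX i) (h.smooth i x hx))
    fun y hy => h.eq_sum hy (X y)

theorem smoothAt_koszul {X Y Z : VF I M} {x : M} (hX : SmoothAt X x) (hY : SmoothAt Y x)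
    (hZ : SmoothAt Z x) : FnSmoothAt I (koszul g X Y Z) x := by
  have s {A B : VF I M} (hA : SmoothAt A x) (hB : SmoothAt B x) := g.smoothAt_tensor hA hB
  exact FnSmoothAt.const_mul _ ((((((hX.dir (s hY hZ)).add (hY.dir (s hX hZ))).sub
    (hZ.dir (s hX hY))).add (s (hX.brk hY) hZ)).sub (s (hX.brk hZ) hY)).sub (s (hY.brk hZ) hX))

/-- The components of ∇_X Y in a frame are Koszul expressions. That equality must hold at all points
near x, hence the assumption of smoothness nearby. -/
theorem SmoothAt.cov {X Y : VF I M} {x : M} (hX : ∀ᶠ y in 𝓝 x, SmoothAt X y)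
    (hY : ∀ᶠ y in 𝓝 x, SmoothAt Y y) : SmoothAt (cov g X Y) x := by
  obtain ⟨U, e, hx, he⟩ := exists_orthonormalFrame g x
  refine he.smoothAt_of_inner hx fun i => ?_
  refine FnSmoothAt.congr (smoothAt_koszul (g := g) hX.self_of_nhds hY.self_of_nhds
    (he.smooth i x hx)) ?_
  filter_upwards [hX, hY, he.isOpen.mem_nhds hx] with y h1 h2 h3
  exact inner_cov g h1 h2.diffAt (he.smooth i y h3)

theorem smoothAt_grad {u : M → ℝ} {x : M} (hu : FnSmoothAt I u x) : SmoothAt (grad g u) x := by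
  obtain ⟨U, e, hx, he⟩ := exists_orthonormalFrame g x
  refine he.smoothAt_of_inner hx fun i => ?_
  refine FnSmoothAt.congr ((he.smooth i x hx).dir hu) (Filter.Eventually.of_forall fun y => ?_)
  exact grad_spec g u y (e i y)

end VFCalc

/-! ### Pointwise algebra of the structure functions and the Bismut Ricci tensor. -/

namespace VFCalc

open VectorField Bundle Topology

/-- The area form of the plane spanned by the last two of four basis vectors. -/
def areaForm (i j : Fin 4) : ℝ :=
  if i = 2 ∧ j = 3 then 1 else if i = 3 ∧ j = 2 then -1 else 0

theorem areaForm_swap (i j : Fin 4) : areaForm j i = -areaForm i j := by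
  fin_cases i <;> fin_cases j <;> simp [areaForm]

theorem areaForm_table :
    areaForm 0 0 = 0 ∧ areaForm 0 1 = 0 ∧ areaForm 0 2 = 0 ∧ areaForm 0 3 = 0 ∧
    areaForm 1 0 = 0 ∧ areaForm 1 1 = 0 ∧ areaForm 1 2 = 0 ∧ areaForm 1 3 = 0 ∧
    areaForm 2 0 = 0 ∧ areaForm 2 1 = 0 ∧ areaForm 2 2 = 0 ∧ areaForm 2 3 = 1 ∧
    areaForm 3 0 = 0 ∧ areaForm 3 1 = 0 ∧ areaForm 3 2 = -1 ∧ areaForm 3 3 = 0 := by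
  simp [areaForm]

/-- Components of the 3-form `θ ∧ areaForm`. -/
def wedgeArea (θ : Fin 4 → ℝ) (i j k : Fin 4) : ℝ :=
  θ i * areaForm j k + θ j * areaForm k i + θ k * areaForm i j

/-- Structure functions of a frame adapted to a torus fibration. -/
def structFn (θ σ : Fin 4 → ℝ) (i j k : Fin 4) : ℝ :=
  -wedgeArea θ i j k + σ i * areaForm j k - σ j * areaForm i k

/-- Christoffel symbols of a frame adapted to a torus fibration. -/
def chris (θ σ : Fin 4 → ℝ) (i j k : Fin 4) : ℝ :=
  -(1 / 2) * wedgeArea θ i j k + σ i * areaForm j k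

/-- The Koszul formula in an orthonormal frame, where only the bracket terms survive. -/
theorem chris_eq (θ σ : Fin 4 → ℝ) (i j k : Fin 4) :
    chris θ σ i j k = (1 / 2) * (structFn θ σ i j k - structFn θ σ i k j - structFn θ σ j k i) := by
  simp only [chris, structFn, wedgeArea, areaForm_swap i j, areaForm_swap j k,
    areaForm_swap i k]
  ring

/-- Adding half of θ ∧ A to the Christoffel symbols leaves σ_i A_jk. This connection is a rotation
of one plane, hence abelian, so its curvature is dσ ⊗ A, and contracting gives the right-hand side.
On the left stand Rc, ¼H² and ½d*H in the frame; `Dθ i l` and `Dσ i l` stand for the derivatives of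
θ_l and σ_l along e_i. The identity is polynomial and is checked for the sixteen index pairs. -/
theorem bismut_algebra (θ σ : Fin 4 → ℝ) (Dθ Dσ : Fin 4 → Fin 4 → ℝ) (j k : Fin 4) :
    (∑ i, ((chris (Dθ i) (Dσ i) j k i + ∑ l, chris θ σ j k l * chris θ σ i l i)
        - (chris (Dθ j) (Dσ j) i k i + ∑ l, chris θ σ i k l * chris θ σ j l i)
        - ∑ l, structFn θ σ i j l * chris θ σ l k i))
      - (1 / 4) * (∑ l, ∑ m, wedgeArea θ j l m * wedgeArea θ k l m)
      - (1 / 2) * -∑ i, (wedgeArea (Dθ i) i j k - ∑ l, chris θ σ i i l * wedgeArea θ l j k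
          - ∑ l, chris θ σ i j l * wedgeArea θ i l k - ∑ l, chris θ σ i k l * wedgeArea θ i j l)
      = ∑ i, (Dσ i j - Dσ j i - ∑ l, structFn θ σ i j l * σ l) * areaForm k i := by
  fin_cases j <;> fin_cases k <;>
  simp only [Fin.zero_eta, Fin.mk_one, Fin.reduceFinMk, Fin.sum_univ_four, chris, structFn,
    wedgeArea, areaForm_table, mul_zero, zero_mul, add_zero, zero_add, sub_zero, mul_one, neg_zero,
    mul_neg, neg_mul, zero_sub] <;> ring

end VFCalc

/-! ### Bismut Ricci curvature and the soliton equation in an adapted orthonormal frame. -/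

namespace VFCalc

open VectorField Bundle Topology

variable {E : Type*} [NormedAddCommGroup E] [NormedSpace ℝ E] [FiniteDimensional ℝ E]
  {H : Type*} [TopologicalSpace H] {I : ModelWithCorners ℝ E H}
  {M : Type*} [TopologicalSpace M] [ChartedSpace H M] [IsManifold I ∞ M]
  {g : Metric I M}

theorem dir_eq_sum {ι : Type*} [Fintype ι] {X : VF I M} {x : M} {c : ι → ℝ} {e : ι → VF I M}
    (h : X x = ∑ i, c i • e i x) (u : M → ℝ) : dir X u x = ∑ i, c i * dir (e i) u x := by
  simp [dir, h]

/-- An orthonormal frame whose Lie brackets have the form that occurs on a torus fibration. -/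
structure IsTorusFrame (g : Metric I M) (U : Set M) (e : Fin 4 → VF I M)
    (θ σ : Fin 4 → M → ℝ) : Prop extends IsOrthonormalFrame g U e where
  smooth_theta : ∀ i, ∀ y ∈ U, FnSmoothAt I (θ i) y
  smooth_sigma : ∀ i, ∀ y ∈ U, FnSmoothAt I (σ i) y
  brk_eq : ∀ y ∈ U, ∀ i j,
    brk (e i) (e j) y = ∑ k, structFn (fun l => θ l y) (fun l => σ l y) i j k • e k y

/-- The 3-form `T` has the components `wedgeArea θ` in the frame `e`. -/
structure IsWedgeForm (g : Metric I M) (U : Set M) (e : Fin 4 → VF I M) (θ : Fin 4 → M → ℝ)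
    (T : Tensor₃ I M) : Prop where
  swap_left : ∀ X Y Z y, T X Y Z y = -T Y X Z y
  swap_right : ∀ X Y Z y, T X Y Z y = -T X Z Y y
  expand : ∀ X Y Z : VF I M, ∀ y ∈ U, SmoothAt X y → SmoothAt Y y → SmoothAt Z y →
    T X Y Z y = ∑ l, g.inner y (X y) (e l y) * T (e l) Y Z y
  frame : ∀ y ∈ U, ∀ i j k, T (e i) (e j) (e k) y = wedgeArea (fun l => θ l y) i j k

section

variable {U : Set M} {e : Fin 4 → VF I M} {θ σ : Fin 4 → M → ℝ}

theorem smoothAt_wedgeArea {x : M} (hθ : ∀ i, FnSmoothAt I (θ i) x) (i j k : Fin 4) :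
    FnSmoothAt I (fun y => wedgeArea (fun l => θ l y) i j k) x := by
  have s (a : Fin 4) (c : ℝ) : FnSmoothAt I (fun y => θ a y * c) x :=
    (hθ a).mul (FnSmoothAt.const c)
  exact ((s i _).add (s j _)).add (s k _)

/-- The expression is linear in θ with constant coefficients, so a derivation passes through to θ.
The same remark applies to `chris` and `structFn`. -/
theorem dir_wedgeArea {x : M} (hθ : ∀ i, FnSmoothAt I (θ i) x) (X : VF I M) (i j k : Fin 4) :
    dir X (fun y => wedgeArea (fun l => θ l y) i j k) x =
      wedgeArea (fun l => dir X (θ l) x) i j k := by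
  have s (a : Fin 4) (c : ℝ) : FnSmoothAt I (fun y => θ a y * c) x :=
    FnSmoothAt.mul (hθ a) (FnSmoothAt.const c)
  have d (a : Fin 4) (c : ℝ) : dir X (fun y => θ a y * c) x = dir X (θ a) x * c := by
    rw [dir_mul (hθ a).diffAt mdifferentiableAt_const]; simp
  simp only [wedgeArea]
  rw [dir_add (FnSmoothAt.add (s i _) (s j _)).diffAt (s k _).diffAt,
    dir_add (s i _).diffAt (s j _).diffAt, d, d, d]

theorem smoothAt_chris {x : M} (hθ : ∀ i, FnSmoothAt I (θ i) x) (hσ : ∀ i, FnSmoothAt I (σ i) x)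
    (i j k : Fin 4) : FnSmoothAt I (fun y => chris (fun l => θ l y) (fun l => σ l y) i j k) x :=
  ((smoothAt_wedgeArea hθ i j k).const_mul _).add ((hσ i).mul (FnSmoothAt.const _))

theorem dir_chris {x : M} (hθ : ∀ i, FnSmoothAt I (θ i) x) (hσ : ∀ i, FnSmoothAt I (σ i) x)
    (X : VF I M) (i j k : Fin 4) :
    dir X (fun y => chris (fun l => θ l y) (fun l => σ l y) i j k) x =
      chris (fun l => dir X (θ l) x) (fun l => dir X (σ l) x) i j k := by
  have h := smoothAt_wedgeArea hθ i j k
  simp only [chris]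
  rw [dir_add (h.const_mul _).diffAt ((hσ i).mul (FnSmoothAt.const _)).diffAt,
    dir_const_mul _ h.diffAt, dir_mul (hσ i).diffAt mdifferentiableAt_const, dir_wedgeArea hθ]
  simp

namespace IsTorusFrame

variable (h : IsTorusFrame g U e θ σ)
include h

theorem inner_sum {x : M} (hx : x ∈ U) (c : Fin 4 → ℝ) (k : Fin 4) :
    g.inner x (∑ i, c i • e i x) (e k x) = c k := by
  simp [h.inner x hx]

theorem inner_brk {x : M} (hx : x ∈ U) (i j k : Fin 4) :
    g.inner x (brk (e i) (e j) x) (e k x) =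
      structFn (fun l => θ l x) (fun l => σ l x) i j k := by
  rw [h.brk_eq x hx, h.inner_sum hx]

theorem inner_cov {x : M} (hx : x ∈ U) (i j k : Fin 4) :
    g.inner x (cov g (e i) (e j) x) (e k x) =
      chris (fun l => θ l x) (fun l => σ l x) i j k := by
  rw [VFCalc.inner_cov g (h.smooth i x hx) (h.smooth j x hx).diffAt (h.smooth k x hx), chris_eq]
  -- Inner products of frame fields are constant, so the derivative terms of the Koszul formula
  -- vanish.
  have d (X : VF I M) (a b : Fin 4) : dir X (g.tensor (e a) (e b)) x = 0 := by
    rw [dir_congr_on (u := g.tensor (e a) (e b)) (v := fun _ => if a = b then 1 else 0) h.isOpen hx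
      fun y hy => h.inner y hy a b]
    simp
  simp only [koszul, d]
  simp only [Metric.tensor, h.inner_brk hx]
  ring

theorem cov_eq {x : M} (hx : x ∈ U) (i j : Fin 4) :
    cov g (e i) (e j) x =
      ∑ k, chris (fun l => θ l x) (fun l => σ l x) i j k • e k x := by
  rw [h.eq_sum hx (cov g (e i) (e j) x)]
  simp only [h.inner_cov hx]

theorem smoothAt_cov {x : M} (hx : x ∈ U) (i j : Fin 4) : SmoothAt (cov g (e i) (e j)) x :=
  SmoothAt.cov (Filter.eventually_of_mem (h.isOpen.mem_nhds hx) (h.smooth i))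
    (Filter.eventually_of_mem (h.isOpen.mem_nhds hx) (h.smooth j))

theorem inner_cov_cov {x : M} (hx : x ∈ U) (i j k m : Fin 4) :
    g.inner x (cov g (e i) (cov g (e j) (e k)) x) (e m x) =
      chris (fun l => dir (e i) (θ l) x) (fun l => dir (e i) (σ l) x) j k m +
        ∑ l, chris (fun l => θ l x) (fun l => σ l x) j k l *
          chris (fun l => θ l x) (fun l => σ l x) i l m := by
  have hθ : ∀ i, FnSmoothAt I (θ i) x := fun i => h.smooth_theta i x hx
  have hσ : ∀ i, FnSmoothAt I (σ i) x := fun i => h.smooth_sigma i x hx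
  have hc (l : Fin 4) := smoothAt_chris hθ hσ j k l
  have e1 : cov g (e i) (cov g (e j) (e k)) x = cov g (e i)
      (fun y => ∑ l, chris (fun l => θ l y) (fun l => σ l y) j k l • e l y) x :=
    nabla_congr (h.smoothAt_cov hx j k).diffAt
      (Filter.eventuallyEq_of_mem (h.isOpen.mem_nhds hx) fun y hy => h.cov_eq hy j k) _
  have e2 : ∀ l : Fin 4, cov g (e i)
      (fun y => chris (fun l => θ l y) (fun l => σ l y) j k l • e l y) x =
      chris (fun l => dir (e i) (θ l) x) (fun l => dir (e i) (σ l) x) j k l • e l x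
        + chris (fun l => θ l x) (fun l => σ l x) j k l • cov g (e i) (e l) x := fun l => by
    rw [cov_smul_right (h.smooth i x hx) (hc l).diffAt (h.smooth l x hx).diffAt,
      dir_chris hθ hσ]
  rw [e1, cov_sum_right (h.smooth i x hx) _ fun l _ =>
    DiffAt.smul (hc l).diffAt (h.smooth l x hx).diffAt, Finset.sum_congr rfl fun l _ => e2 l,
    Finset.sum_add_distrib, map_add, add_apply, h.inner_sum hx]
  congr 1
  simp [h.inner_cov hx]

theorem inner_cov_brk {x : M} (hx : x ∈ U) (i j k m : Fin 4) :
    g.inner x (cov g (brk (e i) (e j)) (e k) x) (e m x) =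
      ∑ l, structFn (fun l => θ l x) (fun l => σ l x) i j l *
        chris (fun l => θ l x) (fun l => σ l x) l k m := by
  have hk := (h.smooth k x hx).diffAt
  have e1 : cov g (brk (e i) (e j)) (e k) x =
      ∑ l, structFn (fun l => θ l x) (fun l => σ l x) i j l • cov g (e l) (e k) x := by
    let φ : TangentSpace I x →ₗ[ℝ] TangentSpace I x :=
      { toFun := nabla g (e k) x
        map_add' := nabla_add hk
        map_smul' := nabla_smul hk }
    change φ (brk (e i) (e j) x) = ∑ l, _ • φ (e l x)
    rw [h.brk_eq x hx, map_sum]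
    simp
  rw [e1]
  simp [h.inner_cov hx]

/-- The Ricci curvature of the Bismut connection, in terms of its connection form `σ`. -/
theorem ricci_bismut {T : Tensor₃ I M} (hT : IsWedgeForm g U e θ T) {x : M} (hx : x ∈ U)
    (j k : Fin 4) :
    ricci g e (e j) (e k) x - (1 / 4) * sq₃ T e (e j) (e k) x
        - (1 / 2) * codiff₃ g T e (e j) (e k) x =
      ∑ i, (dir (e i) (σ j) x - dir (e j) (σ i) x
        - ∑ l, structFn (fun l => θ l x) (fun l => σ l x) i j l * σ l x) * areaForm k i := by
  have hθ : ∀ i, FnSmoothAt I (θ i) x := fun i => h.smooth_theta i x hx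
  rw [← bismut_algebra (fun l => θ l x) (fun l => σ l x) (fun i l => dir (e i) (θ l) x)
    (fun i l => dir (e i) (σ l) x) j k]
  congr 1
  · congr 1
    · simp only [ricci, curv, map_sub, sub_apply, h.inner_cov_cov hx, h.inner_cov_brk hx]
    · simp only [sq₃, hT.frame x hx]
  · simp only [codiff₃, covTensor₃]
    congr 2
    refine Finset.sum_congr rfl fun i _ => ?_
    -- Expansion is available in the first slot of T only; `t2` and `t3` move the differentiated
    -- slot there by antisymmetry, and `w1`, `w2` move the index back.
    have t1 : ∀ a b c d : Fin 4, T (cov g (e a) (e b)) (e c) (e d) x =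
        ∑ l, chris (fun l => θ l x) (fun l => σ l x) a b l *
          wedgeArea (fun l => θ l x) l c d := fun a b c d => by
      rw [hT.expand _ _ _ x hx (h.smoothAt_cov hx a b) (h.smooth c x hx) (h.smooth d x hx)]
      simp only [h.inner_cov hx, hT.frame x hx]
    have w1 : ∀ (v : Fin 4 → ℝ) (a b c : Fin 4), wedgeArea v a b c = -wedgeArea v b a c :=
      fun v a b c => by
        simp only [wedgeArea, areaForm_swap a b, areaForm_swap a c, areaForm_swap b c]; ring
    have w2 : ∀ (v : Fin 4 → ℝ) (a b c : Fin 4), wedgeArea v a b c = -wedgeArea v a c b :=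
      fun v a b c => by
        simp only [wedgeArea, areaForm_swap a b, areaForm_swap a c, areaForm_swap b c]; ring
    have t2 : T (e i) (cov g (e i) (e j)) (e k) x =
        ∑ l, chris (fun l => θ l x) (fun l => σ l x) i j l *
          wedgeArea (fun l => θ l x) i l k := by
      rw [hT.swap_left, t1, ← Finset.sum_neg_distrib]
      refine Finset.sum_congr rfl fun l _ => ?_
      rw [w1 _ i l k]; ring
    have t3 : T (e i) (e j) (cov g (e i) (e k)) x =
        ∑ l, chris (fun l => θ l x) (fun l => σ l x) i k l *
          wedgeArea (fun l => θ l x) i j l := by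
      rw [hT.swap_right, hT.swap_left, t1, neg_neg]
      refine Finset.sum_congr rfl fun l _ => ?_
      rw [w2 _ i j l, w1 _ i l j, neg_neg]
    rw [t1, t2, t3, dir_congr_on h.isOpen hx fun y hy => hT.frame y hy i j k, dir_wedgeArea hθ]

/-- A steady soliton satisfies `Rc = ∇²f` for the Bismut connection. -/
theorem soliton_eq {T : Tensor₃ I M} (hT : IsWedgeForm g U e θ T) {f : M → ℝ} {x : M}
    (hx : x ∈ U) (hf : ∀ y, FnSmoothAt I f y) (j k : Fin 4)
    (h1 : ricci g e (e j) (e k) x - (1 / 4) * sq₃ T e (e j) (e k) x = hess g f (e j) (e k) x)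
    (h2 : (1 / 2) * codiff₃ g T e (e j) (e k) x =
      T (fun y => (1 / 2 : ℝ) • grad g f y) (e j) (e k) x) :
    ∑ i, (dir (e i) (σ j) x - dir (e j) (σ i) x
        - ∑ l, structFn (fun l => θ l x) (fun l => σ l x) i j l * σ l x) * areaForm k i =
      dir (e j) (dir (e k) f) x - ∑ l, σ j x * areaForm k l * dir (e l) f x := by
  -- In the Hessian minus the contraction of H with ½∇f, the terms with θ ∧ A cancel: what remains
  -- is the Hessian of the Bismut connection, with coefficients σ_j A_kl.
  rw [← h.ricci_bismut hT hx, h1, h2, hT.expand _ _ _ x hx ((smoothAt_grad (hf x)).const_smul _)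
    (h.smooth j x hx) (h.smooth k x hx), hess, dir_eq_sum (h.cov_eq hx j k), sub_sub,
    ← Finset.sum_add_distrib]
  congr 1
  refine Finset.sum_congr rfl fun l _ => ?_
  rw [hT.frame x hx, map_smul, smul_apply, grad_spec, ← dir_apply]
  simp only [chris, wedgeArea, smul_eq_mul]
  ring

end IsTorusFrame

end

end VFCalc

/-! ### The Kähler form and the torsion form in a fibre frame. -/

namespace VFCalc

open VectorField Bundle Topology

variable {E : Type*} [NormedAddCommGroup E] [NormedSpace ℝ E] [FiniteDimensional ℝ E]
  {H : Type*} [TopologicalSpace H] {I : ModelWithCorners ℝ E H}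
  {M : Type*} [TopologicalSpace M] [ChartedSpace H M] [IsManifold I ∞ M]
  {g : Metric I M} {J : (x : M) → TangentSpace I x → TangentSpace I x}

/-- `J` is a smooth almost complex structure. -/
structure IsAlmostComplex (J : (x : M) → TangentSpace I x → TangentSpace I x) : Prop where
  map_add : ∀ (x : M) (v w : TangentSpace I x), J x (v + w) = J x v + J x w
  map_smul : ∀ (x : M) (c : ℝ) (v : TangentSpace I x), J x (c • v) = c • J x v
  sq : ∀ (x : M) (v : TangentSpace I x), J x (J x v) = -v
  smooth : ∀ (X : VF I M) (x : M), SmoothAt X x → SmoothAt (app J X) x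

section form

variable (hJ : IsAlmostComplex J) (hg : IsHermitian J g)
include hJ hg

theorem inner_J_right (x : M) (v w : TangentSpace I x) :
    g.inner x v (J x w) = -g.inner x (J x v) w := by
  rw [← hg x v (J x w), hJ.sq, map_neg]

theorem kahlerForm_swap (X Y : VF I M) (x : M) :
    kahlerForm J g X Y x = -kahlerForm J g Y X x := by
  simp only [kahlerForm, Metric.tensor, app]
  rw [inner_J_right hJ hg, g.symm_apply]

theorem diffAt_kahlerForm {X Y : VF I M} {x : M} (hX : DiffAt X x) (hY : SmoothAt Y x) :
    FnDiffAt I (kahlerForm J g X Y) x :=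
  g.diffAt_tensor hX (hJ.smooth Y x hY).diffAt

theorem extd₂_kahlerForm_swap_left (X Y Z : VF I M) (x : M) :
    extd₂ (kahlerForm J g) X Y Z x = -extd₂ (kahlerForm J g) Y X Z x := by
  have hs : ∀ A B : VF I M, kahlerForm J g A B = fun y => -kahlerForm J g B A y :=
    fun A B => funext fun y => kahlerForm_swap hJ hg A B y
  simp only [extd₂]
  rw [hs Y Z, hs Z X, hs X Y, dir_neg, dir_neg, dir_neg]
  simp only [kahlerForm, Metric.tensor, brk_swap X Y, map_neg, neg_apply]
  ring

theorem extd₂_kahlerForm_swap_right (X Y Z : VF I M) (x : M) :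
    extd₂ (kahlerForm J g) X Y Z x = -extd₂ (kahlerForm J g) X Z Y x := by
  have hs : ∀ A B : VF I M, kahlerForm J g A B = fun y => -kahlerForm J g B A y :=
    fun A B => funext fun y => kahlerForm_swap hJ hg A B y
  simp only [extd₂]
  rw [hs Y Z, hs Z X, hs X Y, dir_neg, dir_neg, dir_neg]
  simp only [kahlerForm, Metric.tensor, brk_swap Y Z, map_neg, neg_apply]
  ring

/-- The derivatives of u produced by the Leibniz rule cancel against those produced by the brackets.
The first slot is enough, since dω is antisymmetric. -/
theorem tensorialAt_extd₂_kahlerForm {Y Z : VF I M} {x : M} (hY : SmoothAt Y x)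
    (hZ : SmoothAt Z x) : TensorialAt I E (fun X => extd₂ (kahlerForm J g) X Y Z x) x := by
  have hs : ∀ A : VF I M, kahlerForm J g Z A = fun y => -kahlerForm J g A Z y :=
    fun A => funext fun y => kahlerForm_swap hJ hg Z A y
  refine ⟨fun {u X} hu hX => ?_, fun {X X'} hX hX' => ?_⟩
  · have b1 : ∀ V : VF I M, brk (u • X) V x = -(dir V u x • X x) + u x • brk X V x :=
      fun V => brk_smul_left (V := V) hu hX
    have k1 : ∀ V : VF I M, kahlerForm J g (u • X) V = fun y => u y * kahlerForm J g X V y :=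
      fun V => Metric.tensor_smul_left g u X (app J V)
    have k2 : kahlerForm J g (brk Y Z) (u • X) x = u x * kahlerForm J g (brk Y Z) X x := by
      simp [kahlerForm, Metric.tensor, app, hJ.map_smul]
    simp only [extd₂, hs, dir_neg, k1, k2, dir_smul_left]
    rw [dir_mul hu (diffAt_kahlerForm hJ hg hX hZ), dir_mul hu (diffAt_kahlerForm hJ hg hX hY)]
    simp only [kahlerForm, Metric.tensor, b1, map_add, map_neg, map_smul, add_apply, neg_apply,
      smul_apply, smul_eq_mul]
    ring
  · have b1 : ∀ V : VF I M, brk (X + X') V x = brk X V x + brk X' V x :=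
      fun V => brk_add_left (V := V) hX hX'
    have k1 : ∀ V : VF I M, kahlerForm J g (X + X') V =
        fun y => kahlerForm J g X V y + kahlerForm J g X' V y :=
      fun V => Metric.tensor_add_left g X X' (app J V)
    have k2 : kahlerForm J g (brk Y Z) (X + X') x =
        kahlerForm J g (brk Y Z) X x + kahlerForm J g (brk Y Z) X' x := by
      simp [kahlerForm, Metric.tensor, app, hJ.map_add]
    simp only [extd₂, hs, dir_neg, k1, k2, dir_add_left]
    rw [dir_add (diffAt_kahlerForm hJ hg hX hZ) (diffAt_kahlerForm hJ hg hX' hZ),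
      dir_add (diffAt_kahlerForm hJ hg hX hY) (diffAt_kahlerForm hJ hg hX' hY)]
    simp only [kahlerForm, Metric.tensor, b1, map_add, add_apply]
    ring

/-- Needed because J e_i is a signed frame field: such a pointwise relation suffices to replace all
three arguments of dω. Each slot is brought to the front in turn. -/
theorem extd₂_kahlerForm_smul {X Y Z X' Y' Z' : VF I M} {x : M} {a b c : ℝ}
    (hX : SmoothAt X x) (hY : SmoothAt Y x) (hZ : SmoothAt Z x)
    (hX' : SmoothAt X' x) (hY' : SmoothAt Y' x) (hZ' : SmoothAt Z' x)
    (ha : X x = a • X' x) (hb : Y x = b • Y' x) (hc : Z x = c • Z' x) :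
    extd₂ (kahlerForm J g) X Y Z x = a * b * c * extd₂ (kahlerForm J g) X' Y' Z' x := by
  have key : ∀ {A A' B C : VF I M} {r : ℝ}, SmoothAt A x → SmoothAt A' x → SmoothAt B x →
      SmoothAt C x → A x = r • A' x →
      extd₂ (kahlerForm J g) A B C x = r * extd₂ (kahlerForm J g) A' B C x := by
    intro A A' B C r hA hA' hB hC hr
    have := TensorialAt.apply_sum (tensorialAt_extd₂_kahlerForm hJ hg hB hC)
      (e := fun _ : Fin 1 => A') (fun _ => hA'.diffAt) hA.diffAt (fun _ => r) (by simpa using hr)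
    simpa using this
  rw [key hX hX' hY hZ ha, extd₂_kahlerForm_swap_left hJ hg X' Y, key hY hY' hX' hZ hb,
    extd₂_kahlerForm_swap_right hJ hg Y' X', extd₂_kahlerForm_swap_left hJ hg Y' Z,
    key hZ hZ' hY' hX' hc, extd₂_kahlerForm_swap_left hJ hg Z' Y',
    extd₂_kahlerForm_swap_right hJ hg Y' Z', extd₂_kahlerForm_swap_left hJ hg Y' X']
  ring

theorem torsionForm_expand {X Y Z : VF I M} {x : M} {ι : Type*} [Fintype ι] {e : ι → VF I M}
    (he : ∀ i, SmoothAt (e i) x) (hX : SmoothAt X x) (hY : SmoothAt Y x) (hZ : SmoothAt Z x)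
    (c : ι → ℝ) (h : X x = ∑ i, c i • e i x) :
    torsionForm J g X Y Z x = ∑ i, c i * torsionForm J g (e i) Y Z x := by
  let φ : TangentSpace I x →ₗ[ℝ] TangentSpace I x :=
    { toFun := J x, map_add' := hJ.map_add x, map_smul' := hJ.map_smul x }
  have h' : app J X x = ∑ i, c i • app J (e i) x := by
    change φ (X x) = ∑ i, c i • φ (e i x)
    rw [h, map_sum]
    simp
  have := TensorialAt.apply_sum (tensorialAt_extd₂_kahlerForm hJ hg (hJ.smooth _ _ hY)
    (hJ.smooth _ _ hZ)) (fun i => (hJ.smooth _ _ (he i)).diffAt) (hJ.smooth _ _ hX).diffAt c h'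
  simp only [torsionForm, this, mul_neg, Finset.sum_neg_distrib]

theorem torsionForm_swap_left (X Y Z : VF I M) (x : M) :
    torsionForm J g X Y Z x = -torsionForm J g Y X Z x := by
  simp only [torsionForm]
  rw [extd₂_kahlerForm_swap_left hJ hg]

theorem torsionForm_swap_right (X Y Z : VF I M) (x : M) :
    torsionForm J g X Y Z x = -torsionForm J g X Z Y x := by
  simp only [torsionForm]
  rw [extd₂_kahlerForm_swap_right hJ hg]

end form

/-- The complex structure pairs the basis vectors `0, 1` and `2, 3`: the index of the image. -/
def pairIdx : Fin 4 → Fin 4 := ![1, 0, 3, 2]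

/-- The complex structure pairs the basis vectors `0, 1` and `2, 3`: the sign of the image. -/
def pairSign : Fin 4 → ℝ := ![1, -1, 1, -1]

/-- The square lengths of an orthogonal frame with fibre length function `ψ`. -/
def sqLen (ψ : M → ℝ) : Fin 4 → M → ℝ := ![ψ, ψ, fun _ => 1, fun _ => 1]

/-- A frame on the total space of a holomorphic torus fibration: the first two fields span the
fibres and have square length `ψ`, the last two are orthonormal and horizontal. -/
structure IsFibreFrame (J : (x : M) → TangentSpace I x → TangentSpace I x) (g : Metric I M)
    (U : Set M) (e : Fin 4 → VF I M) (ψ : M → ℝ) (θ σ : Fin 4 → M → ℝ) : Prop where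
  isOpen : IsOpen U
  finrank : 4 = Module.finrank ℝ E
  smooth : ∀ i, ∀ y ∈ U, SmoothAt (e i) y
  pos : ∀ y ∈ U, 0 < ψ y
  inner : ∀ y ∈ U, ∀ i j, g.inner y (e i y) (e j y) = if i = j then sqLen ψ i y else 0
  J_eq : ∀ y ∈ U, ∀ i, J y (e i y) = pairSign i • e (pairIdx i) y
  dir_zero : ∀ y ∈ U, dir (e 0) ψ y = 0
  dir_one : ∀ y ∈ U, dir (e 1) ψ y = 0
  smooth_theta : ∀ i, ∀ y ∈ U, FnSmoothAt I (θ i) y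
  smooth_sigma : ∀ i, ∀ y ∈ U, FnSmoothAt I (σ i) y
  brk_eq : ∀ y ∈ U, ∀ i j,
    brk (e i) (e j) y = ∑ k, structFn (fun l => θ l y) (fun l => σ l y) i j k • e k y

namespace IsFibreFrame

variable {U : Set M} {e : Fin 4 → VF I M} {ψ : M → ℝ} {θ σ : Fin 4 → M → ℝ}
  (h : IsFibreFrame J g U e ψ θ σ)
include h

theorem kahlerForm_eq {y : M} (hy : y ∈ U) (i j : Fin 4) :
    kahlerForm J g (e i) (e j) y =
      if i = pairIdx j then pairSign j * sqLen ψ i y else 0 := by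
  simp only [kahlerForm, Metric.tensor, app, h.J_eq y hy, map_smul, h.inner y hy, smul_eq_mul]
  split_ifs <;> simp

theorem dir_kahlerForm {y : M} (hy : y ∈ U) (X : VF I M) (i j : Fin 4) :
    dir X (kahlerForm J g (e i) (e j)) y =
      if i = pairIdx j then pairSign j * dir X (sqLen ψ i) y else 0 := by
  rw [dir_congr_on h.isOpen hy fun z hz => h.kahlerForm_eq hz i j]
  split_ifs with hij
  · refine dir_const_mul _ ?_
    have hd : FnSmoothAt I (sqLen ψ i) y :=
      FnSmoothAt.congr_on h.isOpen hy (g.smoothAt_tensor (h.smooth i y hy) (h.smooth i y hy))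
        fun z hz => by simp [Metric.tensor, h.inner z hz]
    exact hd.diffAt
  · simp

theorem kahlerForm_brk {y : M} (hy : y ∈ U) (i j k : Fin 4) :
    kahlerForm J g (brk (e i) (e j)) (e k) y =
      structFn (fun l => θ l y) (fun l => σ l y) i j (pairIdx k) *
        (pairSign k * sqLen ψ (pairIdx k) y) := by
  have h1 : ∀ l, g.inner y (e l y) (J y (e k y)) =
      if l = pairIdx k then pairSign k * sqLen ψ l y else 0 := fun l => h.kahlerForm_eq hy l k
  simp only [kahlerForm, Metric.tensor, app, h.brk_eq y hy, map_sum, map_smul, sum_apply,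
    smul_apply, h1]
  simp

/-- J permutes the frame up to sign, so H is a signed copy of dω with paired indices. -/
theorem torsionForm_frame (hJ : IsAlmostComplex J) (hg : IsHermitian J g) {y : M} (hy : y ∈ U)
    (i j k : Fin 4) :
    torsionForm J g (e i) (e j) (e k) y =
      -(pairSign i * pairSign j * pairSign k *
        extd₂ (kahlerForm J g) (e (pairIdx i)) (e (pairIdx j)) (e (pairIdx k)) y) := by
  rw [torsionForm, extd₂_kahlerForm_smul hJ hg (hJ.smooth _ _ (h.smooth i y hy))
    (hJ.smooth _ _ (h.smooth j y hy)) (hJ.smooth _ _ (h.smooth k y hy))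
    (h.smooth _ y hy) (h.smooth _ y hy) (h.smooth _ y hy)
    (h.J_eq y hy i) (h.J_eq y hy j) (h.J_eq y hy k)]

theorem extd₂_frame {y : M} (hy : y ∈ U) (a b c : Fin 4) :
    extd₂ (kahlerForm J g) (e a) (e b) (e c) y =
      (if b = pairIdx c then pairSign c * dir (e a) (sqLen ψ b) y else 0)
      + (if c = pairIdx a then pairSign a * dir (e b) (sqLen ψ c) y else 0)
      + (if a = pairIdx b then pairSign b * dir (e c) (sqLen ψ a) y else 0)
      - structFn (fun l => θ l y) (fun l => σ l y) a b (pairIdx c) *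
        (pairSign c * sqLen ψ (pairIdx c) y)
      + structFn (fun l => θ l y) (fun l => σ l y) a c (pairIdx b) *
        (pairSign b * sqLen ψ (pairIdx b) y)
      - structFn (fun l => θ l y) (fun l => σ l y) b c (pairIdx a) *
        (pairSign a * sqLen ψ (pairIdx a) y) := by
  simp only [extd₂, h.kahlerForm_brk hy, h.dir_kahlerForm hy]

theorem isTorusFrame (h1 : ∀ y ∈ U, ψ y = 1) : IsTorusFrame g U e θ σ where
  isOpen := h.isOpen
  finrank := h.finrank
  smooth := h.smooth
  inner y hy i j := by
    rw [h.inner y hy]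
    fin_cases i <;> simp [sqLen, h1 y hy]
  smooth_theta := h.smooth_theta
  smooth_sigma := h.smooth_sigma
  brk_eq := h.brk_eq

/-- With constant fibre length the components of ω are constant, so dω consists of bracket terms
alone; the σ parts cancel and H becomes θ ∧ A. -/
theorem isWedgeForm (hJ : IsAlmostComplex J) (hg : IsHermitian J g) (h1 : ∀ y ∈ U, ψ y = 1) :
    IsWedgeForm g U e θ (torsionForm J g) where
  swap_left := torsionForm_swap_left hJ hg
  swap_right := torsionForm_swap_right hJ hg
  expand X Y Z y hy hX hY hZ :=
    torsionForm_expand hJ hg (fun i => h.smooth i y hy) hX hY hZ _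
      ((h.isTorusFrame h1).eq_sum hy (X y))
  frame y hy i j k := by
    have hs : ∀ (X : VF I M) a, dir X (sqLen ψ a) y = 0 := fun X a => by
      rw [dir_congr_on (v := fun _ => 1) h.isOpen hy fun z hz => ?_]
      · simp
      · fin_cases a <;> simp [sqLen, h1 z hz]
    have hl : ∀ a, sqLen ψ a y = 1 := fun a => by
      fin_cases a <;> simp [sqLen, h1 y hy]
    rw [h.torsionForm_frame hJ hg hy, h.extd₂_frame hy]
    simp only [hs, hl, mul_zero, ite_self, zero_add, mul_one]
    fin_cases i <;> fin_cases j <;> fin_cases k <;>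
      simp [pairSign, pairIdx, structFn, wedgeArea, areaForm_table] <;> ring

theorem torsionForm_brk (hJ : IsAlmostComplex J) (hg : IsHermitian J g) {y : M} (hy : y ∈ U)
    (a b c d : Fin 4) :
    torsionForm J g (brk (e a) (e b)) (e c) (e d) y =
      ∑ l, structFn (fun l => θ l y) (fun l => σ l y) a b l *
        torsionForm J g (e l) (e c) (e d) y :=
  torsionForm_expand hJ hg (fun i => h.smooth i y hy)
    ((h.smooth a y hy).brk (h.smooth b y hy)) (h.smooth c y hy) (h.smooth d y hy) _
    (h.brk_eq y hy a b)

end IsFibreFrame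

end VFCalc

/-! ### The Jacobi identity and the equation for the fibre length. -/

namespace VFCalc

open VectorField Bundle Topology

variable {E : Type*} [NormedAddCommGroup E] [NormedSpace ℝ E] [FiniteDimensional ℝ E]
  {H : Type*} [TopologicalSpace H] {I : ModelWithCorners ℝ E H}
  {M : Type*} [TopologicalSpace M] [ChartedSpace H M] [IsManifold I ∞ M]
  {g : Metric I M} {J : (x : M) → TangentSpace I x → TangentSpace I x}

theorem dir_structFn {θ σ : Fin 4 → M → ℝ} {x : M} (hθ : ∀ i, FnSmoothAt I (θ i) x)
    (hσ : ∀ i, FnSmoothAt I (σ i) x) (X : VF I M) (i j k : Fin 4) :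
    dir X (fun y => structFn (fun l => θ l y) (fun l => σ l y) i j k) x =
      structFn (fun l => dir X (θ l) x) (fun l => dir X (σ l) x) i j k := by
  have h := smoothAt_wedgeArea hθ i j k
  have s (a : Fin 4) (c : ℝ) : FnSmoothAt I (fun y => σ a y * c) x :=
    FnSmoothAt.mul (hσ a) (FnSmoothAt.const c)
  have d (a : Fin 4) (c : ℝ) : dir X (fun y => σ a y * c) x = dir X (σ a) x * c := by
    rw [dir_mul (hσ a).diffAt mdifferentiableAt_const]; simp
  simp only [structFn]
  rw [dir_sub (FnSmoothAt.add (FnSmoothAt.neg h) (s i _)).diffAt (s j _).diffAt,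
    dir_add (FnSmoothAt.neg h).diffAt (s i _).diffAt, dir_neg, dir_wedgeArea hθ, d, d]

theorem smoothAt_structFn {θ σ : Fin 4 → M → ℝ} {x : M} (hθ : ∀ i, FnSmoothAt I (θ i) x)
    (hσ : ∀ i, FnSmoothAt I (σ i) x) (i j k : Fin 4) :
    FnSmoothAt I (fun y => structFn (fun l => θ l y) (fun l => σ l y) i j k) x := by
  have h := smoothAt_wedgeArea hθ i j k
  have s (a : Fin 4) (c : ℝ) : FnSmoothAt I (fun y => σ a y * c) x :=
    FnSmoothAt.mul (hσ a) (FnSmoothAt.const c)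
  exact FnSmoothAt.sub (FnSmoothAt.add (FnSmoothAt.neg h) (s i _)) (s j _)

namespace IsFibreFrame

variable {U : Set M} {e : Fin 4 → VF I M} {ψ : M → ℝ} {θ σ : Fin 4 → M → ℝ}
  (h : IsFibreFrame J g U e ψ θ σ)
include h

theorem sqLen_pos {y : M} (hy : y ∈ U) (i : Fin 4) : 0 < sqLen ψ i y := by
  fin_cases i <;> simp [sqLen, h.pos y hy]

theorem smooth_psi {y : M} (hy : y ∈ U) : FnSmoothAt I ψ y :=
  FnSmoothAt.congr_on h.isOpen hy (g.smoothAt_tensor (h.smooth 0 y hy) (h.smooth 0 y hy))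
    fun z hz => by simp [Metric.tensor, h.inner z hz, sqLen]

theorem coeff_ext {y : M} (hy : y ∈ U) {c c' : Fin 4 → ℝ}
    (hc : ∑ i, c i • e i y = ∑ i, c' i • e i y) (m : Fin 4) : c m = c' m := by
  have := congrArg (fun v => g.inner y v (e m y)) hc
  simpa [h.inner y hy, (h.sqLen_pos hy m).ne'] using this

theorem brk_brk {x : M} (hx : x ∈ U) (i j k : Fin 4) :
    brk (e i) (brk (e j) (e k)) x = ∑ m,
      (structFn (fun l => dir (e i) (θ l) x) (fun l => dir (e i) (σ l) x) j k m +
        ∑ l, structFn (fun l => θ l x) (fun l => σ l x) j k l *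
          structFn (fun l => θ l x) (fun l => σ l x) i l m) • e m x := by
  have hθ : ∀ i, FnSmoothAt I (θ i) x := fun i => h.smooth_theta i x hx
  have hσ : ∀ i, FnSmoothAt I (σ i) x := fun i => h.smooth_sigma i x hx
  have hc (l : Fin 4) := smoothAt_structFn hθ hσ j k l
  have e1 : brk (e i) (brk (e j) (e k)) x = brk (e i)
      (fun y => ∑ l, structFn (fun l => θ l y) (fun l => σ l y) j k l • e l y) x :=
    brk_congr .rfl (Filter.eventuallyEq_of_mem (h.isOpen.mem_nhds hx) fun y hy => h.brk_eq y hy j k)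
  rw [e1, brk_sum_right (fun l (_ : l ∈ Finset.univ) =>
    DiffAt.smul (hc l).diffAt (h.smooth l x hx).diffAt)]
  have e2 : ∀ l : Fin 4, brk (e i)
      (fun y => structFn (fun l => θ l y) (fun l => σ l y) j k l • e l y) x =
      structFn (fun l => dir (e i) (θ l) x) (fun l => dir (e i) (σ l) x) j k l • e l x +
        structFn (fun l => θ l x) (fun l => σ l x) j k l • brk (e i) (e l) x := fun l => by
    rw [← dir_structFn hθ hσ]
    exact brk_smul_right (hc l).diffAt (h.smooth l x hx).diffAt
  simp only [e2, h.brk_eq x hx, Finset.sum_add_distrib, add_smul, Finset.smul_sum,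
    Finset.sum_smul, smul_smul]
  congr 1
  exact Finset.sum_comm

theorem jacobi {x : M} (hx : x ∈ U) (i j k m : Fin 4) :
    structFn (fun l => dir (e i) (θ l) x) (fun l => dir (e i) (σ l) x) j k m +
        ∑ l, structFn (fun l => θ l x) (fun l => σ l x) j k l *
          structFn (fun l => θ l x) (fun l => σ l x) i l m =
      -(structFn (fun l => dir (e k) (θ l) x) (fun l => dir (e k) (σ l) x) i j m +
        ∑ l, structFn (fun l => θ l x) (fun l => σ l x) i j l *
          structFn (fun l => θ l x) (fun l => σ l x) k l m) +
      (structFn (fun l => dir (e j) (θ l) x) (fun l => dir (e j) (σ l) x) i k m +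
        ∑ l, structFn (fun l => θ l x) (fun l => σ l x) i k l *
          structFn (fun l => θ l x) (fun l => σ l x) j l m) := by
  have hj := brk_jacobi (h.smooth i x hx) (h.smooth j x hx) (h.smooth k x hx)
  rw [brk_swap (brk (e i) (e j)) (e k), h.brk_brk hx, h.brk_brk hx, h.brk_brk hx,
    ← Finset.sum_neg_distrib] at hj
  simp only [← neg_smul] at hj
  rw [← Finset.sum_add_distrib] at hj
  simp only [← add_smul] at hj
  exact h.coeff_ext hx hj m

/-- The consequences of the Jacobi identity for the structure functions. -/
theorem jacobi_table {x : M} (hx : x ∈ U) :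
    (dir (e 0) (θ 0) x = 0 ∧ dir (e 0) (θ 1) x = 0 ∧ dir (e 1) (θ 0) x = 0 ∧
      dir (e 1) (θ 1) x = 0) ∧
    (dir (e 0) (σ 2) x = (σ 0 x - θ 0 x) * σ 3 x + (dir (e 2) (σ 0) x - dir (e 2) (θ 0) x) ∧
      dir (e 0) (σ 3) x = -(σ 0 x - θ 0 x) * σ 2 x + (dir (e 3) (σ 0) x - dir (e 3) (θ 0) x)) ∧
    dir (e 1) (σ 2) x = (σ 1 x - θ 1 x) * σ 3 x + (dir (e 2) (σ 1) x - dir (e 2) (θ 1) x) ∧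
      dir (e 1) (σ 3) x = -(σ 1 x - θ 1 x) * σ 2 x + (dir (e 3) (σ 1) x - dir (e 3) (θ 1) x) := by
  -- One vertical and both horizontal fields enter. The vertical components give the invariance of θ
  -- along the fibres, the horizontal ones the derivatives of σ 2 and σ 3 along the fibres.
  have j0 := h.jacobi hx 0 2 3
  have j1 := h.jacobi hx 1 2 3
  have a0 := j0 0; have a1 := j0 1; have a2 := j0 2; have a3 := j0 3
  have b0 := j1 0; have b1 := j1 1; have b2 := j1 2; have b3 := j1 3
  simp only [Fin.sum_univ_four, structFn,
    wedgeArea, areaForm_table, mul_zero, zero_mul, add_zero, zero_add, sub_zero, mul_one, neg_zero,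
    mul_neg, neg_mul, zero_sub] at a0 a1 a2 a3 b0 b1 b2 b3
  refine ⟨⟨?_, ?_, ?_, ?_⟩, ⟨?_, ?_⟩, ?_, ?_⟩ <;> linarith

/-- These four components determine H: two come from the curvature of the fibration, two from the
variation of the fibre length. -/
theorem torsionForm_table (hJ : IsAlmostComplex J) (hg : IsHermitian J g) {y : M} (hy : y ∈ U) :
    torsionForm J g (e 0) (e 2) (e 3) y = θ 0 y * ψ y ∧
    torsionForm J g (e 1) (e 2) (e 3) y = θ 1 y * ψ y ∧
    torsionForm J g (e 0) (e 1) (e 2) y = dir (e 3) ψ y ∧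
    torsionForm J g (e 0) (e 1) (e 3) y = -dir (e 2) ψ y := by
  have hs : ∀ X : VF I M, dir X (sqLen ψ 2) y = 0 ∧ dir X (sqLen ψ 3) y = 0 := fun X => by
    constructor <;> exact dir_const _
  have h0 := h.dir_zero y hy
  have h1 := h.dir_one y hy
  simp only [h.torsionForm_frame hJ hg hy, h.extd₂_frame hy]
  refine ⟨?_, ?_, ?_, ?_⟩ <;>
    simp [pairSign, pairIdx, sqLen, structFn, wedgeArea, areaForm_table, h0, h1]

/-- Pluriclosedness makes the fibre length function harmonic. -/
theorem harmonic (hJ : IsAlmostComplex J) (hg : IsPluriclosed J g) {x : M} (hx : x ∈ U) :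
    dir (e 2) (dir (e 2) ψ) x + dir (e 3) (dir (e 3) ψ) x =
      σ 2 x * dir (e 3) ψ x - σ 3 x * dir (e 2) ψ x := by
  -- In dH(e0, e1, e2, e3) the curvature enters only through e0(θ1 ψ) and e1(θ0 ψ), which vanish.
  -- The brackets otherwise produce repeated arguments, except for the horizontal part of [e2, e3],
  -- which gives the first order terms.
  have hc := hg.2 x _ _ _ _ (h.smooth 0 x hx) (h.smooth 1 x hx) (h.smooth 2 x hx) (h.smooth 3 x hx)
  obtain ⟨⟨t1, t2, t3, t4⟩, -⟩ := h.jacobi_table hx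
  have sθ : ∀ i, FnDiffAt I (θ i) x := fun i => (h.smooth_theta i x hx).diffAt
  have sψ := (h.smooth_psi hx).diffAt
  have T := fun y hy => h.torsionForm_table hJ hg.1 (y := y) hy
  simp only [extd₃, h.torsionForm_brk hJ hg.1 hx] at hc
  rw [dir_congr_on h.isOpen hx fun y hy => (T y hy).1,
    dir_congr_on h.isOpen hx fun y hy => (T y hy).2.1,
    dir_congr_on h.isOpen hx fun y hy => (T y hy).2.2.1,
    dir_congr_on h.isOpen hx fun y hy => (T y hy).2.2.2, dir_mul (sθ _) sψ, dir_mul (sθ _) sψ,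
    h.dir_zero x hx, h.dir_one x hx, t2, t3, dir_neg] at hc
  have z : ∀ A B : VF I M, torsionForm J g A A B x = 0 := fun A B => by
    have := torsionForm_swap_left hJ hg.1 A A B x; linarith
  have z' : ∀ A B : VF I M, torsionForm J g A B B x = 0 := fun A B => by
    have := torsionForm_swap_right hJ hg.1 A B B x; linarith
  have z'' : ∀ A B : VF I M, torsionForm J g A B A x = 0 := fun A B => by
    rw [torsionForm_swap_right hJ hg.1, z, neg_zero]
  have r1 : torsionForm J g (e 2) (e 0) (e 1) x = dir (e 3) ψ x := by
    rw [torsionForm_swap_left hJ hg.1, torsionForm_swap_right hJ hg.1, neg_neg, (T x hx).2.2.1]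
  have r2 : torsionForm J g (e 3) (e 0) (e 1) x = -dir (e 2) ψ x := by
    rw [torsionForm_swap_left hJ hg.1, torsionForm_swap_right hJ hg.1, neg_neg, (T x hx).2.2.2]
  simp only [Fin.sum_univ_four, structFn, wedgeArea, areaForm_table, z, z', z'', r1, r2, mul_zero,
    zero_mul, add_zero, zero_add, sub_zero, mul_one, neg_zero, mul_neg, neg_mul, zero_sub] at hc
  linarith

end IsFibreFrame

end VFCalc

/-! ### Adapted frames for a pair of commuting Killing fields. -/

namespace VFCalc

open VectorField Bundle Topology

variable {E : Type*} [NormedAddCommGroup E] [NormedSpace ℝ E] [FiniteDimensional ℝ E]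
  {H : Type*} [TopologicalSpace H] {I : ModelWithCorners ℝ E H}
  {M : Type*} [TopologicalSpace M] [ChartedSpace H M] [IsManifold I ∞ M]
  {g : Metric I M} {J : (x : M) → TangentSpace I x → TangentSpace I x}

/-- `Z` and `J Z` are commuting, nowhere vanishing Killing fields. -/
structure IsTorusAction (J : (x : M) → TangentSpace I x → TangentSpace I x) (g : Metric I M)
    (Z : VF I M) : Prop where
  smooth : ∀ x, SmoothAt Z x
  ne_zero : ∀ x, Z x ≠ 0
  killing : Vanishes₂ (lieDeriv₂ Z g.tensor)
  killing_app : Vanishes₂ (lieDeriv₂ (app J Z) g.tensor)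
  brk_eq_zero : ∀ x, brk Z (app J Z) x = 0

theorem inner_brk_of_killing {K X Y : VF I M} {x : M} (hK : Vanishes₂ (lieDeriv₂ K g.tensor))
    (hX : SmoothAt X x) (hY : SmoothAt Y x) :
    g.inner x (brk K X x) (Y x) + g.inner x (X x) (brk K Y x) = dir K (g.tensor X Y) x := by
  have := hK x X Y hX hY
  simp only [lieDeriv₂] at this
  simp only [Metric.tensor] at this ⊢
  linarith

theorem lieDeriv₂_const_smul (c : ℝ) {K X Y : VF I M} {T : Tensor₂ I M} {x : M}
    (hK : SmoothAt K x) (h : ∀ a : ℝ, T (fun y => a • brk K X y) Y x = a * T (brk K X) Y x)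
    (h' : ∀ a : ℝ, T X (fun y => a • brk K Y y) x = a * T X (brk K Y) x)
    (hT : ∀ A B : VF I M, A x = B x → T A Y x = T B Y x ∧ T X A x = T X B x) :
    lieDeriv₂ (fun y => c • K y) T X Y x = c * lieDeriv₂ K T X Y x := by
  have hb : ∀ V : VF I M, brk (fun y => c • K y) V x = c • brk K V x := fun V => by
    have := brk_smul_left (V := V) (u := fun _ => c) (x := x) mdifferentiableAt_const hK.diffAt
    simpa using this
  have h1 := (hT (brk (fun y => c • K y) X) (fun y => c • brk K X y) (hb X)).1
  have h2 := (hT (brk (fun y => c • K y) Y) (fun y => c • brk K Y y) (hb Y)).2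
  simp only [lieDeriv₂, h1, h2, h, h', dir_apply, map_smul, smul_eq_mul]
  ring

/-- The symmetries of the brackets of a frame that is adapted to commuting Killing fields
determine all structure functions. -/
theorem div_eq_structFn (c : Fin 4 → Fin 4 → Fin 4 → ℝ) {r : ℝ} (hr : r ≠ 0)
    (sw : ∀ a b d, c a b d = -c b a d) (k0 : ∀ b d, c 0 b d = -c 0 d b)
    (k1 : ∀ b d, c 1 b d = -c 1 d b) (c01 : ∀ d, c 0 1 d = 0) (i j k : Fin 4) :
    c i j k / (![r, r, 1, 1] : Fin 4 → ℝ) k =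
      structFn ![r⁻¹ * -c 2 3 0, r⁻¹ * -c 2 3 1, 0, 0]
        ![r⁻¹ * -c 2 3 0 + c 0 2 3, r⁻¹ * -c 2 3 1 + c 1 2 3, -c 2 3 2, -c 2 3 3] i j k := by
  have cs : ∀ a d, c a a d = 0 := fun a d => by have := sw a a d; linarith
  have c10 : ∀ d, c 1 0 d = 0 := fun d => by rw [sw, c01, neg_zero]
  have c0 : ∀ b, c 0 b 0 = 0 ∧ c 0 b 1 = 0 ∧ c 0 b b = 0 := fun b =>
    ⟨by rw [k0, cs, neg_zero], by rw [k0, c01, neg_zero], by have := k0 b b; linarith⟩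
  have c1 : ∀ b, c 1 b 0 = 0 ∧ c 1 b 1 = 0 ∧ c 1 b b = 0 := fun b =>
    ⟨by rw [k1, c10, neg_zero], by rw [k1, cs, neg_zero], by have := k1 b b; linarith⟩
  have c2 : ∀ d, c 2 0 d = -c 0 2 d ∧ c 2 1 d = -c 1 2 d := fun d => ⟨sw _ _ _, sw _ _ _⟩
  have c3 : ∀ d, c 3 0 d = -c 0 3 d ∧ c 3 1 d = -c 1 3 d ∧ c 3 2 d = -c 2 3 d :=
    fun d => ⟨sw _ _ _, sw _ _ _, sw _ _ _⟩
  have x5 := k0 3 2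
  have x6 := k1 3 2
  fin_cases i <;> fin_cases j <;> fin_cases k <;>
    simp [structFn, wedgeArea, areaForm_table, cs, c01, c10, c2, c3, c0, c1, x5, x6] <;>
    field_simp

namespace IsTorusAction

variable {Z : VF I M} (hZ : IsTorusAction J g Z) (hJ : IsAlmostComplex J) (hg : IsHermitian J g)
include hZ hJ

theorem smooth_app (x : M) : SmoothAt (app J Z) x := hJ.smooth _ _ (hZ.smooth x)

theorem const_smul {c : ℝ} (hc : c ≠ 0) : IsTorusAction J g (fun x => c • Z x) := by
  have e : app J (fun x => c • Z x) = fun x => c • app J Z x :=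
    funext fun x => hJ.map_smul x c (Z x)
  have k : ∀ K : VF I M, (∀ x, SmoothAt K x) → Vanishes₂ (lieDeriv₂ K g.tensor) →
      Vanishes₂ (lieDeriv₂ (fun x => c • K x) g.tensor) := fun K hK h x X Y hX hY => by
    rw [lieDeriv₂_const_smul c (hK x) (fun a => by simp [Metric.tensor])
      (fun a => by simp [Metric.tensor]) (fun A B h => by simp [Metric.tensor, h]), h x X Y hX hY,
      mul_zero]
  refine ⟨fun x => (hZ.smooth x).const_smul c, fun x => smul_ne_zero hc (hZ.ne_zero x),
    k _ hZ.smooth hZ.killing, ?_, fun x => ?_⟩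
  · rw [e]
    exact k _ (hZ.smooth_app hJ) hZ.killing_app
  · rw [e]
    have h1 := brk_smul_left (V := fun y => c • app J Z y) (u := fun _ => c) (x := x)
      mdifferentiableAt_const (hZ.smooth x).diffAt
    have h2 := brk_smul_right (V := Z) (u := fun _ => c) (x := x)
      mdifferentiableAt_const (hZ.smooth_app hJ x).diffAt
    rw [h1, h2, hZ.brk_eq_zero]
    simp

include hg

/-- Around every point there is a unit vector field orthogonal to the fibres. -/
theorem exists_horizontal (hd : Module.finrank ℝ E = 4) (x : M) :
    ∃ (U : Set M) (X : VF I M), IsOpen U ∧ x ∈ U ∧ (∀ y ∈ U, SmoothAt X y) ∧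
      ∀ y ∈ U, g.inner y (X y) (X y) = 1 ∧ g.inner y (Z y) (X y) = 0 ∧
        g.inner y (app J Z y) (X y) = 0 := by
  classical
  -- Two vectors cannot span a four-dimensional space.
  have hn : ∃ v : TangentSpace I x, v ∉ Submodule.span ℝ {Z x, app J Z x} := by
    by_contra! hc
    have h1 : Submodule.span ℝ {Z x, app J Z x} = ⊤ := Submodule.eq_top_iff'.2 hc
    have h2 := finrank_span_le_card (R := ℝ) ({Z x, app J Z x} : Set (TangentSpace I x))
    rw [h1, finrank_top] at h2
    have h3 : Module.finrank ℝ (TangentSpace I x) = 4 := hd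
    have h4 : ({Z x, app J Z x} : Set (TangentSpace I x)).toFinset.card ≤ 2 := by
      rw [← Set.ncard_eq_toFinset_card']
      exact (Set.ncard_insert_le _ _).trans (by simp)
    omega
  obtain ⟨v, hv⟩ := hn
  obtain ⟨X, U, hU, hxU, hX, hXv⟩ := exists_smooth_extension v
  set ψ := g.tensor Z Z with hψ
  have ψne : ∀ y, ψ y ≠ 0 := fun y h0 => hZ.ne_zero y (Metric.eq_zero_of_inner_self h0)
  have sψ : ∀ y, FnSmoothAt I (fun y => (ψ y)⁻¹) y := fun y =>
    FnSmoothAt.inv (g.smoothAt_tensor (hZ.smooth y) (hZ.smooth y)) (ψne y)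
  -- Projection off the fibres: Z and JZ are orthogonal and both have square length ψ.
  let Y : VF I M := fun y => X y - ((ψ y)⁻¹ * g.tensor Z X y) • Z y
    - ((ψ y)⁻¹ * g.tensor (app J Z) X y) • app J Z y
  have sY : ∀ y ∈ U, SmoothAt Y y := fun y hy =>
    SmoothAt.sub (SmoothAt.sub (hX y hy)
      (SmoothAt.smul (FnSmoothAt.mul (sψ y) (g.smoothAt_tensor (hZ.smooth y) (hX y hy)))
        (hZ.smooth y)))
      (SmoothAt.smul (FnSmoothAt.mul (sψ y) (g.smoothAt_tensor (hZ.smooth_app hJ y) (hX y hy)))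
        (hZ.smooth_app hJ y))
  have o1 : ∀ y, g.inner y (Z y) (app J Z y) = 0 := fun y => by
    have := inner_J_right hJ hg y (Z y) (Z y)
    rw [g.symm_apply (J y (Z y))] at this
    simp only [app]; linarith
  have o2 : ∀ y, g.inner y (app J Z y) (Z y) = 0 := fun y => by rw [g.symm_apply, o1]
  have o3 : ∀ y, g.inner y (app J Z y) (app J Z y) = ψ y := fun y => hg y _ _
  have oY : ∀ y, g.inner y (Z y) (Y y) = 0 ∧ g.inner y (app J Z y) (Y y) = 0 := fun y => by
    have hp : g.inner y (Z y) (Z y) = ψ y := rfl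
    constructor <;>
      simp only [Y, map_sub, map_smul, o1, o2, o3, hp, smul_eq_mul] <;>
      simp only [Metric.tensor] <;> field_simp [ψne y] <;> ring
  have hYx : Y x ≠ 0 := fun h0 => hv <| by
    have : v = ((ψ x)⁻¹ * g.tensor Z X x) • Z x
        + ((ψ x)⁻¹ * g.tensor (app J Z) X x) • app J Z x := by
      rw [← hXv, ← sub_eq_zero, ← sub_sub]; exact h0
    rw [this]
    exact Submodule.mem_span_pair.2 ⟨_, _, rfl⟩
  have hpos : 0 < g.tensor Y Y x := g.pos x _ hYx
  have hc : ContinuousOn (g.tensor Y Y) U := fun y hy =>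
    (g.smoothAt_tensor (sY y hy) (sY y hy)).continuousAt.continuousWithinAt
  refine ⟨U ∩ g.tensor Y Y ⁻¹' Set.Ioi 0, fun y => (√(g.tensor Y Y y))⁻¹ • Y y,
    hc.isOpen_inter_preimage hU isOpen_Ioi, ⟨hxU, hpos⟩, fun y hy => ?_, fun y hy => ?_⟩
  · have hy0 : 0 < g.tensor Y Y y := hy.2
    exact SmoothAt.smul (FnSmoothAt.inv (FnSmoothAt.sqrt
      (g.smoothAt_tensor (sY y hy.1) (sY y hy.1)) hy0.ne') (Real.sqrt_pos.2 hy0).ne') (sY y hy.1)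
  · have hy0 : 0 < g.tensor Y Y y := hy.2
    refine ⟨?_, ?_, ?_⟩
    · have hs := Real.mul_self_sqrt hy0.le
      have hne := (Real.sqrt_pos.2 hy0).ne'
      simp only [map_smul, smul_apply, smul_eq_mul]
      change _ * (_ * g.tensor Y Y y) = 1
      field_simp
      nlinarith
    · simp [oY]
    · simp [oY]

/-- The flows of Z and JZ are isometric and, since the fields commute, preserve Z. -/
theorem dir_length (x : M) : dir Z (g.tensor Z Z) x = 0 ∧ dir (app J Z) (g.tensor Z Z) x = 0 := by
  constructor
  · rw [← inner_brk_of_killing hZ.killing (hZ.smooth x) (hZ.smooth x), brk_self]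
    simp
  · rw [← inner_brk_of_killing hZ.killing_app (hZ.smooth x) (hZ.smooth x), brk_swap,
      hZ.brk_eq_zero]
    simp

theorem exists_fibreFrame (hd : Module.finrank ℝ E = 4) (x : M) :
    ∃ (U : Set M) (e : Fin 4 → VF I M) (θ σ : Fin 4 → M → ℝ), x ∈ U ∧
      IsFibreFrame J g U e (g.tensor Z Z) θ σ ∧ e 0 = Z ∧ e 1 = app J Z := by
  obtain ⟨U, X, hU, hxU, sX, hX⟩ := hZ.exists_horizontal hJ hg hd x
  set ψ := g.tensor Z Z with hψ
  have ψne : ∀ y, ψ y ≠ 0 := fun y h0 => hZ.ne_zero y (Metric.eq_zero_of_inner_self h0)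
  let e : Fin 4 → VF I M := ![Z, app J Z, X, app J X]
  have se : ∀ i, ∀ y ∈ U, SmoothAt (e i) y := fun i y hy => by
    fin_cases i
    exacts [hZ.smooth y, hZ.smooth_app hJ y, sX y hy, hJ.smooth _ _ (sX y hy)]
  have oJ : ∀ y (v : TangentSpace I y), g.inner y v (J y v) = 0 := fun y v => by
    have := inner_J_right hJ hg y v v
    rw [g.symm_apply (J y v)] at this
    linarith
  have oJ' : ∀ y (v : TangentSpace I y), g.inner y (J y v) v = 0 := fun y v => by
    rw [g.symm_apply, oJ]
  have hin : ∀ y ∈ U, ∀ i j, g.inner y (e i y) (e j y) = if i = j then sqLen ψ i y else 0 := by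
    intro y hy i j
    obtain ⟨h1, h2, h3⟩ := hX y hy
    have h2' : g.inner y (X y) (Z y) = 0 := by rw [g.symm_apply, h2]
    have h3' : g.inner y (X y) (app J Z y) = 0 := by rw [g.symm_apply, h3]
    have h4 : g.inner y (Z y) (J y (X y)) = 0 := by
      rw [inner_J_right hJ hg]
      change -g.inner y (app J Z y) (X y) = 0
      rw [h3, neg_zero]
    have h4' : g.inner y (J y (X y)) (Z y) = 0 := by rw [g.symm_apply, h4]
    have h0 : g.inner y (Z y) (Z y) = ψ y := rfl
    have h5 : g.inner y (app J Z y) (J y (X y)) = 0 := (hg y _ _).trans h2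
    have h5' : g.inner y (J y (X y)) (app J Z y) = 0 := by rw [g.symm_apply, h5]
    have h6 : g.inner y (J y (X y)) (J y (X y)) = 1 := (hg y _ _).trans h1
    fin_cases i <;> fin_cases j
    exacts [h0, oJ _ _, h2, h4, oJ' _ _, (hg y _ _).trans h0, h3, h5, h2', h3', h1, oJ _ _,
      h4', h5', oJ' _ _, h6]
  let c : Fin 4 → Fin 4 → Fin 4 → M → ℝ := fun i j k => g.tensor (brk (e i) (e j)) (e k)
  have sc : ∀ i j k, ∀ y ∈ U, FnSmoothAt I (c i j k) y := fun i j k y hy =>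
    g.smoothAt_tensor ((se i y hy).brk (se j y hy)) (se k y hy)
  have sψ : ∀ y, FnSmoothAt I (fun y => (ψ y)⁻¹) y := fun y =>
    FnSmoothAt.inv (g.smoothAt_tensor (hZ.smooth y) (hZ.smooth y)) (ψne y)
  -- The formula for the brackets is inverted: [e2, e3] has the components -θ0, -θ1, -σ2, -σ3, and
  -- [e_a, e2] = (σ_a - θ_a) e3 for a = 0, 1. The factor 1/ψ accounts for vertical fields not of
  -- unit length.
  let θ₀ : M → ℝ := fun y => (ψ y)⁻¹ * -c 2 3 0 y
  let θ₁ : M → ℝ := fun y => (ψ y)⁻¹ * -c 2 3 1 y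
  let θ : Fin 4 → M → ℝ := ![θ₀, θ₁, fun _ => 0, fun _ => 0]
  let σ : Fin 4 → M → ℝ := ![fun y => θ₀ y + c 0 2 3 y, fun y => θ₁ y + c 1 2 3 y,
    fun y => -c 2 3 2 y, fun y => -c 2 3 3 y]
  have sθ₀ : ∀ y ∈ U, FnSmoothAt I θ₀ y := fun y hy =>
    FnSmoothAt.mul (sψ y) (FnSmoothAt.neg (sc 2 3 0 y hy))
  have sθ₁ : ∀ y ∈ U, FnSmoothAt I θ₁ y := fun y hy =>
    FnSmoothAt.mul (sψ y) (FnSmoothAt.neg (sc 2 3 1 y hy))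
  refine ⟨U, e, θ, σ, hxU, ⟨hU, hd.symm, se, fun y _ => g.pos y _ (hZ.ne_zero y), hin,
    fun y hy i => ?_, fun y _ => (hZ.dir_length hJ hg y).1, fun y _ => (hZ.dir_length hJ hg y).2,
    fun i y hy => ?_, fun i y hy => ?_, fun y hy i j => ?_⟩, rfl, rfl⟩
  · fin_cases i
    exacts [(one_smul ℝ _).symm, (hJ.sq y _).trans (neg_one_smul ℝ _).symm,
      (one_smul ℝ _).symm, (hJ.sq y _).trans (neg_one_smul ℝ _).symm]
  · fin_cases i
    exacts [sθ₀ y hy, sθ₁ y hy, FnSmoothAt.const _, FnSmoothAt.const _]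
  · fin_cases i
    exacts [FnSmoothAt.add (sθ₀ y hy) (sc 0 2 3 y hy), FnSmoothAt.add (sθ₁ y hy) (sc 1 2 3 y hy),
      FnSmoothAt.neg (sc 2 3 2 y hy), FnSmoothAt.neg (sc 2 3 3 y hy)]
  · have hl : ∀ i, sqLen ψ i y ≠ 0 := fun i => by fin_cases i <;> simp [sqLen, ψne]
    -- The products of frame fields are 0, 1 or ψ, all invariant along the fibres. The Killing
    -- equation therefore says that `c a b d` is antisymmetric in b and d for vertical a.
    have dl : ∀ a : Fin 4, a = 0 ∨ a = 1 → ∀ b d, dir (e a) (g.tensor (e b) (e d)) y = 0 := by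
      intro a ha b d
      rw [dir_congr_on (u := g.tensor (e b) (e d)) hU hy fun z hz => hin z hz b d]
      split_ifs
      · have l := hZ.dir_length hJ hg y
        rcases ha with rfl | rfl <;> fin_cases b
        exacts [l.1, l.1, dir_const _, dir_const _, l.2, l.2, dir_const _, dir_const _]
      · exact dir_const _
    have ks : ∀ a : Fin 4, a = 0 ∨ a = 1 → ∀ b d, c a b d y = -c a d b y := by
      intro a ha b d
      have hk : Vanishes₂ (lieDeriv₂ (e a) g.tensor) := by
        rcases ha with rfl | rfl
        exacts [hZ.killing, hZ.killing_app]
      have h1 := inner_brk_of_killing hk (se b y hy) (se d y hy)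
      rw [dl a ha, g.symm_apply (e b y)] at h1
      exact eq_neg_of_add_eq_zero_left h1
    have k0 := ks 0 (.inl rfl)
    have k1 := ks 1 (.inr rfl)
    have sw : ∀ a b d, c a b d y = -c b a d y := fun a b d => by
      simp only [c, Metric.tensor]
      rw [brk_swap (e a) (e b)]
      simp
    have c01 : ∀ d, c 0 1 d y = 0 := fun d => by simp [c, e, Metric.tensor, hZ.brk_eq_zero]
    rw [eq_sum_orthogonal hd.symm hl (hin y hy) (brk (e i) (e j) y)]
    refine Finset.sum_congr rfl fun k _ => ?_
    congr 1
    change c i j k y / sqLen ψ k y = _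
    have key := div_eq_structFn (fun i j k => c i j k y) (ψne y) sw k0 k1 c01 i j k
    convert key using 2
    · fin_cases k <;> rfl
    · funext l; fin_cases l <;> rfl
    · funext l; fin_cases l <;> rfl

end IsTorusAction

end VFCalc

/-! ### Derivative tests along vector fields and the Hopf barrier. -/

namespace VFCalc

open VectorField Bundle Topology Filter

variable {E : Type*} [NormedAddCommGroup E] [NormedSpace ℝ E] [FiniteDimensional ℝ E]
  {H : Type*} [TopologicalSpace H] {I : ModelWithCorners ℝ E H}
  {M : Type*} [TopologicalSpace M] [ChartedSpace H M] [IsManifold I ∞ M]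

theorem dir_comp_real {φ : ℝ → ℝ} {φ' : ℝ} {u : M → ℝ} {X : VF I M} {x : M}
    (hφ : HasDerivAt φ φ' (u x)) (hu : FnDiffAt I u x) :
    dir X (fun y => φ (u y)) x = φ' * dir X u x := by
  have h : HasMFDerivAt I 𝓘(ℝ, ℝ) (φ ∘ u) x _ :=
    HasMFDerivAt.comp x hφ.hasFDerivAt.hasMFDerivAt hu.hasMFDerivAt
  have h2 := h.mfderiv
  change mfderiv I 𝓘(ℝ, ℝ) (φ ∘ u) x (X x) = _
  rw [h2]
  exact mul_comm (dir X u x) φ'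

theorem hasDerivAt_comp_curve {u : M → ℝ} {X : VF I M} {γ : ℝ → M} {t : ℝ}
    (hγ : HasMFDerivAt 𝓘(ℝ, ℝ) I γ t (ContinuousLinearMap.smulRight (1 : ℝ →L[ℝ] ℝ) (X (γ t))))
    (hu : FnDiffAt I u (γ t)) : HasDerivAt (fun s => u (γ s)) (dir X u (γ t)) t := by
  have h : HasMFDerivAt 𝓘(ℝ, ℝ) 𝓘(ℝ, ℝ) (u ∘ γ) t _ :=
    HasMFDerivAt.comp t hu.hasMFDerivAt hγ
  have h2 : HasMFDerivAt 𝓘(ℝ, ℝ) 𝓘(ℝ, ℝ) (u ∘ γ) t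
      (ContinuousLinearMap.smulRight (1 : ℝ →L[ℝ] ℝ) (dir X u (γ t))) := by
    convert h using 1
    refine ContinuousLinearMap.ext fun (c : ℝ) => ?_
    change c • dir X u (γ t) = mfderiv I 𝓘(ℝ, ℝ) u (γ t) (c • X (γ t))
    rw [map_smul]
    rfl
  have h3 : HasFDerivAt (u ∘ γ) (ContinuousLinearMap.smulRight (1 : ℝ →L[ℝ] ℝ) (dir X u (γ t))) t :=
    hasMFDerivAt_iff_hasFDerivAt.1 h2
  have h4 := h3.hasDerivAt
  rwa [ContinuousLinearMap.smulRight_apply, one_apply_eq_self, one_smul] at h4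

variable [I.Boundaryless]

/-- The first and second derivative test along vector fields. -/
theorem dir_eq_zero_and_dir_dir_nonpos {u : M → ℝ} {X : VF I M} {x : M} (hX : SmoothAt X x)
    (hu : ∀ᶠ y in 𝓝 x, FnSmoothAt I u y) (h : IsLocalMax u x) :
    dir X u x = 0 ∧ dir X (dir X u) x ≤ 0 := by
  have : IsManifold I 1 M := IsManifold.of_le (n := ∞) (by simp)
  -- Along an integral curve of X the functions X u and X X u are the first and second derivatives
  -- of u, so the one-variable tests apply.
  obtain ⟨γ, hγ0, hγ⟩ := exists_isMIntegralCurveAt_of_contMDiffAt_boundaryless (I := I) (v := X)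
    (0 : ℝ) (hX.of_le (by simp))
  have hγt : HasMFDerivAt 𝓘(ℝ, ℝ) I γ 0
      (ContinuousLinearMap.smulRight (1 : ℝ →L[ℝ] ℝ) (X (γ 0))) := hγ.self_of_nhds
  have hcont : ContinuousAt γ 0 := hγt.continuousAt
  have hd : ∀ᶠ t in 𝓝 (0 : ℝ), HasDerivAt (fun s => u (γ s)) (dir X u (γ t)) t := by
    rw [← hγ0] at hu
    filter_upwards [hγ, hcont.eventually hu] with t h1 h2
    exact hasDerivAt_comp_curve h1 h2.diffAt
  have hux := hu.self_of_nhds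
  have hd2 : HasDerivAt (fun s => dir X u (γ s)) (dir X (dir X u) x) 0 := by
    have := hasDerivAt_comp_curve (u := dir X u) hγt (by rw [hγ0]; exact (hX.dir hux).diffAt)
    rwa [hγ0] at this
  have hmax : IsLocalMax (fun s => u (γ s)) 0 := by
    have : ∀ᶠ y in 𝓝 (γ 0), u y ≤ u (γ 0) := by rw [hγ0]; exact h
    exact hcont.eventually this
  have h0 : dir X u x = 0 := by
    rw [← hγ0]; exact hmax.hasDerivAt_eq_zero hd.self_of_nhds
  refine ⟨h0, ?_⟩
  -- A positive second derivative would make 0 also a local minimum; then u is constant along the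
  -- curve and the second derivative is zero.
  by_contra! hpos
  have hde : deriv (fun s => u (γ s)) =ᶠ[𝓝 0] fun s => dir X u (γ s) := by
    filter_upwards [hd] with t ht using ht.deriv
  have hmin : IsLocalMin (fun s => u (γ s)) 0 := by
    refine isLocalMin_of_deriv_deriv_pos ?_ ?_ hd.self_of_nhds.continuousAt
    · rwa [hde.deriv_eq, hd2.deriv]
    · rw [hd.self_of_nhds.deriv, hγ0, h0]
  have hconst : (fun s => u (γ s)) =ᶠ[𝓝 0] fun _ => u (γ 0) := by
    filter_upwards [hmax, hmin] with t h1 h2 using le_antisymm h1 h2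
  have hz : (fun s => dir X u (γ s)) =ᶠ[𝓝 0] fun _ => 0 := by
    filter_upwards [hde, hconst.deriv] with t h1 h2
    rw [← h1, h2, deriv_const]
  have := hz.deriv_eq
  rw [hd2.deriv, deriv_const] at this
  exact hpos.ne' this

/-- Subsolutions of the equation `∑ eᵢ eᵢ u = B u` do not touch their maximum from inside a
sublevel set `{r ≤ r p}` along which `r` is non-characteristic. -/
theorem false_of_touching [T2Space M] {U : Set M} (hU : IsOpen U) {p : M} (hp : p ∈ U)
    {ι : Type*} [Fintype ι]
    {e : ι → VF I M} {B : VF I M} {u r : M → ℝ} (he : ∀ i, ∀ y ∈ U, SmoothAt (e i) y)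
    (hB : ∀ y ∈ U, SmoothAt B y) (hu : ∀ y ∈ U, FnSmoothAt I u y)
    (hr : ∀ y ∈ U, FnSmoothAt I r y) (hr0 : ∀ y, 0 ≤ r y)
    (hL : ∀ y ∈ U, ∑ i, dir (e i) (dir (e i) u) y = dir B u y)
    (hnc : ∃ i, dir (e i) r p ≠ 0) (hle : ∀ y ∈ U, u y ≤ u p)
    (hlt : ∀ y ∈ U, r y ≤ r p → y ≠ p → u y < u p) : False := by
  have : LocallyCompactSpace M := Manifold.locallyCompact_of_finiteDimensional I
  let Q : M → ℝ := fun y => ∑ i, dir (e i) r y ^ 2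
  let R : M → ℝ := fun y => ∑ i, dir (e i) (dir (e i) r) y - dir B r y
  have sr : ∀ i, ∀ y ∈ U, FnSmoothAt I (dir (e i) r) y := fun i y hy => (he i y hy).dir (hr y hy)
  have cQ : ContinuousAt Q p :=
    tendsto_finsetSum _ fun i _ => (sr i p hp).continuousAt.pow 2
  have cR : ContinuousAt R p :=
    (tendsto_finsetSum _ fun i _ => ((he i p hp).dir (sr i p hp)).continuousAt).sub
      ((hB p hp).dir (hr p hp)).continuousAt
  have Qp : 0 < Q p := by
    obtain ⟨i, hi⟩ := hnc
    exact Finset.sum_pos' (fun i _ => sq_nonneg _) ⟨i, Finset.mem_univ _, by positivity⟩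
  -- Applying the operator ∑ e_i e_i - B to exp(-a r) gives a exp(-a r) (a Q - R). Since r is
  -- non-characteristic, Q p > 0, and a large a makes this positive near p.
  obtain ⟨a, ha0, ha⟩ : ∃ a : ℝ, 0 < a ∧ R p < a * Q p := by
    refine ⟨|R p| / Q p + 1, by positivity, ?_⟩
    rw [add_mul, div_mul_cancel₀ _ Qp.ne', one_mul]
    have := le_abs_self (R p)
    linarith
  have hpos : ∀ᶠ y in 𝓝 p, R y < a * Q y := cR.eventually_lt (cQ.const_mul a) ha
  obtain ⟨K, hKp, hK, hKc⟩ := local_compact_nhds (Filter.inter_mem (hU.mem_nhds hp) hpos)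
  have hKU : ∀ y ∈ K, y ∈ U := fun y hy => (hK hy).1
  have hKpK : p ∈ K := mem_of_mem_nhds hKp
  -- The Hopf barrier: zero at p, negative outside the sublevel set of r, and at most 1 because r is
  -- nonnegative.
  let h : M → ℝ := fun y => Real.exp (-a * r y) - Real.exp (-a * r p)
  have hd : ∀ (c : ℝ) (t : ℝ), HasDerivAt (fun s => Real.exp (-a * s) - c)
      (-a * Real.exp (-a * t)) t := fun c t => by
    have := (((hasDerivAt_id t).const_mul (-a)).exp).sub_const c
    simpa [mul_comm] using this
  have sE : ∀ y ∈ U, FnSmoothAt I (fun y => Real.exp (-a * r y)) y := fun y hy =>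
    FnSmoothAt.comp_real (φ := fun s => Real.exp (-a * s))
      (by fun_prop : ContDiff ℝ ∞ fun s : ℝ => Real.exp (-a * s)).contDiffAt (hr y hy)
  have sh : ∀ y ∈ U, FnSmoothAt I h y := fun y hy => FnSmoothAt.sub (sE y hy) (FnSmoothAt.const _)
  have dh : ∀ (X : VF I M), ∀ y ∈ U, dir X h y = -a * (Real.exp (-a * r y) * dir X r y) :=
    fun X y hy => by
      rw [← mul_assoc]
      exact dir_comp_real (φ := fun s => Real.exp (-a * s) - Real.exp (-a * r p)) (hd _ _)
        (hr y hy).diffAt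
  have dE : ∀ (X : VF I M), ∀ y ∈ U,
      dir X (fun y => Real.exp (-a * r y)) y = -a * (Real.exp (-a * r y) * dir X r y) :=
    fun X y hy => by
      rw [← mul_assoc]
      have := dir_comp_real (X := X) (φ := fun s => Real.exp (-a * s) - 0) (hd 0 (r y))
        (hr y hy).diffAt
      simpa using this
  have ddh : ∀ i, ∀ y ∈ U, dir (e i) (dir (e i) h) y =
      Real.exp (-a * r y) * (a ^ 2 * dir (e i) r y ^ 2 - a * dir (e i) (dir (e i) r) y) :=
    fun i y hy => by
      rw [dir_congr_on hU hy fun z hz => dh (e i) z hz,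
        dir_const_mul _ (FnSmoothAt.mul (sE y hy) (sr i y hy)).diffAt,
        dir_mul (sE y hy).diffAt (sr i y hy).diffAt, dE _ y hy]
      ring
  have Lh : ∀ y ∈ K, 0 < ∑ i, dir (e i) (dir (e i) h) y - dir B h y := fun y hy => by
    have e1 : ∑ i, dir (e i) (dir (e i) h) y - dir B h y =
        Real.exp (-a * r y) * (a * (a * Q y - R y)) := by
      simp only [ddh _ y (hKU y hy), dh _ y (hKU y hy), Q, R, ← Finset.mul_sum,
        Finset.sum_sub_distrib]
      ring
    rw [e1]
    have : 0 < a * Q y - R y := sub_pos.2 (hK hy).2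
    positivity
  have h1 : ∀ y, h y ≤ 1 := fun y => by
    have e1 : Real.exp (-a * r y) ≤ 1 := Real.exp_le_one_iff.2 (by nlinarith [hr0 y])
    have e2 := Real.exp_pos (-a * r p)
    simp only [h]; linarith
  have hneg : ∀ y, r p < r y → h y < 0 := fun y hy => by
    have : Real.exp (-a * r y) < Real.exp (-a * r p) := Real.exp_lt_exp.2 (by nlinarith)
    simp only [h]; linarith
  have cu : ContinuousOn u K := fun y hy => (hu y (hKU y hy)).continuousAt.continuousWithinAt
  have ch : ContinuousOn h K := fun y hy => (sh y (hKU y hy)).continuousAt.continuousWithinAt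
  have cr : ContinuousOn r K := fun y hy => (hr y (hKU y hy)).continuousAt.continuousWithinAt
  -- The part of the rim of K inside the sublevel set. It is compact and avoids p, so u stays below
  -- u p there by a fixed margin, which ε times the barrier cannot make up.
  let S : Set M := (K ∩ r ⁻¹' Set.Iic (r p)) \ interior K
  have hS : IsCompact S :=
    ((hKc.of_isClosed_subset (cr.preimage_isClosed_of_isClosed hKc.isClosed isClosed_Iic)
      Set.inter_subset_left)).diff isOpen_interior
  obtain ⟨ε, hε0, hε⟩ : ∃ ε : ℝ, 0 < ε ∧ ∀ y ∈ S, u y + ε < u p := by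
    rcases S.eq_empty_or_nonempty with hSe | hSn
    · exact ⟨1, one_pos, by simp [hSe]⟩
    · obtain ⟨q, hq, hqm⟩ := hS.exists_isMaxOn hSn
        (cu.mono fun y hy => hy.1.1)
      have hqp : q ≠ p := fun h0 => hq.2 (h0 ▸ mem_interior_iff_mem_nhds.2 hKp)
      have := hlt q (hKU q hq.1.1) hq.1.2 hqp
      refine ⟨(u p - u q) / 2, by linarith, fun y hy => ?_⟩
      have : u y ≤ u q := hqm hy
      linarith
  let w : M → ℝ := fun y => u y + ε * h y
  obtain ⟨q, hq, hqm⟩ := hKc.exists_isMaxOn ⟨p, hKpK⟩ (cu.add (continuousOn_const.mul ch) :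
    ContinuousOn w K)
  have hwp : u p ≤ w q := by
    have : w p ≤ w q := hqm hKpK
    simpa [w, h] using this
  -- On the rim w is less than u p: inside the sublevel set by the margin, outside because the
  -- barrier is negative. So the maximum is interior.
  have hqi : q ∈ interior K := by
    by_contra hqi
    rcases le_or_gt (r q) (r p) with hrq | hrq
    · have := hε q ⟨⟨hq, hrq⟩, hqi⟩
      have := mul_le_mul_of_nonneg_left (h1 q) hε0.le
      simp only [w] at hwp; linarith
    · have := mul_neg_of_pos_of_neg hε0 (hneg q hrq)
      have := hle q (hKU q hq)
      simp only [w] at hwp; linarith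
  have hqU := hKU q hq
  have hmax : IsLocalMax w q := by
    filter_upwards [mem_interior_iff_mem_nhds.1 hqi] with y hy using hqm hy
  have sw : ∀ y ∈ U, FnSmoothAt I w y := fun y hy =>
    FnSmoothAt.add (hu y hy) (FnSmoothAt.const_mul _ (sh y hy))
  have sw' : ∀ᶠ y in 𝓝 q, FnSmoothAt I w y := Filter.eventually_of_mem (hU.mem_nhds hqU) sw
  have dw : ∀ (X : VF I M), ∀ y ∈ U, dir X w y = dir X u y + ε * dir X h y := fun X y hy => by
    rw [dir_add (hu y hy).diffAt (FnSmoothAt.const_mul _ (sh y hy)).diffAt,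
      dir_const_mul _ (sh y hy).diffAt]
  have ddw : ∀ i, dir (e i) (dir (e i) w) q =
      dir (e i) (dir (e i) u) q + ε * dir (e i) (dir (e i) h) q := fun i => by
    have s1 := (he i q hqU).dir (hu q hqU)
    have s2 := (he i q hqU).dir (sh q hqU)
    rw [dir_congr_on hU hqU fun z hz => dw (e i) z hz,
      dir_add s1.diffAt (FnSmoothAt.const_mul _ s2).diffAt, dir_const_mul _ s2.diffAt]
  -- At the interior maximum the operator applied to w is nonpositive, yet it equals ε times its
  -- positive value on the barrier.
  have t1 : ∑ i, dir (e i) (dir (e i) w) q ≤ 0 := Finset.sum_nonpos fun i _ =>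
    (dir_eq_zero_and_dir_dir_nonpos (he i q hqU) sw' hmax).2
  have t2 : dir B w q = 0 := (dir_eq_zero_and_dir_dir_nonpos (hB q hqU) sw' hmax).1
  simp only [ddw, Finset.sum_add_distrib, ← Finset.mul_sum] at t1
  rw [dw _ q hqU, ← hL q hqU] at t2
  have := mul_pos hε0 (Lh q hq)
  linarith

end VFCalc

/-! ### The strong maximum principle. -/

namespace VFCalc

open VectorField Bundle Topology Filter

variable {E : Type*} [NormedAddCommGroup E] [NormedSpace ℝ E] [FiniteDimensional ℝ E]
  {H : Type*} [TopologicalSpace H] {I : ModelWithCorners ℝ E H}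
  {M : Type*} [TopologicalSpace M] [ChartedSpace H M] [IsManifold I ∞ M]

/-- A point of `{v = m}` which can be touched from outside by a ball. -/
theorem exists_touching_ball {F : Type*} [NormedAddCommGroup F] [InnerProductSpace ℝ F]
    [ProperSpace F] {v : F → ℝ} {z₀ z₁ : F} {R : ℝ} (hv : ContinuousOn v (Metric.ball z₀ R))
    (hle : ∀ z ∈ Metric.ball z₀ R, v z ≤ v z₀) (h₁ : dist z₁ z₀ < R / 2) (hlt : v z₁ ≠ v z₀) :
    ∃ c p : F, p ∈ Metric.ball z₀ R ∧ p ≠ c ∧ v p = v z₀ ∧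
      ∀ z ∈ Metric.ball z₀ R, dist z c ≤ dist p c → z ≠ p → v z < v z₀ := by
  have hd0 : 0 ≤ dist z₁ z₀ := dist_nonneg
  have hsub : ∀ z ∈ Metric.closedBall z₁ (dist z₁ z₀), z ∈ Metric.ball z₀ R := fun z hz => by
    have := dist_triangle z z₁ z₀
    rw [Metric.mem_closedBall] at hz
    rw [Metric.mem_ball]; linarith
  let S := Metric.closedBall z₁ (dist z₁ z₀) ∩ v ⁻¹' {v z₀}
  have hS : IsCompact S := by
    refine (isCompact_closedBall z₁ (dist z₁ z₀)).of_isClosed_subset ?_ Set.inter_subset_left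
    exact (hv.mono hsub).preimage_isClosed_of_isClosed Metric.isClosed_closedBall isClosed_singleton
  have hz₀ : z₀ ∈ S := ⟨by rw [Metric.mem_closedBall, dist_comm], rfl⟩
  -- p is a point of {v = v z₀} nearest to z₁. The bound R/2 keeps the balls in question inside the
  -- domain.
  obtain ⟨p, hp, hmin⟩ := hS.exists_isMinOn ⟨z₀, hz₀⟩
    (continuous_id.dist continuous_const : Continuous fun z => dist z z₁).continuousOn
  have hpz : p ≠ z₁ := fun h => hlt (h ▸ hp.2)
  -- The ball around z₁ through p may meet {v = v z₀} at further boundary points. The ball of half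
  -- the radius around the midpoint z₁ + a touches its sphere at p only.
  let a : F := (1 / 2 : ℝ) • (p - z₁)
  have ha : ‖p - z₁‖ = 2 * ‖a‖ := by simp [a, norm_smul]
  have ea : p - z₁ = a + a := by simp only [a, ← add_smul]; norm_num
  have hpa : p - (z₁ + a) = a := by rw [← sub_sub, ea, add_sub_cancel_right]
  have ha0 : a ≠ 0 := by simpa [a, sub_eq_zero] using hpz
  refine ⟨z₁ + a, p, hsub p hp.1, ?_, hp.2, fun z hz hzc hzp => ?_⟩
  · intro h
    apply ha0
    rw [← hpa, ← h, sub_self]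
  · refine lt_of_le_of_ne (hle z hz) fun hvz => hzp ?_
    rw [dist_eq_norm, dist_eq_norm, hpa] at hzc
    set b := z - (z₁ + a) with hb
    have hzb : z - z₁ = b + a := by rw [hb]; abel
    have hle1 : dist z z₁ ≤ dist p z₁ := by
      rw [dist_eq_norm, dist_eq_norm, hzb, ha]
      linarith [norm_add_le b a]
    have hzS : z ∈ S := ⟨by
      rw [Metric.mem_closedBall]
      exact hle1.trans (Metric.mem_closedBall.1 hp.1), hvz⟩
    have hge : dist p z₁ ≤ dist z z₁ := hmin hzS
    rw [dist_eq_norm, dist_eq_norm, hzb, ha] at hge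
    -- From ‖b‖ ≤ ‖a‖ and ‖b + a‖ ≥ 2‖a‖ the parallelogram law gives b = a.
    have hpar := parallelogram_law_with_norm ℝ b a
    have : ‖b - a‖ ^ 2 ≤ 0 := by nlinarith [norm_nonneg a, norm_nonneg b]
    have hba : b = a := by
      rw [← sub_eq_zero, ← norm_eq_zero]
      exact pow_eq_zero_iff (two_ne_zero) |>.1 (le_antisymm this (sq_nonneg _))
    have : z - z₁ = p - z₁ := by rw [hzb, hba, ea]
    exact sub_left_injective this

section

variable [I.Boundaryless] [T2Space M]

/-- The strong maximum principle for sums of squares of vector fields that span the tangent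
spaces. -/
theorem eventually_eq_of_eventually_le {U : Set M} (hU : IsOpen U) {x : M} (hx : x ∈ U)
    {ι : Type*} [Fintype ι] {e : ι → VF I M} {B : VF I M} {u : M → ℝ}
    (he : ∀ i, ∀ y ∈ U, SmoothAt (e i) y) (hB : ∀ y ∈ U, SmoothAt B y)
    (hspan : ∀ y ∈ U, ∀ v : TangentSpace I y, ∃ c : ι → ℝ, v = ∑ i, c i • e i y)
    (hu : ∀ y ∈ U, FnSmoothAt I u y)
    (hL : ∀ y ∈ U, ∑ i, dir (e i) (dir (e i) u) y = dir B u y)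
    (hle : ∀ᶠ y in 𝓝 x, u y ≤ u x) : ∀ᶠ y in 𝓝 x, u y = u x := by
  have : IsManifold I 1 M := IsManifold.of_le (n := ∞) (by simp)
  -- The touching ball requires an inner product, while E only carries a norm; hence the chart is
  -- followed by a linear isomorphism with Euclidean space.
  let T := toEuclidean (E := E)
  let φ := extChartAt I x
  let F : M → EuclideanSpace ℝ (Fin (Module.finrank ℝ E)) := fun y => T (φ y)
  let G : EuclideanSpace ℝ (Fin (Module.finrank ℝ E)) → M := fun z => φ.symm (T.symm z)
  have hGF : ∀ y ∈ φ.source, G (F y) = y := fun y hy => by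
    simp only [G, F, ContinuousLinearEquiv.symm_apply_apply]
    exact φ.left_inv hy
  have hFG : ∀ z, T.symm z ∈ φ.target → F (G z) = z := fun z hz => by
    simp only [F, G]
    rw [φ.right_inv hz, ContinuousLinearEquiv.apply_symm_apply]
  obtain ⟨V, hVU, hV, hxV⟩ := eventually_nhds_iff.1
    (hle.and (Filter.Eventually.and (hU.mem_nhds hx) (extChartAt_source_mem_nhds (I := I) x)) :
      ∀ᶠ y in 𝓝 x, u y ≤ u x ∧ y ∈ U ∧ y ∈ φ.source)
  have hφt : IsOpen φ.target := isOpen_extChartAt_target x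
  have hGc : ContinuousOn G (T.symm ⁻¹' φ.target) :=
    (continuousOn_extChartAt_symm x).comp T.symm.continuous.continuousOn fun z hz => hz
  have hO : IsOpen (T.symm ⁻¹' φ.target ∩ G ⁻¹' V) :=
    hGc.isOpen_inter_preimage (hφt.preimage T.symm.continuous) hV
  have hxs : x ∈ φ.source := mem_extChartAt_source x
  have hFx : F x ∈ T.symm ⁻¹' φ.target ∩ G ⁻¹' V :=
    ⟨by simpa [F] using φ.map_source hxs, by rw [Set.mem_preimage, hGF x hxs]; exact hxV⟩
  obtain ⟨R, hR, hball⟩ := Metric.isOpen_iff.1 hO (F x) hFx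
  have hFc : ∀ y ∈ φ.source, ContinuousAt F y := fun y hy =>
    T.continuous.continuousAt.comp (continuousAt_extChartAt' hy)
  have hnear : ∀ᶠ y in 𝓝 x, dist (F y) (F x) < R / 2 ∧ y ∈ φ.source :=
    ((hFc x hxs).eventually (Metric.ball_mem_nhds _ (half_pos hR))).and
      (extChartAt_source_mem_nhds x)
  filter_upwards [hnear] with y hy
  by_contra hne
  have huc : ContinuousOn (fun z => u (G z)) (Metric.ball (F x) R) := fun z hz =>
    ((hu _ (hVU _ (hball hz).2).2.1).continuousAt.comp
      (hGc.continuousAt ((hφt.preimage T.symm.continuous).mem_nhds (hball hz).1))).continuousWithinAt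
  obtain ⟨c, p, hpB, hpc, hup, hlt⟩ := exists_touching_ball (v := fun z => u (G z)) huc
    (fun z hz => by rw [hGF x hxs]; exact (hVU _ (hball hz).2).1) hy.1
    (by rw [hGF x hxs, hGF y hy.2]; exact hne)
  rw [hGF x hxs] at hup
  have hFp : F (G p) = p := hFG p (hball hpB).1
  let V' : Set M := (U ∩ V) ∩ {y | y ∈ φ.source ∧ F y ∈ Metric.ball (F x) R}
  have hV' : IsOpen V' := by
    refine (hU.inter hV).inter ?_
    have : ContinuousOn F φ.source := fun y hy => (hFc y hy).continuousWithinAt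
    exact this.isOpen_inter_preimage (isOpen_extChartAt_source x) Metric.isOpen_ball
  have hpV' : G p ∈ V' := by
    have h1 := hVU _ (hball hpB).2
    exact ⟨⟨h1.2.1, (hball hpB).2⟩, h1.2.2, by rw [hFp]; exact hpB⟩
  let r : M → ℝ := fun y => ‖F y - c‖ ^ 2
  have hFs : ∀ y ∈ φ.source, ContMDiffAt I 𝓘(ℝ, E) ∞ φ y := fun y hy =>
    contMDiffAt_extChartAt' (by rwa [extChartAt_source] at hy)
  let ρ : E → ℝ := fun z => ‖T z - c‖ ^ 2
  have hρ : ContDiff ℝ ∞ ρ := (T.contDiff.sub contDiff_const).norm_sq ℝ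
  have hder : ∀ z, fderiv ℝ ρ z (T.symm (T z - c)) = 2 * ‖T z - c‖ ^ 2 := fun z => by
    have h1 : HasFDerivAt ρ _ z :=
      ((T : E →L[ℝ] EuclideanSpace ℝ (Fin (Module.finrank ℝ E))).hasFDerivAt.sub_const c).norm_sq
    rw [h1.fderiv]
    simp only [ContinuousLinearEquiv.coe_coe, smul_apply, ContinuousLinearMap.comp_apply,
      ContinuousLinearEquiv.apply_symm_apply, innerSL_apply_apply, real_inner_self_eq_norm_sq,
      nsmul_eq_mul]
    norm_num
  have hr : ∀ y ∈ φ.source, FnSmoothAt I r y := fun y hy =>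
    hρ.contDiffAt.contMDiffAt.comp (f := φ) y (hFs y hy)
  refine false_of_touching (I := I) (r := r) hV' hpV' (fun i y hy => he i y hy.1.1)
    (fun y hy => hB y hy.1.1) (fun y hy => hu y hy.1.1) (fun y hy => hr y hy.2.1)
    (fun y => sq_nonneg _) (fun y hy => hL y hy.1.1) ?_
    (fun y hy => by rw [hup]; exact (hVU y hy.1.2).1) (fun y hy hry hyp => ?_)
  -- If all e_i r vanished at the touching point, dr would vanish there because the e_i span. On the
  -- radial vector dr equals 2‖p - c‖², which is not zero.
  · by_contra! hc
    have hz : ∀ v : TangentSpace I (G p), mvfderiv I r (G p) v = 0 := fun v => by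
      obtain ⟨k, hk⟩ := hspan (G p) hpV'.1.1 v
      rw [hk, map_sum]
      refine Finset.sum_eq_zero fun i _ => ?_
      rw [map_smul, ← dir_apply, hc i, smul_zero]
    have hs : G p ∈ φ.source := hpV'.2.1
    obtain ⟨w, hw⟩ := (isInvertible_mfderiv_extChartAt (I := I) hs).bijective.2
      (T.symm (p - c))
    have hcomp := mfderiv_comp_apply (I := I) (I' := 𝓘(ℝ, E)) (I'' := 𝓘(ℝ, ℝ)) (g := ρ) (f := φ)
      (G p) ((hρ.differentiable (by simp)).mdifferentiable _)
      ((hFs _ hs).mdifferentiableAt (by simp)) w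
    have h0 : mfderiv I 𝓘(ℝ, ℝ) (ρ ∘ φ) (G p) w = 0 := hz w
    rw [h0, hw, mfderiv_eq_fderiv] at hcomp
    have hFp' : T (φ (G p)) = p := hFp
    have h2 := hder (φ (G p))
    rw [hFp'] at h2
    exact hpc (sub_eq_zero.1 (norm_eq_zero.1 (by
      have h3 : 2 * ‖p - c‖ ^ 2 = 0 := h2.symm.trans hcomp.symm
      nlinarith [norm_nonneg (p - c)])))
  · have := hlt (F y) hy.2.2 (by
      have h1 : ‖F y - c‖ ^ 2 ≤ ‖F (G p) - c‖ ^ 2 := hry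
      rw [hFp] at h1
      rw [dist_eq_norm, dist_eq_norm]
      exact (pow_le_pow_iff_left₀ (norm_nonneg _) (norm_nonneg _) two_ne_zero).1 h1)
      (fun h => hyp (by rw [← h, hGF y hy.2.1]))
    rw [hGF y hy.2.1, hGF x hxs] at this
    rw [hup]
    exact this

end

end VFCalc

/-! ### Local constancy of the fibre length; the soliton equations in components. -/

namespace VFCalc

open VectorField Bundle Topology Filter

variable {E : Type*} [NormedAddCommGroup E] [NormedSpace ℝ E] [FiniteDimensional ℝ E]
  {H : Type*} [TopologicalSpace H] {I : ModelWithCorners ℝ E H}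
  {M : Type*} [TopologicalSpace M] [ChartedSpace H M] [IsManifold I ∞ M]
  {g : Metric I M} {J : (x : M) → TangentSpace I x → TangentSpace I x}

namespace IsTorusAction

variable {Z : VF I M} (hZ : IsTorusAction J g Z) (hJ : IsAlmostComplex J)
include hZ hJ

/-- The fibre length function of a pluriclosed metric satisfies the strong maximum principle. -/
theorem eventually_length_eq [I.Boundaryless] [T2Space M] (hg : IsPluriclosed J g)
    (hd : Module.finrank ℝ E = 4) {x : M}
    (hle : ∀ᶠ y in 𝓝 x, g.tensor Z Z y ≤ g.tensor Z Z x) :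
    ∀ᶠ y in 𝓝 x, g.tensor Z Z y = g.tensor Z Z x := by
  obtain ⟨U, e, θ, σ, hx, h, -, -⟩ := hZ.exists_fibreFrame hJ hg.1 hd x
  refine eventually_eq_of_eventually_le (e := e)
    (B := fun y => σ 2 y • e 3 y - σ 3 y • e 2 y) h.isOpen hx h.smooth (fun y hy => ?_)
    (fun y hy v => ?_) (fun y hy => h.smooth_psi hy) (fun y hy => ?_) hle
  · exact SmoothAt.sub (SmoothAt.smul (h.smooth_sigma 2 y hy) (h.smooth 3 y hy))
      (SmoothAt.smul (h.smooth_sigma 3 y hy) (h.smooth 2 y hy))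
  · exact ⟨_, eq_sum_orthogonal h.finrank (fun i => (h.sqLen_pos hy i).ne') (h.inner y hy) v⟩
  -- The equation for ψ only contains horizontal derivatives. Adding the vanishing vertical second
  -- derivatives gives a sum over fields that span the tangent space.
  · have h0 : dir (e 0) (dir (e 0) (g.tensor Z Z)) y = 0 := by
      rw [dir_congr_on h.isOpen hy h.dir_zero, dir_const]
    have h1 : dir (e 1) (dir (e 1) (g.tensor Z Z)) y = 0 := by
      rw [dir_congr_on h.isOpen hy h.dir_one, dir_const]
    rw [Fin.sum_univ_four, h0, h1, zero_add, zero_add, h.harmonic hJ hg hy]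
    simp [dir_apply]

end IsTorusAction

namespace IsFibreFrame

variable {U : Set M} {e : Fin 4 → VF I M} {ψ : M → ℝ} {θ σ : Fin 4 → M → ℝ}
  (h : IsFibreFrame J g U e ψ θ σ) (h1 : ∀ y ∈ U, ψ y = 1) (hJ : IsAlmostComplex J) {f : M → ℝ}
  (hs : IsSteadySoliton J g f)
include h h1 hJ hs

theorem soliton_eq {x : M} (hx : x ∈ U) (j k : Fin 4) :
    ∑ i, (dir (e i) (σ j) x - dir (e j) (σ i) x
        - ∑ l, structFn (fun l => θ l x) (fun l => σ l x) i j l * σ l x) * areaForm k i =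
      dir (e j) (dir (e k) f) x - ∑ l, σ j x * areaForm k l * dir (e l) f x := by
  have ht := h.isTorusFrame h1
  have ho := ht.toIsOrthonormalFrame.isOrthonormalAt hx
  exact ht.soliton_eq (h.isWedgeForm hJ hs.pluriclosed.1 h1) hx hs.smooth j k
    (hs.ricci_eq x 4 e ho _ _ (h.smooth j x hx) (h.smooth k x hx))
    (hs.torsion_eq x 4 e ho _ _ (h.smooth j x hx) (h.smooth k x hx))

/-- Second derivatives of the potential of a steady soliton, and first derivatives of the
curvature component `θ 0`. -/
theorem soliton_table {x : M} (hx : x ∈ U) :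
    (∀ j, dir (e j) (dir (e 0) f) x = 0) ∧ (∀ j, dir (e j) (dir (e 1) f) x = 0) ∧
    dir (e 0) (dir (e 2) f) x = (σ 0 x - θ 0 x) * dir (e 3) f x ∧
    dir (e 0) (dir (e 3) f) x = -((σ 0 x - θ 0 x) * dir (e 2) f x) ∧
    dir (e 1) (dir (e 2) f) x = (σ 1 x - θ 1 x) * dir (e 3) f x ∧
    dir (e 1) (dir (e 3) f) x = -((σ 1 x - θ 1 x) * dir (e 2) f x) ∧
    dir (e 2) (dir (e 3) f) x = -(σ 2 x * dir (e 2) f x) ∧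
    dir (e 3) (dir (e 2) f) x = σ 3 x * dir (e 3) f x ∧
    dir (e 2) (dir (e 2) f) x - σ 2 x * dir (e 3) f x =
      dir (e 3) (dir (e 3) f) x + σ 3 x * dir (e 2) f x ∧
    dir (e 2) (θ 0) x = -(θ 0 x * dir (e 2) f x) ∧
    dir (e 3) (θ 0) x = -(θ 0 x * dir (e 3) f x) := by
  have E := h.soliton_eq h1 hJ hs hx
  have c : ∀ i j, dir (e i) (dir (e j) f) x - dir (e j) (dir (e i) f) x =
      ∑ k, structFn (fun l => θ l x) (fun l => σ l x) i j k * dir (e k) f x := fun i j => by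
    rw [← dir_brk (h.smooth i x hx) (h.smooth j x hx) (hs.smooth x),
      dir_eq_sum (h.brk_eq x hx i j)]
  -- For a vertical second index the area form vanishes on both sides, so the equation reduces to
  -- this second derivative.
  have z0 : ∀ j, dir (e j) (dir (e 0) f) x = 0 := fun j => by
    have := E j 0
    simp only [Fin.sum_univ_four, areaForm_table, mul_zero, zero_mul, add_zero, sub_zero] at this
    exact this.symm
  have z1 : ∀ j, dir (e j) (dir (e 1) f) x = 0 := fun j => by
    have := E j 1
    simp only [Fin.sum_univ_four, areaForm_table, mul_zero, zero_mul, add_zero, sub_zero] at this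
    exact this.symm
  -- The commutators give the mixed derivatives of f. By the Jacobi identity dσ(e3, e0) = e3 θ0, and
  -- the soliton equation makes it -θ0 e3 f; similarly for e2. On horizontal indices the Ricci side
  -- is a multiple of the metric, so the trace-free part of the Hessian vanishes.
  obtain ⟨-, ⟨j1, j2⟩, -, -⟩ := h.jacobi_table hx
  have c02 := c 0 2
  have c03 := c 0 3
  have c12 := c 1 2
  have c13 := c 1 3
  have E02 := E 0 2
  have E03 := E 0 3
  have E22 := E 2 2
  have E23 := E 2 3
  have E32 := E 3 2
  have E33 := E 3 3
  simp only [Fin.sum_univ_four, structFn, wedgeArea, areaForm_table, mul_zero, zero_mul,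
    add_zero, zero_add, sub_zero, mul_one, neg_zero, mul_neg, z0, z1]
    at c02 c03 c12 c13 E02 E03 E22 E23 E32 E33
  refine ⟨z0, z1, ?_, ?_, ?_, ?_, ?_, ?_, ?_, ?_, ?_⟩ <;> linarith

theorem app_grad_eq {x : M} (hx : x ∈ U) :
    app J (grad g f) x = (-dir (e 1) f x) • e 0 x + dir (e 0) f x • e 1 x +
      (-dir (e 3) f x) • e 2 x + dir (e 2) f x • e 3 x := by
  have hj := h.J_eq x hx
  have hgr := (h.isTorusFrame h1).eq_sum hx (grad g f x)
  simp only [grad_spec, ← dir_apply, Fin.sum_univ_four] at hgr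
  rw [app, hgr]
  simp only [hJ.map_add, hJ.map_smul, hj]
  simp only [pairSign, pairIdx, Matrix.cons_val, smul_neg, neg_smul, one_smul]
  abel

theorem inner_brk_app_grad {x : M} (hx : x ∈ U) (k m : Fin 4) :
    g.inner x (brk (app J (grad g f)) (e k) x) (e m x) =
      -dir (e 1) f x * structFn (fun l => θ l x) (fun l => σ l x) 0 k m +
      dir (e 0) f x * structFn (fun l => θ l x) (fun l => σ l x) 1 k m -
      dir (e 3) f x * structFn (fun l => θ l x) (fun l => σ l x) 2 k m +
      dir (e 2) f x * structFn (fun l => θ l x) (fun l => σ l x) 3 k m -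
      (![-dir (e k) (dir (e 1) f) x, dir (e k) (dir (e 0) f) x, -dir (e k) (dir (e 3) f) x,
        dir (e k) (dir (e 2) f) x] : Fin 4 → ℝ) m := by
  have ht := h.isTorusFrame h1
  let v : Fin 4 → M → ℝ := ![fun y => -dir (e 1) f y, dir (e 0) f, fun y => -dir (e 3) f y,
    dir (e 2) f]
  have sf : ∀ i, FnSmoothAt I (dir (e i) f) x := fun i => (h.smooth i x hx).dir (hs.smooth x)
  have sv : ∀ i, FnSmoothAt I (v i) x := fun i => by
    fin_cases i
    exacts [FnSmoothAt.neg (sf 1), sf 0, FnSmoothAt.neg (sf 3), sf 2]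
  have e1 : brk (app J (grad g f)) (e k) x = -brk (e k) (fun y => ∑ i, v i y • e i y) x := by
    rw [brk_swap]
    congr 1
    refine brk_congr .rfl (Filter.eventuallyEq_of_mem (h.isOpen.mem_nhds hx) fun y hy => ?_)
    rw [h.app_grad_eq h1 hJ hs hy, Fin.sum_univ_four]
    rfl
  have e2 : ∀ i, brk (e k) (fun y => v i y • e i y) x =
      dir (e k) (v i) x • e i x + v i x • brk (e k) (e i) x := fun i =>
    brk_smul_right (sv i).diffAt (h.smooth i x hx).diffAt
  rw [e1, brk_sum_right (fun i (_ : i ∈ Finset.univ) =>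
    DiffAt.smul (sv i).diffAt (h.smooth i x hx).diffAt)]
  simp only [e2, brk_swap (e k), Finset.sum_add_distrib, map_neg, map_add, neg_apply, add_apply,
    ht.inner_sum hx]
  simp only [Fin.sum_univ_four, map_add, map_smul, map_neg, add_apply, smul_apply, neg_apply,
    smul_eq_mul, ht.inner_brk hx]
  have dv : dir (e k) (v m) x = (![-dir (e k) (dir (e 1) f) x, dir (e k) (dir (e 0) f) x,
      -dir (e k) (dir (e 3) f) x, dir (e k) (dir (e 2) f) x] : Fin 4 → ℝ) m := by
    fin_cases m
    exacts [dir_neg, rfl, dir_neg, rfl]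
  rw [dv]
  simp only [v, Matrix.cons_val]
  ring

/-- The flow of `J ∇f` rotates the horizontal coframe. -/
theorem exists_rotation {x : M} (hx : x ∈ U) : ∃ κ : ℝ, ∀ X : VF I M, DiffAt X x →
    g.inner x (brk (app J (grad g f)) X x) (e 2 x) =
      dir (app J (grad g f)) (g.tensor X (e 2)) x - κ * g.tensor X (e 3) x ∧
    g.inner x (brk (app J (grad g f)) X x) (e 3 x) =
      dir (app J (grad g f)) (g.tensor X (e 3)) x + κ * g.tensor X (e 2) x := by
  have ht := h.isTorusFrame h1
  obtain ⟨z0, z1, t1, t2, t3, t4, t5, t6, t7, -, -⟩ := h.soliton_table h1 hJ hs hx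
  set V := app J (grad g f) with hV
  -- κ is the e3 component of [V, e2]. The e2 component of [V, e3] is its negative because the two
  -- diagonal entries of the horizontal Hessian agree (`t7`).
  refine ⟨-dir (e 1) f x * (σ 0 x - θ 0 x) + dir (e 0) f x * (σ 1 x - θ 1 x)
    + dir (e 2) f x * σ 3 x - dir (e 2) (dir (e 2) f) x, fun X hX => ?_⟩
  have hXe : X =ᶠ[𝓝 x] fun y => ∑ i, g.tensor X (e i) y • e i y :=
    Filter.eventuallyEq_of_mem (h.isOpen.mem_nhds hx) fun y hy => ht.eq_sum hy (X y)
  have dX : ∀ i, FnDiffAt I (g.tensor X (e i)) x := fun i =>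
    g.diffAt_tensor hX (h.smooth i x hx).diffAt
  have e2 : ∀ i, brk V (fun y => g.tensor X (e i) y • e i y) x =
      dir V (g.tensor X (e i)) x • e i x + g.tensor X (e i) x • brk V (e i) x := fun i =>
    brk_smul_right (dX i) (h.smooth i x hx).diffAt
  have e3 : ∀ m, g.inner x (brk V X x) (e m x) = dir V (g.tensor X (e m)) x +
      ∑ i, g.tensor X (e i) x * g.inner x (brk V (e i) x) (e m x) := fun m => by
    have hb : brk V X x = brk V (fun y => ∑ i, g.tensor X (e i) y • e i y) x :=
      brk_congr .rfl hXe
    rw [hb, brk_sum_right (fun i (_ : i ∈ Finset.univ) =>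
      DiffAt.smul (dX i) (h.smooth i x hx).diffAt)]
    simp only [e2, Finset.sum_add_distrib, map_add, add_apply, ht.inner_sum hx]
    congr 1
    simp only [map_sum, map_smul, sum_apply, smul_apply, smul_eq_mul]
  rw [e3, e3]
  simp only [hV, h.inner_brk_app_grad h1 hJ hs hx, Fin.sum_univ_four, structFn, wedgeArea,
    areaForm_table, mul_zero, zero_mul, add_zero, zero_add, sub_zero, mul_one, neg_zero, mul_neg,
    Matrix.cons_val, z0, z1, t1, t2, t3, t4, t5, t6]
  constructor
  · linear_combination -(g.tensor X (e 3) x) * t7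
  · ring

/-- Horizontally dθ0 = -θ0 df, and the horizontal part of J∇f is annihilated by df. Vertically θ0 is
constant by the Jacobi identity. -/
theorem dir_app_grad_theta {x : M} (hx : x ∈ U) : dir (app J (grad g f)) (θ 0) x = 0 := by
  obtain ⟨-, -, -, -, -, -, -, -, -, t1, t2⟩ := h.soliton_table h1 hJ hs hx
  obtain ⟨⟨j1, -, j2, -⟩, -⟩ := h.jacobi_table hx
  rw [dir, h.app_grad_eq h1 hJ hs hx]
  simp only [map_add, map_smul, ← dir_apply, j1, j2, t1, t2, smul_eq_mul]
  ring

end IsFibreFrame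

end VFCalc

/-! ### Tensors preserved by the flow of J∇f. -/

namespace VFCalc

open VectorField Bundle Topology Filter

variable {E : Type*} [NormedAddCommGroup E] [NormedSpace ℝ E] [FiniteDimensional ℝ E]
  {H : Type*} [TopologicalSpace H] {I : ModelWithCorners ℝ E H}
  {M : Type*} [TopologicalSpace M] [ChartedSpace H M] [IsManifold I ∞ M]
  {g : Metric I M} {J : (x : M) → TangentSpace I x → TangentSpace I x}

theorem tensorialAt_extd₁_inner {e Y : VF I M} {x : M} (he : DiffAt e x) :
    TensorialAt I E (fun X => extd₁ (fun A => g.tensor A e) X Y x) x := by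
  refine ⟨fun {u X} hu hX => ?_, fun {X X'} hX hX' => ?_⟩
  · have b : brk (u • X) Y x = -(dir Y u x • X x) + u x • brk X Y x := brk_smul_left hu hX
    have k : g.tensor (u • X) e = fun y => u y * g.tensor X e y := Metric.tensor_smul_left g u X e
    simp only [extd₁, k, dir_smul_left]
    rw [dir_mul hu (g.diffAt_tensor hX he)]
    simp only [Metric.tensor, b, map_add, map_neg, map_smul, add_apply, neg_apply,
      smul_apply, smul_eq_mul]
    ring
  · have b : brk (X + X') Y x = brk X Y x + brk X' Y x := brk_add_left hX hX'
    have k : g.tensor (X + X') e = fun y => g.tensor X e y + g.tensor X' e y :=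
      Metric.tensor_add_left g X X' e
    simp only [extd₁, k, dir_add_left]
    rw [dir_add (g.diffAt_tensor hX he) (g.diffAt_tensor hX' he)]
    simp only [Metric.tensor, b, map_add, add_apply]
    ring

theorem extd₁_swap (α : Tensor₁ I M) {X Y : VF I M} {x : M}
    (h : ∀ A : VF I M, A x = -brk Y X x → α A x = -α (brk Y X) x) :
    extd₁ α X Y x = -extd₁ α Y X x := by
  simp only [extd₁]
  rw [h (brk X Y) (brk_swap X Y x)]
  ring

namespace IsFibreFrame

variable {U : Set M} {e : Fin 4 → VF I M} {ψ : M → ℝ} {θ σ : Fin 4 → M → ℝ}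
  (h : IsFibreFrame J g U e ψ θ σ) (h1 : ∀ y ∈ U, ψ y = 1)
include h h1

/-- The curvature of the connection form `g(e 0, ·)`. -/
theorem extd₁_inner {x : M} (hx : x ∈ U) {X Y : VF I M} (hX : DiffAt X x) (hY : DiffAt Y x) :
    extd₁ (fun A => g.tensor A (e 0)) X Y x = θ 0 x *
      (g.tensor X (e 2) x * g.tensor Y (e 3) x - g.tensor X (e 3) x * g.tensor Y (e 2) x) := by
  have ht := h.isTorusFrame h1
  have de : ∀ i, DiffAt (e i) x := fun i => (h.smooth i x hx).diffAt
  have sw : ∀ A B : VF I M, extd₁ (fun A => g.tensor A (e 0)) A B x =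
      -extd₁ (fun A => g.tensor A (e 0)) B A x := fun A B =>
    extd₁_swap _ fun C hC => by simp [Metric.tensor, hC]
  -- On frame fields only the bracket term survives, and only [e2, e3] has a component along e0,
  -- namely -θ0.
  have hf : ∀ i j, extd₁ (fun A => g.tensor A (e 0)) (e i) (e j) x = θ 0 x * areaForm i j := by
    intro i j
    have hc : ∀ A : VF I M, ∀ k, dir A (g.tensor (e k) (e 0)) x = 0 := fun A k => by
      rw [dir_congr_on (u := g.tensor (e k) (e 0)) h.isOpen hx fun y hy => ht.inner y hy k 0,
        dir_const]
    simp only [extd₁, hc, Metric.tensor, ht.inner_brk hx]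
    fin_cases i <;> fin_cases j <;> simp [structFn, wedgeArea, areaForm_table]
  rw [TensorialAt.apply_sum (tensorialAt_extd₁_inner (de 0)) de hX _ (ht.eq_sum hx (X x))]
  have key : ∀ i, extd₁ (fun A => g.tensor A (e 0)) (e i) Y x =
      ∑ j, g.tensor Y (e j) x * (θ 0 x * areaForm i j) := fun i => by
    rw [sw, TensorialAt.apply_sum (tensorialAt_extd₁_inner (de 0)) de hY _
      (ht.eq_sum hx (Y x)), ← Finset.sum_neg_distrib]
    refine Finset.sum_congr rfl fun j _ => ?_
    rw [← mul_neg, ← sw, hf]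
    rfl
  simp only [key, Fin.sum_univ_four, areaForm_table, Metric.tensor]
  ring

variable (hJ : IsAlmostComplex J) {f : M → ℝ} (hs : IsSteadySoliton J g f)
include hJ hs

theorem smoothAt_app_grad (x : M) : SmoothAt (app J (grad g f)) x :=
  hJ.smooth _ _ (smoothAt_grad (hs.smooth x))

/-- The flow of `J ∇f` preserves the horizontal part of the metric. -/
theorem lieDeriv₂_horizontal {T : Tensor₂ I M}
    (hT : ∀ y ∈ U, ∀ A B : VF I M, T A B y =
      g.tensor A (e 2) y * g.tensor B (e 2) y + g.tensor A (e 3) y * g.tensor B (e 3) y)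
    {x : M} (hx : x ∈ U) {X Y : VF I M} (hX : SmoothAt X x) (hY : SmoothAt Y x) :
    lieDeriv₂ (app J (grad g f)) T X Y x = 0 := by
  obtain ⟨κ, hκ⟩ := h.exists_rotation h1 hJ hs hx
  obtain ⟨r1, r2⟩ := hκ X hX.diffAt
  obtain ⟨r3, r4⟩ := hκ Y hY.diffAt
  have sX : ∀ i, FnSmoothAt I (g.tensor X (e i)) x := fun i =>
    g.smoothAt_tensor hX (h.smooth i x hx)
  have sY : ∀ i, FnSmoothAt I (g.tensor Y (e i)) x := fun i =>
    g.smoothAt_tensor hY (h.smooth i x hx)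
  have sXY : ∀ i j, FnDiffAt I (fun y => g.tensor X (e i) y * g.tensor Y (e j) y) x := fun i j =>
    (FnSmoothAt.mul (sX i) (sY j)).diffAt
  rw [lieDeriv₂, hT x hx, hT x hx, dir_congr_on h.isOpen hx fun y hy => hT y hy X Y,
    dir_add (sXY 2 2) (sXY 3 3),
    dir_mul (sX 2).diffAt (sY 2).diffAt, dir_mul (sX 3).diffAt (sY 3).diffAt]
  change _ - (g.inner x (brk _ X x) _ * _ + g.inner x (brk _ X x) _ * _)
    - (_ * g.inner x (brk _ Y x) _ + _ * g.inner x (brk _ Y x) _) = 0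
  -- The κ terms cancel, as the metric of the plane is rotation invariant.
  rw [r1, r2, r3, r4]
  ring

/-- The flow of `J ∇f` preserves multiples of the horizontal area form by invariant functions. -/
theorem lieDeriv₂_area {T : Tensor₂ I M} {a : M → ℝ}
    (hT : ∀ y ∈ U, ∀ A B : VF I M, DiffAt A y → DiffAt B y → T A B y = a y *
      (g.tensor A (e 2) y * g.tensor B (e 3) y - g.tensor A (e 3) y * g.tensor B (e 2) y))
    {x : M} (hx : x ∈ U) (ha : FnDiffAt I a x) (ha0 : dir (app J (grad g f)) a x = 0)
    {X Y : VF I M} (hX : SmoothAt X x) (hY : SmoothAt Y x) :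
    lieDeriv₂ (app J (grad g f)) T X Y x = 0 := by
  obtain ⟨κ, hκ⟩ := h.exists_rotation h1 hJ hs hx
  obtain ⟨r1, r2⟩ := hκ X hX.diffAt
  obtain ⟨r3, r4⟩ := hκ Y hY.diffAt
  have hV := h.smoothAt_app_grad h1 hJ hs x
  have sX : ∀ i, FnSmoothAt I (g.tensor X (e i)) x := fun i =>
    g.smoothAt_tensor hX (h.smooth i x hx)
  have sY : ∀ i, FnSmoothAt I (g.tensor Y (e i)) x := fun i =>
    g.smoothAt_tensor hY (h.smooth i x hx)
  have sXY : ∀ i j, FnDiffAt I (fun y => g.tensor X (e i) y * g.tensor Y (e j) y) x := fun i j =>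
    (FnSmoothAt.mul (sX i) (sY j)).diffAt
  -- T(X, Y) is differentiated at x, so its formula is needed at nearby points; there X and Y are
  -- still differentiable.
  have hTe : ∀ᶠ y in 𝓝 x, T X Y y = a y *
      (g.tensor X (e 2) y * g.tensor Y (e 3) y - g.tensor X (e 3) y * g.tensor Y (e 2) y) := by
    filter_upwards [h.isOpen.mem_nhds hx, hX.eventually_diffAt, hY.eventually_diffAt]
      with y hy h2 h3 using hT y hy X Y h2 h3
  rw [lieDeriv₂, hT x hx _ _ (hV.brk hX).diffAt hY.diffAt,
    hT x hx _ _ hX.diffAt (hV.brk hY).diffAt, dir_congr hTe,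
    dir_mul ha (FnSmoothAt.sub (FnSmoothAt.mul (sX 2) (sY 3)) (FnSmoothAt.mul (sX 3) (sY 2))).diffAt,
    dir_sub (sXY 2 3) (sXY 3 2),
    dir_mul (sX 2).diffAt (sY 3).diffAt, dir_mul (sX 3).diffAt (sY 2).diffAt, ha0]
  change _ - _ * (g.inner x (brk _ X x) _ * _ - g.inner x (brk _ X x) _ * _)
    - _ * (_ * g.inner x (brk _ Y x) _ - _ * g.inner x (brk _ Y x) _) = 0
  rw [r1, r2, r3, r4]
  ring

end IsFibreFrame

end VFCalc

/-! ### Smoothness and brackets on the cylinder. -/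

namespace SasakiType

open VFCalc Bundle Topology Filter

variable {N : Type*} [TopologicalSpace N] [ChartedSpace (EuclideanSpace ℝ (Fin 3)) N]
  [IsManifold (𝓡 3) ∞ N]

/-- The vector field on the cylinder with components `Y` along `N` and `s` along `ℝ`. -/
def lift (Y : VF (𝓡 3) N) (s : N × ℝ → ℝ) : VF cylModel (N × ℝ) :=
  fun p => ((Y p.1, s p) : EuclideanSpace ℝ (Fin 3) × ℝ)

theorem smoothAt_lift {Y : VF (𝓡 3) N} {s : N × ℝ → ℝ} {p : N × ℝ} (hY : SmoothAt Y p.1)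
    (hs : FnSmoothAt cylModel s p) : SmoothAt (lift Y s) p := by
  have : IsManifold (𝓡 3) 1 N := IsManifold.of_le (n := ∞) (by simp)
  have h1 : ContMDiffAt cylModel (𝓡 3).tangent ∞
      (fun q : N × ℝ => (⟨q.1, Y q.1⟩ : TangentBundle (𝓡 3) N)) p :=
    ContMDiffAt.comp (g := fun n : N => (⟨n, Y n⟩ : TangentBundle (𝓡 3) N)) p hY contMDiffAt_fst
  have h2 : ContMDiffAt cylModel 𝓘(ℝ, ℝ).tangent ∞
      (fun q : N × ℝ => (⟨q.2, s q⟩ : TangentBundle 𝓘(ℝ, ℝ) ℝ)) p := by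
    refine Bundle.contMDiffAt_totalSpace.2 ⟨contMDiffAt_snd, ?_⟩
    convert! hs with y
    simp
  exact (contMDiff_equivTangentBundleProd_symm (I := 𝓡 3) (M := N) (I' := 𝓘(ℝ, ℝ))
    (M' := ℝ) (n := ∞)).contMDiffAt.comp p (h1.prodMk h2)

theorem smoothAt_fst {X : VF cylModel (N × ℝ)} {p : N × ℝ} (hX : SmoothAt X p) :
    ContMDiffAt cylModel (𝓡 3).tangent ∞
      (fun q : N × ℝ => (⟨q.1, (X q).1⟩ : TangentBundle (𝓡 3) N)) p := by
  have : IsManifold (𝓡 3) 1 N := IsManifold.of_le (n := ∞) (by simp)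
  exact ((contMDiff_equivTangentBundleProd (I := 𝓡 3) (M := N) (I' := 𝓘(ℝ, ℝ))
    (M' := ℝ) (n := ∞)).contMDiffAt.comp p hX).fst

theorem smoothAt_snd {X : VF cylModel (N × ℝ)} {p : N × ℝ} (hX : SmoothAt X p) :
    FnSmoothAt cylModel (fun q => ((X q).2 : ℝ)) p := by
  have : IsManifold (𝓡 3) 1 N := IsManifold.of_le (n := ∞) (by simp)
  have h1 : ContMDiffAt cylModel 𝓘(ℝ, ℝ).tangent ∞
      (fun q : N × ℝ => (⟨q.2, (X q).2⟩ : TangentBundle 𝓘(ℝ, ℝ) ℝ)) p :=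
    ((contMDiff_equivTangentBundleProd (I := 𝓡 3) (M := N) (I' := 𝓘(ℝ, ℝ))
      (M' := ℝ) (n := ∞)).contMDiffAt.comp p hX).snd
  exact (contMDiff_snd_tangentBundle_modelSpace ℝ 𝓘(ℝ, ℝ)).contMDiffAt.comp p h1

theorem smoothAt_inner_fst (h : Metric (𝓡 3) N) {X : VF cylModel (N × ℝ)} {Y : VF (𝓡 3) N}
    {p : N × ℝ} (hX : SmoothAt X p) (hY : SmoothAt Y p.1) :
    FnSmoothAt cylModel (fun q => h.inner q.1 (X q).1 (Y q.1)) p := by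
  have h1 : ContMDiffAt cylModel ((𝓡 3).prod 𝓘(ℝ)) ∞
      (fun q : N × ℝ => TotalSpace.mk' ℝ (E := Bundle.Trivial N ℝ) q.1
        (h.inner q.1 (X q).1 (Y q.1))) p := by
    have h2 : ContMDiffAt cylModel ((𝓡 3).prod 𝓘(ℝ, EuclideanSpace ℝ (Fin 3))) ∞
        (fun q : N × ℝ => TotalSpace.mk' (EuclideanSpace ℝ (Fin 3))
          (E := (TangentSpace (𝓡 3) : N → Type _)) q.1 (X q).1) p := smoothAt_fst hX
    refine ContMDiffAt.clm_bundle_apply₂ (F₁ := EuclideanSpace ℝ (Fin 3))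
      (F₂ := EuclideanSpace ℝ (Fin 3)) (F₃ := ℝ) (E₁ := (TangentSpace (𝓡 3) : N → Type _))
      (E₂ := (TangentSpace (𝓡 3) : N → Type _)) (E₃ := Bundle.Trivial N ℝ) (b := fun q : N × ℝ => q.1) (v := fun q : N × ℝ => (X q).1)
      (w := fun q : N × ℝ => Y q.1) ?_ h2 ?_
    · exact ContMDiffAt.comp (g := fun n : N => TotalSpace.mk'
        (EuclideanSpace ℝ (Fin 3) →L[ℝ] EuclideanSpace ℝ (Fin 3) →L[ℝ] ℝ)
        (E := fun x : N => (TangentSpace (𝓡 3) x →L[ℝ] TangentSpace (𝓡 3) x →L[ℝ] ℝ))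
        n (h.inner n)) p h.contMDiff.contMDiffAt contMDiffAt_fst
    · exact ContMDiffAt.comp (g := fun n : N => (⟨n, Y n⟩ : TangentBundle (𝓡 3) N)) p hY
        contMDiffAt_fst
  simp only [contMDiffAt_totalSpace] at h1
  exact h1.2

theorem dir_comp_fst {X : VF cylModel (N × ℝ)} {u : N → ℝ} {p : N × ℝ}
    (hu : FnDiffAt (𝓡 3) u p.1) :
    dir X (fun q => u q.1) p = mvfderiv (𝓡 3) u p.1 (X p).1 := by
  have h := mfderiv_comp_apply (I := cylModel) (I' := 𝓡 3) (I'' := 𝓘(ℝ, ℝ)) (g := u)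
    (f := Prod.fst) p hu mdifferentiableAt_fst (X p)
  rw [mfderiv_fst] at h
  exact h

theorem dir_snd {X : VF cylModel (N × ℝ)} {p : N × ℝ} :
    dir X (fun q => q.2) p = (X p).2 := by
  change mfderiv cylModel 𝓘(ℝ, ℝ) (Prod.snd : N × ℝ → ℝ) p (X p) = _
  rw [mfderiv_snd]
  rfl

section brackets

variable (S : SasakianStructure (𝓡 3) N)

theorem smoothAt_Z (p : N × ℝ) : SmoothAt (Z S) p :=
  smoothAt_lift (s := fun _ => 0) (S.reeb_smooth p.1) contMDiffAt_const

theorem smoothAt_zero (n : N) : SmoothAt (fun _ => 0 : VF (𝓡 3) N) n := by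
  obtain ⟨X, U, -, hn, hX, -⟩ := exists_smooth_extension (0 : TangentSpace (𝓡 3) n)
  simpa using (hX n hn).const_smul 0

theorem smoothAt_W (p : N × ℝ) : SmoothAt (W N) p :=
  smoothAt_lift (Y := fun _ => 0) (s := fun _ => 1) (smoothAt_zero p.1) contMDiffAt_const

/-- A vector is zero once it annihilates the coordinate functions. On chart functions u of N one has
W u = 0, and Z u is again pulled back from N; on t one has W t = 1 and Z t = 0. All commutators
vanish. -/
theorem brk_Z_W (p : N × ℝ) : brk (Z S) (W N) p = 0 := by
  have : IsManifold (𝓡 3) 1 N := IsManifold.of_le (n := ∞) (by simp)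
  have hZ := smoothAt_Z S p
  have hW := smoothAt_W (N := N) p
  refine Prod.ext ?_ ?_
  · let φ := extChartAt (𝓡 3) p.1
    have hφ : ContMDiffAt (𝓡 3) 𝓘(ℝ, EuclideanSpace ℝ (Fin 3)) ∞ φ p.1 := contMDiffAt_extChartAt
    have key : ∀ i, mfderiv (𝓡 3) 𝓘(ℝ, ℝ) (fun n => φ n i) p.1 (brk (Z S) (W N) p).1 = 0 := by
      intro i
      let u : N → ℝ := fun n => φ n i
      have hu : ∀ n ∈ φ.source, FnSmoothAt (𝓡 3) u n := fun n hn =>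
        (EuclideanSpace.proj i : EuclideanSpace ℝ (Fin 3) →L[ℝ] ℝ).contDiff.contDiffAt.contMDiffAt.comp
          (f := φ) n (contMDiffAt_extChartAt' (by rwa [extChartAt_source] at hn))
      have hp : p.1 ∈ φ.source := mem_extChartAt_source p.1
      have hO : IsOpen {q : N × ℝ | q.1 ∈ φ.source} :=
        (isOpen_extChartAt_source p.1).preimage continuous_fst
      have hu2 : FnSmoothAt cylModel (fun q : N × ℝ => u q.1) p :=
        ContMDiffAt.comp (g := u) p (hu _ hp) contMDiffAt_fst
      have h1 := dir_brk hZ hW hu2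
      rw [dir_comp_fst (hu _ hp).diffAt,
        dir_congr_on (u := dir (W N) fun q : N × ℝ => u q.1) (v := fun _ => 0) hO hp
          (fun q hq => by rw [dir_comp_fst (hu _ hq).diffAt]; exact map_zero _), dir_const,
        dir_congr_on (u := dir (Z S) fun q : N × ℝ => u q.1) (v := fun q => dir S.reeb u q.1) hO hp
          (fun q hq => dir_comp_fst (hu _ hq).diffAt),
        dir_comp_fst ((S.reeb_smooth p.1).dir (hu _ hp)).diffAt] at h1
      have h2 : mvfderiv (𝓡 3) (dir S.reeb u) p.1 (W N p).1 = 0 := map_zero _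
      rw [h2, sub_zero] at h1
      exact h1
    refine (isInvertible_mfderiv_extChartAt (I := 𝓡 3) (mem_extChartAt_source p.1)).bijective.1
      (Eq.trans ?_ (map_zero _).symm)
    refine PiLp.ext fun i => ?_
    let P : EuclideanSpace ℝ (Fin 3) →L[ℝ] ℝ := EuclideanSpace.proj i
    have hc := mfderiv_comp_apply (I := 𝓡 3) (I' := 𝓘(ℝ, EuclideanSpace ℝ (Fin 3)))
      (I'' := 𝓘(ℝ, ℝ)) (g := P) (f := φ)
      p.1 P.differentiableAt.mdifferentiableAt
      (hφ.mdifferentiableAt (by simp)) (brk (Z S) (W N) p).1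
    rw [mfderiv_eq_fderiv, ContinuousLinearMap.fderiv] at hc
    exact hc.symm.trans (key i)
  · have h1 := dir_brk (u := fun q : N × ℝ => q.2) hZ hW contMDiffAt_snd
    have e1 : dir (W N) (fun q : N × ℝ => q.2) = fun _ => 1 := funext fun q => dir_snd
    have e2 : dir (Z S) (fun q : N × ℝ => q.2) = fun _ => 0 := funext fun q => dir_snd
    rw [dir_snd, e1, e2, dir_const, dir_const, sub_zero] at h1
    exact h1

end brackets

end SasakiType

/-! ### The endomorphism Φ of a Sasakian manifold. -/

namespace VFCalc

open Topology

namespace SasakianStructure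

variable {E : Type*} [NormedAddCommGroup E] [NormedSpace ℝ E] [FiniteDimensional ℝ E]
  {H : Type*} [TopologicalSpace H] {I : ModelWithCorners ℝ E H}
  {M : Type*} [TopologicalSpace M] [ChartedSpace H M] [IsManifold I ∞ M]
  (S : SasakianStructure I M)

theorem inner_nabla_reeb (x : M) (v : TangentSpace I x) :
    S.metric.inner x (nabla S.metric S.reeb x v) (S.reeb x) = 0 := by
  obtain ⟨X, hX, rfl⟩ := exists_smoothAt_extension v
  have h1 := dir_tensor (g := S.metric) hX (S.reeb_smooth x) (S.reeb_smooth x)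
  have h2 : S.metric.tensor S.reeb S.reeb = fun _ => 1 := funext S.unit_length
  rw [h2, dir_const, S.metric.symm_apply (S.reeb x)] at h1
  have h3 : S.metric.inner x (cov S.metric X S.reeb x) (S.reeb x) = 0 := by linarith
  exact h3

/-- The Killing equation, rewritten through metric compatibility and vanishing torsion. -/
theorem inner_nabla_swap (x : M) (v w : TangentSpace I x) :
    S.metric.inner x (nabla S.metric S.reeb x v) w =
      -S.metric.inner x (nabla S.metric S.reeb x w) v := by
  obtain ⟨X, hX, rfl⟩ := exists_smoothAt_extension v
  obtain ⟨Y, hY, rfl⟩ := exists_smoothAt_extension w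
  have h1 := dir_tensor (g := S.metric) (S.reeb_smooth x) hX hY
  have h2 := inner_brk_of_killing S.killing hX hY
  have h3 := cov_sub_cov (g := S.metric) (S.reeb_smooth x) hX
  have h4 := cov_sub_cov (g := S.metric) (S.reeb_smooth x) hY
  rw [← h3, ← h4, h1] at h2
  simp only [map_sub, sub_apply] at h2
  rw [S.metric.symm_apply (X x) (cov S.metric Y S.reeb x)] at h2
  change S.metric.inner x (cov S.metric X S.reeb x) (Y x) =
    -S.metric.inner x (cov S.metric Y S.reeb x) (X x)
  linarith

/-- By skewness the square length of ∇_Z Z is minus the product of ∇_v Z with Z for v = ∇_Z Z, which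
is zero as Z has unit length. -/
theorem nabla_reeb_reeb (x : M) : nabla S.metric S.reeb x (S.reeb x) = 0 := by
  refine Metric.eq_zero_of_inner_self (g := S.metric) ?_
  rw [S.inner_nabla_swap, S.inner_nabla_reeb, neg_zero]

/-- The Sasaki equation with Y = Z: since Φ Z vanishes identically, only -Φ(Φ X) is left on its
left-hand side. This yields J² = -1. -/
theorem nabla_nabla_reeb (x : M) (v : TangentSpace I x) :
    nabla S.metric S.reeb x (nabla S.metric S.reeb x v) =
      -v + S.metric.inner x (S.reeb x) v • S.reeb x := by
  obtain ⟨X, hX, rfl⟩ := exists_smoothAt_extension v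
  have h1 := S.sasaki x X S.reeb hX (S.reeb_smooth x)
  have h2 : cov S.metric S.reeb S.reeb = fun y => (0 : ℝ) • S.reeb y := funext fun y => by
    rw [zero_smul]; exact S.nabla_reeb_reeb y
  have h3 : cov S.metric X (cov S.metric S.reeb S.reeb) x = 0 := by
    rw [h2, cov_smul_right (u := fun _ => 0) hX mdifferentiableAt_const (S.reeb_smooth x).diffAt,
      dir_const, zero_smul, zero_smul, add_zero]
  rw [h3, S.unit_length, one_smul, zero_sub, S.metric.symm_apply (X x)] at h1
  have h4 := neg_eq_iff_eq_neg.1 h1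
  rw [neg_sub, sub_eq_neg_add] at h4
  exact h4

end SasakianStructure

end VFCalc

/-! ### The almost complex structure and the torus action on the cylinder. -/

namespace SasakiType

open VFCalc Topology Filter

variable {N : Type*} [TopologicalSpace N] [ChartedSpace (EuclideanSpace ℝ (Fin 3)) N]
  [IsManifold (𝓡 3) ∞ N] (S : SasakianStructure (𝓡 3) N)

theorem app_J_Z : app (J S) (Z S) = W N := by
  funext p
  refine Prod.ext ?_ (S.unit_length p.1)
  change nabla S.metric S.reeb p.1 (S.reeb p.1) - (0 : ℝ) • S.reeb p.1 = 0
  rw [S.nabla_reeb_reeb, zero_smul, sub_zero]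

theorem J_sq (p : N × ℝ) (v : TangentSpace cylModel p) : J S p (J S p v) = -v := by
  have hr := (S.reeb_smooth p.1).diffAt
  let w : TangentSpace (𝓡 3) p.1 := v.1
  let s : ℝ := v.2
  refine Prod.ext ?_ ?_
  · change nabla S.metric S.reeb p.1 (nabla S.metric S.reeb p.1 w - s • S.reeb p.1)
      - S.metric.inner p.1 (S.reeb p.1) w • S.reeb p.1 = -w
    rw [sub_eq_add_neg (nabla S.metric S.reeb p.1 w), ← neg_smul, nabla_add hr, nabla_smul hr,
      S.nabla_reeb_reeb, S.nabla_nabla_reeb, smul_zero, add_zero, add_sub_cancel_right]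
  · change S.metric.inner p.1 (S.reeb p.1) (nabla S.metric S.reeb p.1 w - s • S.reeb p.1) = -s
    rw [map_sub, map_smul, S.unit_length, S.metric.symm_apply, S.inner_nabla_reeb, smul_eq_mul]
    ring

/-- J is defined fibrewise through chosen values of ∇Z. In a local orthonormal frame of N, J X is a
combination of the lifted fields (Φ e_i, η(e_i)) and of Z, with smooth coefficients. -/
theorem smoothAt_app_J {X : VF cylModel (N × ℝ)} {p : N × ℝ} (hX : SmoothAt X p) :
    SmoothAt (app (J S) X) p := by
  obtain ⟨U, e, hp, he⟩ := exists_orthonormalFrame S.metric p.1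
  have hU : IsOpen {q : N × ℝ | q.1 ∈ U} := he.isOpen.preimage continuous_fst
  have sΦ : ∀ i, SmoothAt (cov S.metric (e i) S.reeb) p.1 := fun i =>
    SmoothAt.cov (Filter.eventually_of_mem (he.isOpen.mem_nhds hp) (he.smooth i))
      (Filter.Eventually.of_forall S.reeb_smooth)
  let c : Fin _ → N × ℝ → ℝ := fun i q => S.metric.inner q.1 (X q).1 (e i q.1)
  let F : Fin _ → VF cylModel (N × ℝ) := fun i =>
    lift (cov S.metric (e i) S.reeb) fun q => S.metric.tensor S.reeb (e i) q.1
  have sc : ∀ i, FnSmoothAt cylModel (c i) p := fun i =>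
    smoothAt_inner_fst S.metric hX (he.smooth i p.1 hp)
  have sF : ∀ i, SmoothAt (F i) p := fun i =>
    smoothAt_lift (sΦ i) (ContMDiffAt.comp (g := S.metric.tensor S.reeb (e i)) p
      (S.metric.smoothAt_tensor (S.reeb_smooth p.1) (he.smooth i p.1 hp)) contMDiffAt_fst)
  have hs : SmoothAt (fun q => (∑ i, c i q • F i q) - ((X q).2 : ℝ) • Z S q) p :=
    SmoothAt.sub (SmoothAt.sum fun i _ => SmoothAt.smul (sc i) (sF i))
      (SmoothAt.smul (smoothAt_snd hX) (smoothAt_Z S p))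
  refine hs.congr_on hU hp fun q hq => ?_
  let w : TangentSpace (𝓡 3) q.1 := (X q).1
  let s : ℝ := (X q).2
  have hw : w = ∑ i, c i q • e i q.1 := he.eq_sum hq w
  let Φ : TangentSpace (𝓡 3) q.1 →ₗ[ℝ] TangentSpace (𝓡 3) q.1 :=
    { toFun := nabla S.metric S.reeb q.1
      map_add' := nabla_add (S.reeb_smooth q.1).diffAt
      map_smul' := nabla_smul (S.reeb_smooth q.1).diffAt }
  have h1 := map_sum (LinearMap.fst ℝ (EuclideanSpace ℝ (Fin 3)) ℝ)
    (fun i => c i q • (F i q : EuclideanSpace ℝ (Fin 3) × ℝ)) Finset.univ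
  have h2 := map_sum (LinearMap.snd ℝ (EuclideanSpace ℝ (Fin 3)) ℝ)
    (fun i => c i q • (F i q : EuclideanSpace ℝ (Fin 3) × ℝ)) Finset.univ
  refine Prod.ext ?_ ?_
  · have h3 : Φ w = ∑ i, c i q • cov S.metric (e i) S.reeb q.1 := by
      rw [hw, map_sum]
      simp only [map_smul]
      rfl
    exact congrArg (· - s • S.reeb q.1) (h3.trans h1.symm)
  · have h3 : S.metric.inner q.1 (S.reeb q.1) w =
        ∑ i, c i q • S.metric.tensor S.reeb (e i) q.1 := by
      rw [hw, map_sum]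
      simp only [map_smul]
      rfl
    refine (h3.trans h2.symm).trans (Eq.trans (sub_zero _).symm ?_)
    exact congrArg (fun z : ℝ => _ - z) (mul_zero s).symm

theorem isAlmostComplex_J : IsAlmostComplex (J S) where
  map_add p v w := by
    have hr := (S.reeb_smooth p.1).diffAt
    let v₁ : TangentSpace (𝓡 3) p.1 := v.1
    let w₁ : TangentSpace (𝓡 3) p.1 := w.1
    let v₂ : ℝ := v.2
    let w₂ : ℝ := w.2
    refine Prod.ext ?_ (map_add (S.metric.inner p.1 (S.reeb p.1)) v₁ w₁)
    change nabla S.metric S.reeb p.1 (v₁ + w₁) - (v₂ + w₂) • S.reeb p.1 =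
      (nabla S.metric S.reeb p.1 v₁ - v₂ • S.reeb p.1)
        + (nabla S.metric S.reeb p.1 w₁ - w₂ • S.reeb p.1)
    rw [nabla_add hr, add_smul, add_sub_add_comm]
  map_smul p c v := by
    have hr := (S.reeb_smooth p.1).diffAt
    let v₁ : TangentSpace (𝓡 3) p.1 := v.1
    let v₂ : ℝ := v.2
    refine Prod.ext ?_ (map_smul (S.metric.inner p.1 (S.reeb p.1)) c v₁)
    change nabla S.metric S.reeb p.1 (c • v₁) - (c * v₂) • S.reeb p.1 =
      c • (nabla S.metric S.reeb p.1 v₁ - v₂ • S.reeb p.1)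
    rw [nabla_smul hr, mul_smul, smul_sub]
  sq := J_sq S
  smooth _ _ hX := smoothAt_app_J S hX

theorem isTorusAction_Z {g : Metric cylModel (N × ℝ)} (hg : IsInvariant S g.tensor) :
    IsTorusAction (J S) g (Z S) where
  smooth := smoothAt_Z S
  ne_zero p h := by
    have h1 : S.reeb p.1 = 0 := congrArg Prod.fst h
    have h2 := S.unit_length p.1
    rw [h1, map_zero] at h2
    simp at h2
  killing := hg.1
  killing_app := by rw [app_J_Z]; exact hg.2
  brk_eq_zero p := by rw [app_J_Z, brk_Z_W]

theorem finrank_cyl : Module.finrank ℝ (EuclideanSpace ℝ (Fin 3) × ℝ) = 4 := by simp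

end SasakiType

/-! ### Constant fibre length and normalized frames on the cylinder. -/

namespace VFCalc

open Topology

variable {E : Type*} [NormedAddCommGroup E] [NormedSpace ℝ E] [FiniteDimensional ℝ E]
  {H : Type*} [TopologicalSpace H] {I : ModelWithCorners ℝ E H}
  {M : Type*} [TopologicalSpace M] [ChartedSpace H M] [IsManifold I ∞ M]
  {g : Metric I M} {J : (x : M) → TangentSpace I x → TangentSpace I x}

theorem IsFibreFrame.mono {U V : Set M} {e : Fin 4 → VF I M} {ψ : M → ℝ} {θ σ : Fin 4 → M → ℝ}
    (h : IsFibreFrame J g U e ψ θ σ) (hV : IsOpen V) (hVU : V ⊆ U) :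
    IsFibreFrame J g V e ψ θ σ where
  isOpen := hV
  finrank := h.finrank
  smooth i y hy := h.smooth i y (hVU hy)
  pos y hy := h.pos y (hVU hy)
  inner y hy := h.inner y (hVU hy)
  J_eq y hy := h.J_eq y (hVU hy)
  dir_zero y hy := h.dir_zero y (hVU hy)
  dir_one y hy := h.dir_one y (hVU hy)
  smooth_theta i y hy := h.smooth_theta i y (hVU hy)
  smooth_sigma i y hy := h.smooth_sigma i y (hVU hy)
  brk_eq y hy := h.brk_eq y (hVU hy)

end VFCalc

namespace SasakiType

open VFCalc Topology Filter

variable {N : Type*} [TopologicalSpace N] [ChartedSpace (EuclideanSpace ℝ (Fin 3)) N]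
  [IsManifold (𝓡 3) ∞ N] {S : SasakianStructure (𝓡 3) N} {g : Metric cylModel (N × ℝ)}

/-- ψ has zero derivative along W. It thus descends to N, where compactness provides a maximum that
the cylinder itself would not. -/
theorem psi_eq (hg : IsInvariant S g.tensor) (hh : IsHermitian (J S) g) (n : N) (t : ℝ) :
    psi S g (n, t) = psi S g (n, 0) := by
  have hd : ∀ s : ℝ, HasDerivAt (fun r => psi S g (n, r)) 0 s := fun s => by
    have h1 : HasMFDerivAt 𝓘(ℝ, ℝ) cylModel (fun r : ℝ => (n, r)) s
        (ContinuousLinearMap.smulRight (1 : ℝ →L[ℝ] ℝ) (W N (n, s))) := by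
      have h2 := (hasMFDerivAt_const (I := 𝓘(ℝ, ℝ)) (I' := 𝓡 3) n s).prodMk
        (hasMFDerivAt_id (I := 𝓘(ℝ, ℝ)) s)
      have h3 : (0 : ℝ →L[ℝ] EuclideanSpace ℝ (Fin 3)).prod (.id ℝ ℝ) =
          (1 : ℝ →L[ℝ] ℝ).smulRight ((0, 1) : EuclideanSpace ℝ (Fin 3) × ℝ) := by
        ext <;> simp
      exact HasMFDerivAt.congr_mfderiv h2 h3
    have h3 := hasDerivAt_comp_curve (γ := fun r : ℝ => (n, r)) (X := W N) (u := psi S g) h1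
      (g.smoothAt_tensor (smoothAt_Z S _) (smoothAt_Z S _)).diffAt
    have h4 := ((isTorusAction_Z S hg).dir_length (isAlmostComplex_J S) hh (n, s)).2
    rw [app_J_Z] at h4
    rwa [psi, h4] at h3
  exact is_const_of_deriv_eq_zero (fun s => (hd s).differentiableAt) (fun s => (hd s).deriv) t 0

/-- On the cylinder over a compact manifold, the fibre length function of an invariant
pluriclosed metric is locally constant. -/
theorem eventually_psi_eq [T2Space N] [CompactSpace N] (hg : IsInvariant S g.tensor)
    (hp : IsPluriclosed (J S) g) (p : N × ℝ) : ∀ᶠ q in 𝓝 p, psi S g q = psi S g p := by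
  have : LocallyConnectedSpace N :=
    ChartedSpace.locallyConnectedSpace (EuclideanSpace ℝ (Fin 3)) N
  have hconst : ∀ q : N × ℝ, psi S g q = psi S g (q.1, 0) := fun q => psi_eq hg hp.1 q.1 q.2
  let φ : N → ℝ := fun n => psi S g (n, 0)
  have cψ : Continuous (psi S g) := continuous_iff_continuousAt.2 fun q =>
    (g.smoothAt_tensor (smoothAt_Z S q) (smoothAt_Z S q)).continuousAt
  have cφ : Continuous φ := cψ.comp (by fun_prop)
  have hmax : ∀ n, (∀ᶠ m in 𝓝 n, φ m ≤ φ n) → ∀ᶠ m in 𝓝 n, φ m = φ n := fun n hn => by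
    have h1 : ∀ᶠ q in 𝓝 ((n, 0) : N × ℝ), psi S g q ≤ psi S g (n, 0) := by
      filter_upwards [(continuousAt_fst (p := ((n, 0) : N × ℝ))).eventually hn] with q hq
      rw [hconst]; exact hq
    have h2 := (isTorusAction_Z S hg).eventually_length_eq (isAlmostComplex_J S) hp finrank_cyl h1
    have h3 : ContinuousAt (fun m : N => (m, (0 : ℝ))) n := by fun_prop
    exact h3.eventually h2
  -- N need not be connected. On each component the maximum is attained, and by the strong maximum
  -- principle the set where it is attained is open and closed.
  let C := connectedComponent p.1
  have hC : IsOpen C := isOpen_connectedComponent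
  obtain ⟨n₁, hn₁, hm⟩ := (isClosed_connectedComponent (x := p.1)).isCompact.exists_isMaxOn
    ⟨p.1, mem_connectedComponent⟩ cφ.continuousOn
  let A : Set N := C ∩ φ ⁻¹' {φ n₁}
  have hA : IsClopen A := by
    refine ⟨isClosed_connectedComponent.inter (isClosed_singleton.preimage cφ), ?_⟩
    refine isOpen_iff_mem_nhds.2 fun n hn => ?_
    have hn2 : φ n = φ n₁ := hn.2
    have h1 : ∀ᶠ m in 𝓝 n, φ m ≤ φ n := by
      filter_upwards [hC.mem_nhds hn.1] with m hm'
      rw [hn2]; exact hm hm'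
    filter_upwards [hC.mem_nhds hn.1, hmax n h1] with m hm1 hm2 using ⟨hm1, hm2.trans hn2⟩
  have hsub : C ⊆ A := isPreconnected_connectedComponent.subset_isClopen hA ⟨n₁, hn₁, hn₁, rfl⟩
  filter_upwards [continuousAt_fst.preimage_mem_nhds (hC.mem_nhds mem_connectedComponent)]
    with q hq
  rw [hconst q, hconst p]
  exact (hsub hq).2.trans (hsub mem_connectedComponent).2.symm

/-- The normalized situation: around every point there is a frame whose first field is a
constant multiple of the Reeb field. -/
theorem exists_normalized_frame [T2Space N] [CompactSpace N] (hg : IsInvariant S g.tensor)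
    (hp : IsPluriclosed (J S) g) (p : N × ℝ) :
    ∃ (U : Set (N × ℝ)) (e : Fin 4 → VF cylModel (N × ℝ)) (ψ : N × ℝ → ℝ)
      (θ σ : Fin 4 → N × ℝ → ℝ) (c : ℝ), p ∈ U ∧ IsFibreFrame (J S) g U e ψ θ σ ∧
      (∀ q ∈ U, ψ q = 1) ∧ (∀ q, e 0 q = c • Z S q) ∧ (∀ q, e 1 q = c • W N q) ∧
      ∀ q ∈ U, c ^ 2 * psi S g q = 1 := by
  have hJ := isAlmostComplex_J S
  have hZ := isTorusAction_Z S hg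
  have hpos : 0 < psi S g p := g.pos p _ (hZ.ne_zero p)
  have hsq := Real.sqrt_pos.2 hpos
  -- The factor is a constant, so the rescaled field and its image under J are still commuting
  -- Killing fields. As ψ is constant near p, the rescaled field has unit length there and not only
  -- at p.
  have hc : (√(psi S g p))⁻¹ ≠ 0 := (inv_pos.2 hsq).ne'
  obtain ⟨V, hV1, hV, hpV⟩ := eventually_nhds_iff.1 (eventually_psi_eq hg hp p)
  obtain ⟨U, e, θ, σ, hpU, h, h0, h1⟩ :=
    (hZ.const_smul hJ hc).exists_fibreFrame hJ hp.1 finrank_cyl p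
  have hn : ∀ q ∈ U ∩ V, (√(psi S g p))⁻¹ ^ 2 * psi S g q = 1 := fun q hq => by
    rw [hV1 q hq.2, inv_pow, Real.sq_sqrt hpos.le, inv_mul_cancel₀ hpos.ne']
  refine ⟨U ∩ V, e, _, θ, σ, _, ⟨hpU, hpV⟩, h.mono (h.isOpen.inter hV) Set.inter_subset_left,
    fun q hq => ?_, fun q => by rw [h0], fun q => ?_, hn⟩
  · rw [← hn q hq]
    simp only [Metric.tensor, map_smul, smul_apply, smul_eq_mul, psi]
    ring
  · rw [h1, ← app_J_Z S]
    exact hJ.map_smul q _ _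

section components

variable {U : Set (N × ℝ)} {e : Fin 4 → VF cylModel (N × ℝ)} {ψ : N × ℝ → ℝ}
  {θ σ : Fin 4 → N × ℝ → ℝ} {c : ℝ} (h : IsFibreFrame (J S) g U e ψ θ σ)
  (h1 : ∀ q ∈ U, ψ q = 1) (hZ : ∀ q, e 0 q = c • Z S q) (hW : ∀ q, e 1 q = c • W N q)
  (hc : ∀ q ∈ U, c ^ 2 * psi S g q = 1)
include h h1 hZ hc

theorem muZ_eq {q : N × ℝ} (hq : q ∈ U) (A : VF cylModel (N × ℝ)) :
    muZ S g A q = c * g.tensor A (e 0) q := by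
  have hc' := hc q hq
  have hψ : psi S g q ≠ 0 := fun h0 => by rw [h0, mul_zero] at hc'; exact zero_ne_one hc'
  simp only [muZ, Metric.tensor, hZ, map_smul, smul_eq_mul]
  rw [g.symm_apply (A q), ← eq_inv_of_mul_eq_one_left hc']
  ring

/-- Since c is constant and c² = 1/ψ, the form μ^Z is c times g(e0, ·), and its differential is c
times the curvature θ0 A. -/
theorem FZ_eq {q : N × ℝ} (hq : q ∈ U) {A B : VF cylModel (N × ℝ)} (hA : DiffAt A q)
    (hB : DiffAt B q) : FZ S g A B q = c * θ 0 q *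
      (g.tensor A (e 2) q * g.tensor B (e 3) q - g.tensor A (e 3) q * g.tensor B (e 2) q) := by
  have he := (h.smooth 0 q hq).diffAt
  have h2 := h.extd₁_inner h1 hq hA hB
  rw [mul_assoc, ← h2]
  have hm := fun r (hr : r ∈ U) => muZ_eq h h1 hZ hc hr
  simp only [FZ, extd₁]
  rw [dir_congr_on h.isOpen hq fun r hr => hm r hr B,
    dir_congr_on h.isOpen hq fun r hr => hm r hr A, hm q hq,
    dir_const_mul _ (g.diffAt_tensor hA he), dir_const_mul _ (g.diffAt_tensor hB he)]
  ring

include hW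

/-- The subtracted terms are exactly the e0 and e1 parts of the metric, because ψ c² = 1. -/
theorem gT_eq {q : N × ℝ} (hq : q ∈ U) (A B : VF cylModel (N × ℝ)) :
    gT S g A B q = g.tensor A (e 2) q * g.tensor B (e 2) q
      + g.tensor A (e 3) q * g.tensor B (e 3) q := by
  have hc' := hc q hq
  have hψ : psi S g q ≠ 0 := fun h0 => by rw [h0, mul_zero] at hc'; exact zero_ne_one hc'
  have hi := eq_inv_of_mul_eq_one_left hc'
  have h2 : g.tensor A B q = ∑ i, g.tensor A (e i) q * g.tensor B (e i) q := by
    have := congrArg (g.inner q (A q)) ((h.isTorusFrame h1).eq_sum hq (B q))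
    simp only [map_sum, map_smul, smul_eq_mul] at this
    rw [Metric.tensor, this]
    exact Finset.sum_congr rfl fun i _ => mul_comm _ _
  have h3 : ∀ A, muW S g A q = c * g.tensor A (e 1) q := fun A => by
    simp only [muW, Metric.tensor, hW, map_smul, smul_eq_mul]
    rw [g.symm_apply (A q), ← hi]
    ring
  rw [gT, h2, h3, h3, muZ_eq h h1 hZ hc hq, muZ_eq h h1 hZ hc hq, Fin.sum_univ_four]
  linear_combination -(g.tensor A (e 0) q * g.tensor B (e 0) q
    + g.tensor A (e 1) q * g.tensor B (e 1) q) * hc'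

/-- The sign comes from the convention ω(X, Y) = g(X, JY), which with e3 = J e2 gives -1 on (e2,
e3). -/
theorem omegaT_eq (hh : IsHermitian (J S) g) {q : N × ℝ} (hq : q ∈ U) (A B : VF cylModel (N × ℝ)) :
    omegaT S g A B q = -1 *
      (g.tensor A (e 2) q * g.tensor B (e 3) q - g.tensor A (e 3) q * g.tensor B (e 2) q) := by
  have hj : ∀ i, g.tensor (app (J S) B) (e i) q = -g.inner q (B q) (J S q (e i q)) := fun i => by
    rw [inner_J_right (isAlmostComplex_J S) hh, neg_neg]
    rfl
  rw [omegaT, gT_eq h h1 hZ hW hc hq, hj, hj, h.J_eq q hq, h.J_eq q hq]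
  simp only [pairSign, pairIdx, Matrix.cons_val, neg_smul, one_smul, map_neg, Metric.tensor]
  ring

end components

end SasakiType

end

theorem proposition6p1 {N : Type*} [TopologicalSpace N] [T2Space N] [CompactSpace N]
    [ChartedSpace (EuclideanSpace ℝ (Fin 3)) N] [IsManifold (𝓡 3) ∞ N]
    (S : VFCalc.SasakianStructure (𝓡 3) N)
    (g : VFCalc.Metric SasakiType.cylModel (N × ℝ)) (f : N × ℝ → ℝ)
    (hg : SasakiType.IsInvariant S g.tensor)
    (hsol : VFCalc.IsSteadySoliton (SasakiType.J S) g f) :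
    VFCalc.Vanishes₂
        (VFCalc.lieDeriv₂ (VFCalc.app (SasakiType.J S) (VFCalc.grad g f)) (SasakiType.gT S g)) ∧
      VFCalc.Vanishes₂
        (VFCalc.lieDeriv₂ (VFCalc.app (SasakiType.J S) (VFCalc.grad g f))
          (SasakiType.omegaT S g)) ∧
      VFCalc.Vanishes₂
        (VFCalc.lieDeriv₂ (VFCalc.app (SasakiType.J S) (VFCalc.grad g f))
          (SasakiType.FZ S g)) := by
  have hJ := SasakiType.isAlmostComplex_J S
  refine ⟨fun p X Y hX hY => ?_, fun p X Y hX hY => ?_, fun p X Y hX hY => ?_⟩ <;>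
    obtain ⟨U, e, ψ, θ, σ, c, hp, h, h1, hZ, hW, hc⟩ :=
      SasakiType.exists_normalized_frame hg hsol.pluriclosed p
  · exact h.lieDeriv₂_horizontal h1 hJ hsol
      (fun q hq A B => SasakiType.gT_eq h h1 hZ hW hc hq A B) hp hX hY
  · exact h.lieDeriv₂_area h1 hJ hsol (a := fun _ => -1)
      (fun q hq A B _ _ => SasakiType.omegaT_eq h h1 hZ hW hc hsol.pluriclosed.1 hq A B) hp
      mdifferentiableAt_const (VFCalc.dir_const _) hX hY
  · have hθ := h.smooth_theta 0 p hp
    exact h.lieDeriv₂_area h1 hJ hsol (a := fun q => c * θ 0 q)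
      (fun q hq A B hA hB => SasakiType.FZ_eq h h1 hZ hc hq hA hB) hp
      (VFCalc.FnSmoothAt.const_mul c hθ).diffAt
      (by rw [VFCalc.dir_const_mul c hθ.diffAt, h.dir_app_grad_theta h1 hJ hsol hp, mul_zero]) hX hY
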